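/- Let $\alpha>0$. The $\alpha$-Grushin plane $G^2_\alpha$ is $\mathbb{R}^2$ with the Carnot–Carathéodory metric of the vector fields $X=\partial_x$, $Y_\alpha=|x|^\alpha\partial_y$; its topology is the Euclidean one, and "measure" and "a.e." refer to the Lebesgue measure on $\mathbb{R}^2$. **Definitions.** Let $\Omega,\Omega'\subset G^2_\alpha$ be open and $g=(g_1,g_2):\Omega\to\Omega'$. All partial derivatives are weak derivatives. * For $p\ge 1$, a real function $u$ is in $HW^{1,p}(U)$ if $u\in L^p(U)$, the weak derivatives $\partial_xu,\partial_yu$ exist on $U$, and $Xu=\partial_xu$, $Y_\alpha u=|x|^\alpha\partial_yu$ are in $L^p(U)$. We write $g\in HW^{1,p}_{\rm loc}(\Omega,\Omega')$ if $g_1,g_2\in HW^{1,p}(U)$ for every open $U$ whose closure is compact and contained in $\Omega$. * $S_g=\{(x,y)\in\Omega: x=0 \text{ or } g_1(x,y)=0\}$ is the singular set of $g$ and $R_g=\Omega\setminus S_g$ its regular set. * $g$ is orientation preserving if $g\in HW^{1,1}_{\rm loc}(\Omega,\Omega')$ and $J_g=X(g_1)Y_\alpha(g_2)-Y_\alpha(g_1)X(g_2)>0$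 a.e. in $\Omega$. * $g$ is conformal if it is a homeomorphism of $\Omega$ onto $\Omega'$, $g\in HW^{1,2}_{\rm loc}(\Omega,\Omega')$, and the matrix $$D_\alpha g=\begin{bmatrix}X(g_1)&Y_\alpha(g_1)\\ |g_1|^{-\alpha}X(g_2)&|g_1|^{-\alpha}Y_\alpha(g_2)\end{bmatrix}$$ is, at a.e. point of $R_g$, an orthogonal matrix multiplied by a positive number, and has at every point of $S_g$ a finite nonzero limit along $R_g$. (As $D_\alpha g$ is defined up to a null set, this is an essential limit, i.e. a limit along $R_g$ minus some null set.) * With $\varphi_\alpha(x,y)=\frac{x|x|^\alpha}{\alpha+1}+iy$ put $\overline{W}g=(\partial_x+i|x|^\alpha\partial_y)(\varphi_\alpha\circ g)$, an a.e. defined function on $\Omega$ (the derivatives are taken on $\Omega\setminus\{x=0\}$). **Theorem.** Let $\Omega,\Omega'$ be open sets in $G^2_\alpha$ and let $g=(g_1,g_2)\in HW^{1,\frac{2(\alpha+1)}{\alpha}}_{\rm loc}(\Omega,\Omega')$. Then the following hold. (a) If $\overline{W}g=0$ a.e. in $\Omega$, then there is $\hat g:\Omega\to\mathbb{R}^2$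 with $g=\hat g$ a.e. in $\Omega$ and $\hat g\in C^\infty(R_{\hat g})\cap C(\Omega)$. (b) If $g$ is an orientation preserving bijection of $\Omega$ onto $\Omega'$, then $|S_g|=0$. In particular, if $g$ is conformal and orientation preserving, then $\overline{W}g=0$ a.e. in $\Omega$. (c) If $g$ is a homeomorphism of $\Omega$ onto $\Omega'$, then $g$ is conformal and orientation preserving if and only if $\overline{W}g=0$ a.e. in $\Omega$ and $\{(x,y)\in\Omega: g_1(x,y)=0\}=\Omega\cap\{x=0\}$. (d) If $g$ is a homeomorphism of $\Omega$ onto $\Omega'$ and $\Omega\cap\{x=0\}$ has finitely many connected components, then $g$ is conformal and orientation preserving if and only if $\overline{W}g=0$ a.e. in $\Omega$ and the number of connected components of $\Omega'\cap\{x=0\}$ is the same as that of $\Omega\cap\{x=0\}$. -/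

import Mathlib

open MeasureTheory Set Filter Topology
open scoped ContDiff ENNReal

noncomputable section

namespace Grushin

/-- The `y`-axis `{x = 0}` of the plane. The `α`-Grushin plane is `ℝ × ℝ` as a set; its
Carnot-Carathéodory metric induces the Euclidean topology, and its measure is Lebesgue measure. -/
def yAxis : Set (ℝ × ℝ) := {p | p.1 = 0}

section WeakDerivatives

variable {F : Type*} [NormedAddCommGroup F] [NormedSpace ℝ F]

/-- On the open set `U`, the locally integrable function `v` is a weak derivative of the locally
integrable function `u` in the direction `e`. -/
def HasWeakPartial (U : Set (ℝ × ℝ)) (e : ℝ × ℝ) (u v : ℝ × ℝ → F) : Prop :=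
  LocallyIntegrableOn u U ∧ LocallyIntegrableOn v U ∧
    ∀ ψ : ℝ × ℝ → ℝ, ContDiff ℝ ∞ ψ → HasCompactSupport ψ → tsupport ψ ⊆ U →
      ∫ p in U, fderiv ℝ ψ p e • u p = -∫ p in U, ψ p • v p

open Classical in
/-- The weak derivative of `u` on `U` in the direction `e` (unique up to a null set); the value
is `0` when there is none. -/
def weakPartial (U : Set (ℝ × ℝ)) (e : ℝ × ℝ) (u : ℝ × ℝ → F) : ℝ × ℝ → F :=
  if h : ∃ v, HasWeakPartial U e u v then h.choose else 0

end WeakDerivatives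

/-- The horizontal Sobolev space `HW^{1,p,α}(U)` of real functions: `u`, `∂u/∂x` and
`|x|^α ∂u/∂y` lie in `L^p(U)`, where the partial derivatives are weak ones. -/
def HW (α : ℝ) (p : ℝ≥0∞) (U : Set (ℝ × ℝ)) (u : ℝ × ℝ → ℝ) : Prop :=
  MemLp u p (volume.restrict U) ∧
    ∃ ux uy : ℝ × ℝ → ℝ, HasWeakPartial U (1, 0) u ux ∧ HasWeakPartial U (0, 1) u uy ∧
      MemLp ux p (volume.restrict U) ∧
      MemLp (fun q => |q.1| ^ α * uy q) p (volume.restrict U)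

/-- The local horizontal Sobolev space of mappings `HW^{1,p,α}_loc(Ω,Ω')`: maps `Ω → Ω'` both of
whose components are in `HW^{1,p,α}(U)` for every open `U` compactly contained in `Ω`. -/
def HWloc (α : ℝ) (p : ℝ≥0∞) (Ω Ω' : Set (ℝ × ℝ)) (g : ℝ × ℝ → ℝ × ℝ) : Prop :=
  MapsTo g Ω Ω' ∧
    ∀ U : Set (ℝ × ℝ), IsOpen U → IsCompact (closure U) → closure U ⊆ Ω →
      HW α p U (fun q => (g q).1) ∧ HW α p U (fun q => (g q).2)

/-- The horizontal derivative `X u = ∂u/∂x` on `Ω`. -/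
def X (Ω : Set (ℝ × ℝ)) (u : ℝ × ℝ → ℝ) : ℝ × ℝ → ℝ :=
  weakPartial Ω (1, 0) u

/-- The horizontal derivative `Y_α u = |x|^α ∂u/∂y` on `Ω`. -/
def Y (α : ℝ) (Ω : Set (ℝ × ℝ)) (u : ℝ × ℝ → ℝ) : ℝ × ℝ → ℝ :=
  fun q => |q.1| ^ α * weakPartial Ω (0, 1) u q

/-- The matrix `D_H g`. -/
def horizontalD (α : ℝ) (Ω : Set (ℝ × ℝ)) (g : ℝ × ℝ → ℝ × ℝ) (q : ℝ × ℝ) :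
    Matrix (Fin 2) (Fin 2) ℝ :=
  !![X Ω (fun r => (g r).1) q, Y α Ω (fun r => (g r).1) q;
     X Ω (fun r => (g r).2) q, Y α Ω (fun r => (g r).2) q]

/-- The matrix `D_α g`: the second row of `D_H g` is divided by `|g₁|^α`. It is only used at
points where `g₁ ≠ 0`. -/
def grushinD (α : ℝ) (Ω : Set (ℝ × ℝ)) (g : ℝ × ℝ → ℝ × ℝ) (q : ℝ × ℝ) :
    Matrix (Fin 2) (Fin 2) ℝ :=
  !![X Ω (fun r => (g r).1) q, Y α Ω (fun r => (g r).1) q;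
     X Ω (fun r => (g r).2) q / |(g q).1| ^ α, Y α Ω (fun r => (g r).2) q / |(g q).1| ^ α]

/-- The singular set `S_g`. -/
def singularSet (Ω : Set (ℝ × ℝ)) (g : ℝ × ℝ → ℝ × ℝ) : Set (ℝ × ℝ) :=
  {q ∈ Ω | q.1 = 0 ∨ (g q).1 = 0}

/-- The regular set `R_g`. -/
def regularSet (Ω : Set (ℝ × ℝ)) (g : ℝ × ℝ → ℝ × ℝ) : Set (ℝ × ℝ) :=
  Ω \ singularSet Ω g

/-- `g` restricts to a homeomorphism of `Ω` onto `Ω'`. -/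
def IsHomeo (Ω Ω' : Set (ℝ × ℝ)) (g : ℝ × ℝ → ℝ × ℝ) : Prop :=
  ∃ h : Ω ≃ₜ Ω', ∀ q : Ω, (h q : ℝ × ℝ) = g q

/-- `g` is orientation preserving: `g ∈ HW^{1,1}_loc(Ω,Ω')` and `J_g = det D_H g > 0` a.e. -/
def OrientationPreserving (α : ℝ) (Ω Ω' : Set (ℝ × ℝ)) (g : ℝ × ℝ → ℝ × ℝ) : Prop :=
  HWloc α 1 Ω Ω' g ∧ ∀ᵐ q ∂(volume.restrict Ω), 0 < (horizontalD α Ω g q).det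

/-- `g` is conformal: a homeomorphism in `HW^{1,2}_loc(Ω,Ω')` such that `D_α g` is, a.e. in `R_g`,
a positive multiple of an orthogonal matrix, and has a finite nonzero limit at each point of
`S_g`. Since `D_α g` is only defined up to a null set, the limit is an essential one: it is taken
along the points of `R_g` outside a null set. -/
def Conformal (α : ℝ) (Ω Ω' : Set (ℝ × ℝ)) (g : ℝ × ℝ → ℝ × ℝ) : Prop :=
  HWloc α 2 Ω Ω' g ∧ IsHomeo Ω Ω' g ∧
    (∀ᵐ q ∂(volume.restrict (regularSet Ω g)),
      ∃ c : ℝ, 0 < c ∧ ∃ Q ∈ Matrix.orthogonalGroup (Fin 2) ℝ, grushinD α Ω g q = c • Q) ∧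
    ∀ q₀ ∈ singularSet Ω g, ∃ L : Matrix (Fin 2) (Fin 2) ℝ, L ≠ 0 ∧
      Tendsto (grushinD α Ω g) (𝓝[regularSet Ω g] q₀ ⊓ ae volume) (𝓝 L)

/-- The Meyerson map `φ_α(x,y) = x|x|^α/(α+1) + iy`. -/
def meyerson (α : ℝ) (q : ℝ × ℝ) : ℂ :=
  ⟨q.1 * |q.1| ^ α / (α + 1), q.2⟩

/-- The operator `W̄ g = (∂_x + i|x|^α ∂_y)(φ_α ∘ g)`. The derivatives are weak derivatives on the
open set `Ω \ {x = 0}`, which has full measure in `Ω`; across `{x = 0}` the function `φ_α ∘ g` of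
a map `g` of the local horizontal Sobolev space need not be locally integrable. -/
def Wbar (α : ℝ) (Ω : Set (ℝ × ℝ)) (g : ℝ × ℝ → ℝ × ℝ) (q : ℝ × ℝ) : ℂ :=
  weakPartial (Ω \ yAxis) (1, 0) (fun r => meyerson α (g r)) q +
    Complex.I * ((|q.1| ^ α : ℝ) : ℂ) *
      weakPartial (Ω \ yAxis) (0, 1) (fun r => meyerson α (g r)) q

end Grushin

end

/-! The Meyerson map `φ` has real part `u` with `du = |x|^α dx` and imaginary part `y`. It is a
homeomorphism of the plane onto `ℂ` carrying `|x|^α dx dy` to Lebesgue measure, and `∂_x + i|x|^α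
∂_y` is `|x|^α` times the Cauchy-Riemann operator in these coordinates. Hence `W̄g = 0` says that `h
= φ ∘ g ∘ φ⁻¹` is holomorphic. In components it reads `|g₁|^α X g₁ = Y g₂` and `|g₁|^α Y g₁ = -X
g₂`.

The delicate point is to cross the axis, where the weight degenerates and `φ ∘ g` need not be
integrable a priori. Off the axis, Sobolev embedding makes all powers of `g₁` locally integrable.
Across it, the equation replaces `|g₁|^α ∂_x g₁` by the integrable function `Y g₂`, and control of a
derivative transversal to the axis yields local integrability of `|g₁|^(α+1)` there
(`locallyIntegrableOn_signedPow_of_diff_yAxis`). Integration by parts against `Ψ ∘ φ` then gives the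
weak Cauchy-Riemann equation on all of `φ(Ω)`, and Weyl's lemma applies (`exists_holomorphic`). The
representative in (a) is `φ⁻¹ ∘ h ∘ φ`.

For (b), the weak gradient of `g₁` vanishes a.e. on `{g₁ = 0}`, so `J_g > 0` makes that set null; a
conformal matrix with positive Jacobian is a scaled rotation, which is the system above.

For (c), `h` is injective, so `h'` has no zeros, and `D_α g` is the matrix of `h'` times `|x|^α /
|g₁|^α`. A finite nonzero limit of `D_α g` at a singular point therefore prevents one of `x`, `g₁`
from vanishing without the other (`zeroSet_eq`). Conversely, if both vanish on the same set, `h`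
maps the axis into the axis, `h'` is real and nonzero there, and the ratio converges to `|Re
h'|^(-α/(α+1))` (`tendsto_weight_ratio`).

For (d) the exponent `s = 2(α+1)/α` is critical: near a zero `q₀` of `g₁` off the axis, the `s`-th
power of the gradient of `g₁` would dominate `|q - q₀|⁻²`, which is not integrable in the plane
(`fst_eq_zero`). So every zero lies on the axis. The zeros form a relatively clopen part of `Ω ∩ {x
= 0}`: on the two sides of a zero `g₁` has opposite signs, since otherwise `Re h` would have a local
extremum with `h' ≠ 0` (`eventually_fst_eq_zero`). This clopen part is homeomorphic to `Ω' ∩ {x =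
0}`, and equality of finite numbers of components forces it to be everything. -/

namespace Grushin

/-! ### Mollification and its convergence -/

section Mollification

open scoped Convolution

variable {E F : Type*} [NormedAddCommGroup E] [NormedSpace ℝ E] [FiniteDimensional ℝ E]
  [MeasurableSpace E] [BorelSpace E] {μ : Measure E} [μ.IsAddHaarMeasure]
  [NormedAddCommGroup F] [NormedSpace ℝ F] [CompleteSpace F]

/-- The mollification of `w` by a normed bump function. -/
noncomputable def mollify (μ : Measure E) (ρ : ContDiffBump (0 : E)) (w : E → F) : E → F :=
  ρ.normed μ ⋆[ContinuousLinearMap.lsmul ℝ ℝ, μ] w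

theorem mollify_enorm_le (ρ : ContDiffBump (0 : E)) (w : E → F) (x : E) :
    ‖mollify μ ρ w x‖ₑ ≤ ∫⁻ t, ENNReal.ofReal (ρ.normed μ t) * ‖w (x - t)‖ₑ ∂μ := by
  refine (enorm_integral_le_lintegral_enorm _).trans (le_of_eq (lintegral_congr fun t => ?_))
  rw [ContinuousLinearMap.lsmul_apply, enorm_smul, Real.enorm_of_nonneg (ρ.nonneg_normed t)]

theorem lintegral_normed_eq_one (ρ : ContDiffBump (0 : E)) :
    ∫⁻ t, ENNReal.ofReal (ρ.normed μ t) ∂μ = 1 := by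
  rw [← ofReal_integral_eq_lintegral_ofReal ρ.integrable_normed
    (Eventually.of_forall ρ.nonneg_normed), ρ.integral_normed, ENNReal.ofReal_one]

/-- Young's inequality for mollifications. -/
theorem eLpNorm_mollify_le (ρ : ContDiffBump (0 : E)) {w : E → F}
    (hw : AEStronglyMeasurable w μ) {p : ℝ≥0∞} (hp : 1 ≤ p) (hp' : p ≠ ⊤) :
    eLpNorm (mollify μ ρ w) p μ ≤ eLpNorm w p μ := by
  have hp0 : p ≠ 0 := (zero_lt_one.trans_le hp).ne'
  set r := p.toReal with hr
  have hr1 : 1 ≤ r := by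
    rw [hr, ← ENNReal.toReal_one]; exact (ENNReal.toReal_le_toReal (by simp) hp').2 hp
  have hr0 : 0 < r := by linarith
  rw [eLpNorm_eq_lintegral_rpow_enorm_toReal hp0 hp', eLpNorm_eq_lintegral_rpow_enorm_toReal hp0 hp']
  refine ENNReal.rpow_le_rpow ?_ (by positivity)
  rw [← hr]
  -- The kernel has mass one, so it defines a probability measure. Jensen's inequality for `w (x -
  -- ·)` under `ν`, then Tonelli and translation invariance, give the bound.
  set ν : Measure E := μ.withDensity (fun t => ENNReal.ofReal (ρ.normed μ t)) with hν
  have hmeas : Measurable (fun t => ENNReal.ofReal (ρ.normed μ t)) :=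
    (ρ.continuous_normed).measurable.ennreal_ofReal
  have : IsProbabilityMeasure ν := ⟨by
    rw [hν, withDensity_apply _ MeasurableSet.univ, Measure.restrict_univ,
      lintegral_normed_eq_one]⟩
  have hac : ν ≪ μ := withDensity_absolutelyContinuous _ _
  have hprod : AEMeasurable (fun q : E × E => ‖w (q.1 - q.2)‖ₑ ^ r) (μ.prod ν) := by
    have : AEStronglyMeasurable (fun q : E × E => w (q.1 - q.2)) (μ.prod μ) :=
      hw.comp_quasiMeasurePreserving (quasiMeasurePreserving_sub μ μ)
    exact (this.enorm.pow_const r).mono_ac (Measure.AbsolutelyContinuous.rfl.prod hac)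
  have key : ∀ x, ‖mollify μ ρ w x‖ₑ ^ r ≤ ∫⁻ t, ‖w (x - t)‖ₑ ^ r ∂ν := by
    intro x
    have h1 : ‖mollify μ ρ w x‖ₑ ≤ ∫⁻ t, ‖w (x - t)‖ₑ ∂ν := by
      refine (mollify_enorm_le ρ w x).trans (le_of_eq ?_)
      rw [hν, lintegral_withDensity_eq_lintegral_mul_non_measurable _ hmeas (by simp)]
      rfl
    have hwx : AEStronglyMeasurable (fun t => w (x - t)) ν :=
      (hw.comp_quasiMeasurePreserving (quasiMeasurePreserving_sub_left μ x)).mono_ac hac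
    have h2 := eLpNorm'_le_eLpNorm'_of_exponent_le (μ := ν) one_pos hr1 hwx
    simp only [eLpNorm', ENNReal.rpow_one, div_one] at h2
    calc _ ≤ (∫⁻ t, ‖w (x - t)‖ₑ ∂ν) ^ r := ENNReal.rpow_le_rpow h1 hr0.le
      _ ≤ ((∫⁻ t, ‖w (x - t)‖ₑ ^ r ∂ν) ^ (1 / r)) ^ r := ENNReal.rpow_le_rpow h2 hr0.le
      _ = _ := by rw [← ENNReal.rpow_mul, one_div_mul_cancel hr0.ne', ENNReal.rpow_one]
  calc ∫⁻ x, ‖mollify μ ρ w x‖ₑ ^ r ∂μ ≤ ∫⁻ x, ∫⁻ t, ‖w (x - t)‖ₑ ^ r ∂ν ∂μ := lintegral_mono key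
    _ = ∫⁻ t, ∫⁻ x, ‖w (x - t)‖ₑ ^ r ∂μ ∂ν := lintegral_lintegral_swap hprod
    _ = ∫⁻ t, ∫⁻ x, ‖w x‖ₑ ^ r ∂μ ∂ν := by
      refine lintegral_congr fun t => ?_
      exact lintegral_sub_right_eq_self (fun x => ‖w x‖ₑ ^ r) t
    _ = _ := by simp

theorem convolutionExists_mollify (ρ : ContDiffBump (0 : E)) {w : E → F}
    (hw : LocallyIntegrable w μ) :
    ConvolutionExists (ρ.normed μ) w (ContinuousLinearMap.lsmul ℝ ℝ) μ :=
  ρ.hasCompactSupport_normed.convolutionExists_left _ ρ.continuous_normed hw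

theorem mollify_sub (ρ : ContDiffBump (0 : E)) {w w' : E → F} (hw : LocallyIntegrable w μ)
    (hw' : LocallyIntegrable w' μ) :
    mollify μ ρ (w - w') = mollify μ ρ w - mollify μ ρ w' := by
  ext x
  have h1 := convolutionExists_mollify ρ hw x
  have h2 := convolutionExists_mollify ρ hw' x
  simp only [mollify, convolution_def, Pi.sub_apply, map_sub] 
  exact integral_sub h1 h2

theorem contDiff_mollify (ρ : ContDiffBump (0 : E)) {w : E → F} (hw : LocallyIntegrable w μ) :
    ContDiff ℝ ∞ (mollify μ ρ w) :=
  ρ.hasCompactSupport_normed.contDiff_convolution_left _ ρ.contDiff_normed hw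

theorem mollify_congr (ρ : ContDiffBump (0 : E)) {w w' : E → F} {x : E}
    (h : ∀ t ∈ Metric.ball x ρ.rOut, w t = w' t) : mollify μ ρ w x = mollify μ ρ w' x := by
  simp only [mollify, convolution_def]
  refine integral_congr_ae (Eventually.of_forall fun t => ?_)
  by_cases ht : t ∈ Function.support (ρ.normed μ)
  · rw [ρ.support_normed_eq, mem_ball_zero_iff] at ht
    simp only
    rw [h (x - t) (by simpa [Metric.mem_ball, dist_eq_norm] using ht)]
  · rw [Function.notMem_support] at ht
    simp [ht]

theorem mollify_eq_zero (ρ : ContDiffBump (0 : E)) {w : E → F} {x : E}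
    (h : ∀ t ∈ Metric.ball x ρ.rOut, w t = 0) : mollify μ ρ w x = 0 := by
  rw [mollify_congr ρ (w' := 0) (by simpa using h)]
  simp [mollify, convolution_zero]

theorem mollify_eq_zero_of_notMem (ρ : ContDiffBump (0 : E)) {w : E → F} {K : Set E}
    (hw : Function.support w ⊆ K) {x : E} {δ : ℝ} (hδ : ρ.rOut ≤ δ)
    (hx : x ∉ Metric.cthickening δ K) : mollify μ ρ w x = 0 := by
  refine mollify_eq_zero ρ fun t ht => ?_
  by_contra h
  refine hx (Metric.mem_cthickening_of_dist_le x t δ K (hw h) ?_)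
  rw [dist_comm]
  exact (Metric.mem_ball.1 ht).le.trans hδ

/-- Mollifications converge in `L^p`. -/
theorem tendsto_eLpNorm_mollify_sub {ρ : ℕ → ContDiffBump (0 : E)}
    (hρ : Tendsto (fun n => (ρ n).rOut) atTop (𝓝 0)) {w : E → F} {p : ℝ≥0∞}
    (hp : 1 ≤ p) (hp' : p ≠ ⊤) (hw : MemLp w p μ) :
    Tendsto (fun n => eLpNorm (mollify μ (ρ n) w - w) p μ) atTop (𝓝 0) := by
  rw [ENNReal.tendsto_nhds_zero]
  intro ε hε
  have hε3 : ε / 3 ≠ 0 := by simpa using hε.ne'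
  obtain ⟨g, hgc, hg1, hgcont, hgp⟩ := hw.exists_hasCompactSupport_eLpNorm_sub_le hp' hε3
  set K := Metric.cthickening 1 (tsupport g) with hK
  have hKc : IsCompact K := hgc.isCompact.cthickening
  have hC : μ K ^ (1 / p.toReal) ≠ ⊤ :=
    ENNReal.rpow_ne_top_of_nonneg (by positivity) hKc.measure_lt_top.ne
  -- `K` contains the supports of `g` and of all its mollifications of radius below 1, so a uniform
  -- error `δ` costs at most `δ μ(K)^(1/p) < ε/3` in `L^p`.
  obtain ⟨δ, hδ0, hδ⟩ := ENNReal.exists_nnreal_pos_mul_lt hC hε3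
  obtain ⟨η, hη0, hη⟩ := Metric.uniformContinuous_iff.1
    (hgc.uniformContinuous_of_continuous hgcont) δ (by exact_mod_cast hδ0)
  have hlw : LocallyIntegrable w μ := hw.locallyIntegrable hp
  have hlg : LocallyIntegrable g μ := hgcont.locallyIntegrable
  filter_upwards [(tendsto_order.1 hρ).2 _ (lt_min hη0 one_pos)] with n hn
  have hnη := hn.trans_le (min_le_left _ _)
  have hn1 := hn.trans_le (min_le_right _ _)
  have hmeas : ∀ v : E → F, LocallyIntegrable v μ → AEStronglyMeasurable (mollify μ (ρ n) v) μ :=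
    fun v hv => (contDiff_mollify (ρ n) hv).continuous.aestronglyMeasurable
  have h3 : eLpNorm (mollify μ (ρ n) g - g) p μ ≤ ε / 3 := by
    have hsupp : ∀ x, x ∉ K → (mollify μ (ρ n) g - g) x = 0 := by
      intro x hx
      have h1 := mollify_eq_zero_of_notMem (μ := μ) (ρ n) (subset_tsupport g) hn1.le hx
      have h2 : g x = 0 := by
        by_contra h
        exact hx (Metric.self_subset_cthickening _ (subset_tsupport g h))
      simp [h1, h2]
    have heq : mollify μ (ρ n) g - g = K.indicator (mollify μ (ρ n) g - g) := by
      rw [eq_comm, indicator_eq_self]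
      intro x hx
      by_contra h
      exact hx (hsupp x h)
    rw [heq, eLpNorm_indicator_eq_eLpNorm_restrict hKc.measurableSet]
    refine (eLpNorm_le_of_ae_bound (C := δ) (Eventually.of_forall fun x => ?_)).trans ?_
    · rw [Pi.sub_apply, ← dist_eq_norm]
      refine (ρ n).dist_normed_convolution_le hgcont.aestronglyMeasurable fun t ht => ?_
      exact (hη (lt_trans (Metric.mem_ball.1 ht) hnη)).le
    · rw [Measure.restrict_apply_univ, mul_comm, ENNReal.ofReal_coe_nnreal]
      simpa [one_div] using hδ.le
  have hsplit : mollify μ (ρ n) w - w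
      = (mollify μ (ρ n) (w - g) - (w - g)) + (mollify μ (ρ n) g - g) := by
    rw [mollify_sub (ρ n) hlw hlg]; abel
  have h2 : eLpNorm (mollify μ (ρ n) (w - g)) p μ ≤ ε / 3 :=
    (eLpNorm_mollify_le (ρ n) (hw.1.sub hgp.1) hp hp').trans hg1
  calc eLpNorm (mollify μ (ρ n) w - w) p μ
      ≤ (ε / 3 + ε / 3) + ε / 3 := by
        rw [hsplit]
        refine (eLpNorm_add_le ((hmeas _ (hlw.sub hlg)).sub (hw.1.sub hgp.1))
          ((hmeas _ hlg).sub hgp.1) hp).trans (add_le_add ?_ h3)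
        exact (eLpNorm_sub_le (hmeas _ (hlw.sub hlg)) (hw.1.sub hgp.1) hp).trans
          (add_le_add h2 hg1)
    _ = ε := ENNReal.add_thirds ε

theorem fderiv_mollify_apply (ρ : ContDiffBump (0 : E)) {w : E → F} (hw : LocallyIntegrable w μ)
    (x e : E) :
    fderiv ℝ (mollify μ ρ w) x e = ∫ t, fderiv ℝ (ρ.normed μ) (x - t) e • w t ∂μ := by
  have hd := ρ.hasCompactSupport_normed.hasFDerivAt_convolution_left
    (ContinuousLinearMap.lsmul ℝ ℝ) (ContDiffBump.contDiff_normed (μ := μ) (n := 1) ρ) hw x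
  have hex : ConvolutionExistsAt (fderiv ℝ (ρ.normed μ)) w x
      ((ContinuousLinearMap.lsmul ℝ ℝ : ℝ →L[ℝ] F →L[ℝ] F).precompL E) μ :=
    (ρ.hasCompactSupport_normed.fderiv ℝ).convolutionExists_left _
      ((ContDiffBump.contDiff_normed (μ := μ) (n := 1) ρ).continuous_fderiv one_ne_zero) hw x
  rw [mollify, hd.fderiv, convolution_def, ContinuousLinearMap.integral_apply hex]
  rw [← integral_sub_left_eq_self _ μ x]
  simp

end Mollification

/-! ### Calculus of weak partial derivatives -/

theorem integrable_smul_of_tsupport_subset {E F : Type*} [TopologicalSpace E] [T2Space E]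
    [SecondCountableTopology E] [MeasurableSpace E] [BorelSpace E] {μ : Measure E}
    [NormedAddCommGroup F] [NormedSpace ℝ F] {f : E → F} {U : Set E} {ψ : E → ℝ}
    (hf : LocallyIntegrableOn f U μ) (hψ : Continuous ψ) (hc : HasCompactSupport ψ)
    (hs : tsupport ψ ⊆ U) : Integrable (fun x => ψ x • f x) μ := by
  have h : IntegrableOn (fun x => ψ x • f x) (tsupport ψ) μ :=
    (hf.mono_set hs).integrableOn_isCompact hc |>.continuousOn_smul hψ.continuousOn hc
  rwa [integrableOn_iff_integrable_of_support_subset] at h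
  refine fun x hx => subset_tsupport ψ ?_
  intro h0
  exact hx (by simp [h0])

theorem setIntegral_smul_eq_integral {E F : Type*} [TopologicalSpace E] [MeasurableSpace E]
    {μ : Measure E} [NormedAddCommGroup F] [NormedSpace ℝ F] {f : E → F} {U : Set E} {ψ : E → ℝ}
    (hs : tsupport ψ ⊆ U) : ∫ x in U, ψ x • f x ∂μ = ∫ x, ψ x • f x ∂μ := by
  refine setIntegral_eq_integral_of_forall_compl_eq_zero fun x hx => ?_
  rw [image_eq_zero_of_notMem_tsupport (fun h => hx (hs h)), zero_smul]

theorem tsupport_fderiv_apply_subset' {E : Type*} [NormedAddCommGroup E] [NormedSpace ℝ E]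
    (ψ : E → ℝ) (e : E) : tsupport (fun p => fderiv ℝ ψ p e) ⊆ tsupport ψ :=
  (closure_mono fun x hx => by
    intro h0
    exact hx (by simp [h0])).trans (tsupport_fderiv_subset ℝ (f := ψ))

variable {F : Type*} [NormedAddCommGroup F] [NormedSpace ℝ F]

theorem HasWeakPartial.integral_eq {U : Set (ℝ × ℝ)} {e : ℝ × ℝ} {u v : ℝ × ℝ → F}
    (h : HasWeakPartial U e u v) {ψ : ℝ × ℝ → ℝ} (hψ : ContDiff ℝ ∞ ψ)
    (hc : HasCompactSupport ψ) (hs : tsupport ψ ⊆ U) :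
    ∫ p, fderiv ℝ ψ p e • u p = -∫ p, ψ p • v p := by
  rw [← setIntegral_smul_eq_integral hs, ← h.2.2 ψ hψ hc hs,
    setIntegral_smul_eq_integral ((tsupport_fderiv_apply_subset' ψ e).trans hs)]

theorem HasWeakPartial.of_integral_eq {U : Set (ℝ × ℝ)} {e : ℝ × ℝ} {u v : ℝ × ℝ → F}
    (hu : LocallyIntegrableOn u U) (hv : LocallyIntegrableOn v U)
    (h : ∀ ψ : ℝ × ℝ → ℝ, ContDiff ℝ ∞ ψ → HasCompactSupport ψ → tsupport ψ ⊆ U →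
      ∫ p, fderiv ℝ ψ p e • u p = -∫ p, ψ p • v p) : HasWeakPartial U e u v := by
  refine ⟨hu, hv, fun ψ hψ hc hs => ?_⟩
  rw [setIntegral_smul_eq_integral hs, ← h ψ hψ hc hs,
    setIntegral_smul_eq_integral ((tsupport_fderiv_apply_subset' ψ e).trans hs)]

theorem HasWeakPartial.mono {U V : Set (ℝ × ℝ)} {e : ℝ × ℝ} {u v : ℝ × ℝ → F}
    (h : HasWeakPartial U e u v) (hV : V ⊆ U) : HasWeakPartial V e u v :=
  .of_integral_eq (h.1.mono_set hV) (h.2.1.mono_set hV)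
    fun _ hψ hc hs => h.integral_eq hψ hc (hs.trans hV)

theorem HasWeakPartial.congr {U : Set (ℝ × ℝ)} {e : ℝ × ℝ} {u v u' v' : ℝ × ℝ → F}
    (h : HasWeakPartial U e u v) (hu : ∀ᵐ q ∂(volume.restrict U), u q = u' q)
    (hv : ∀ᵐ q ∂(volume.restrict U), v q = v' q) : HasWeakPartial U e u' v' := by
  refine ⟨h.1.congr hu, h.2.1.congr hv, fun ψ hψ hc hs => ?_⟩
  have e1 : ∫ q in U, fderiv ℝ ψ q e • u' q = ∫ q in U, fderiv ℝ ψ q e • u q :=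
    integral_congr_ae (hu.mono fun q hq => by simp only [hq])
  have e2 : ∫ q in U, ψ q • v' q = ∫ q in U, ψ q • v q :=
    integral_congr_ae (hv.mono fun q hq => by simp only [hq])
  rw [e1, e2, h.2.2 ψ hψ hc hs]

theorem HasWeakPartial.unique [CompleteSpace F] {U : Set (ℝ × ℝ)} (hU : IsOpen U) {e : ℝ × ℝ}
    {u v v' : ℝ × ℝ → F} (h : HasWeakPartial U e u v) (h' : HasWeakPartial U e u v') :
    ∀ᵐ q ∂(volume.restrict U), v q = v' q := by
  rw [ae_restrict_iff' hU.measurableSet]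
  have := hU.ae_eq_zero_of_integral_contDiff_smul_eq_zero (μ := volume) (f := v - v')
    (h.2.1.sub h'.2.1) fun ψ hψ hc hs => by
      simp only [Pi.sub_apply, smul_sub]
      rw [integral_sub (integrable_smul_of_tsupport_subset h.2.1 hψ.continuous hc hs)
        (integrable_smul_of_tsupport_subset h'.2.1 hψ.continuous hc hs), sub_eq_zero, ← neg_inj,
        ← h.integral_eq hψ hc hs, ← h'.integral_eq hψ hc hs]
  filter_upwards [this] with q hq hqU
  simpa [sub_eq_zero] using hq hqU

theorem HasWeakPartial.weakPartial_spec {U : Set (ℝ × ℝ)} {e : ℝ × ℝ} {u v : ℝ × ℝ → F}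
    (h : HasWeakPartial U e u v) : HasWeakPartial U e u (weakPartial U e u) := by
  have : ∃ v, HasWeakPartial U e u v := ⟨v, h⟩
  rw [weakPartial, dif_pos this]
  exact this.choose_spec

theorem HasWeakPartial.ae_eq_weakPartial [CompleteSpace F] {U : Set (ℝ × ℝ)} (hU : IsOpen U)
    {e : ℝ × ℝ} {u v : ℝ × ℝ → F} (h : HasWeakPartial U e u v) :
    ∀ᵐ q ∂(volume.restrict U), weakPartial U e u q = v q :=
  h.weakPartial_spec.unique hU h

theorem HasWeakPartial.clm_comp [CompleteSpace F] {F' : Type*} [NormedAddCommGroup F']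
    [NormedSpace ℝ F'] [CompleteSpace F']
    (A : F →L[ℝ] F') {U : Set (ℝ × ℝ)} {e : ℝ × ℝ} {u v : ℝ × ℝ → F}
    (h : HasWeakPartial U e u v) : HasWeakPartial U e (fun q => A (u q)) (fun q => A (v q)) := by
  have hA : ∀ {w : ℝ × ℝ → F}, LocallyIntegrableOn w U →
      LocallyIntegrableOn (fun q => A (w q)) U := fun hw x hx => by
    obtain ⟨s, hs, hi⟩ := hw x hx
    exact ⟨s, hs, A.integrable_comp hi⟩
  refine .of_integral_eq (hA h.1) (hA h.2.1) fun ψ hψ hc hs => ?_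
  have hd : Continuous (fun p => fderiv ℝ ψ p e) :=
    (hψ.continuous_fderiv (by simp)).clm_apply continuous_const
  have h1 := integrable_smul_of_tsupport_subset h.1 hd (hc.fderiv_apply ℝ e)
    ((tsupport_fderiv_apply_subset' ψ e).trans hs)
  have h2 := integrable_smul_of_tsupport_subset h.2.1 hψ.continuous hc hs
  simp only [← map_smul]
  rw [A.integral_comp_comm h1, A.integral_comp_comm h2, h.integral_eq hψ hc hs, map_neg]

theorem HasWeakPartial.add {U : Set (ℝ × ℝ)} {e : ℝ × ℝ} {u v u' v' : ℝ × ℝ → F}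
    (h : HasWeakPartial U e u v) (h' : HasWeakPartial U e u' v') :
    HasWeakPartial U e (fun q => u q + u' q) (fun q => v q + v' q) := by
  refine .of_integral_eq (h.1.add h'.1) (h.2.1.add h'.2.1) fun ψ hψ hc hs => ?_
  have hd : Continuous (fun p => fderiv ℝ ψ p e) :=
    (hψ.continuous_fderiv (by simp)).clm_apply continuous_const
  have hds := (tsupport_fderiv_apply_subset' ψ e).trans hs
  simp only [smul_add]
  rw [integral_add (integrable_smul_of_tsupport_subset h.1 hd (hc.fderiv_apply ℝ e) hds)
    (integrable_smul_of_tsupport_subset h'.1 hd (hc.fderiv_apply ℝ e) hds),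
    integral_add (integrable_smul_of_tsupport_subset h.2.1 hψ.continuous hc hs)
    (integrable_smul_of_tsupport_subset h'.2.1 hψ.continuous hc hs),
    h.integral_eq hψ hc hs, h'.integral_eq hψ hc hs, neg_add]

/-- The translated and reflected bump is supported in the ball around `x`, hence is an admissible
test function on `U`. Reflection changes the sign of its derivative, which cancels the sign in the
definition of the weak derivative. The indicator is harmless because that ball lies in `S`. -/
theorem HasWeakPartial.fderiv_mollify [CompleteSpace F] {U : Set (ℝ × ℝ)} {e : ℝ × ℝ} {u v : ℝ × ℝ → F}
    (h : HasWeakPartial U e u v) {S : Set (ℝ × ℝ)} (hS : MeasurableSet S) (hSU : S ⊆ U)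
    (hu : IntegrableOn u S) (ρ : ContDiffBump (0 : ℝ × ℝ)) {x : ℝ × ℝ}
    (hx : Metric.closedBall x ρ.rOut ⊆ S) :
    fderiv ℝ (mollify volume ρ (S.indicator u)) x e = mollify volume ρ (S.indicator v) x := by
  have hlu : LocallyIntegrable (S.indicator u) volume :=
    ((integrable_indicator_iff hS).2 hu).locallyIntegrable
  rw [fderiv_mollify_apply ρ hlu, mollify, convolution_eq_swap]
  set ψ : ℝ × ℝ → ℝ := fun t => ρ.normed volume (x - t) with hψdef
  have hψ : ContDiff ℝ ∞ ψ :=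
    (ContDiffBump.contDiff_normed (μ := volume) ρ).comp (contDiff_const.sub contDiff_id)
  have hsub : Function.support ψ ⊆ Metric.closedBall x ρ.rOut := fun t ht => by
    have : x - t ∈ Function.support (ρ.normed volume) := ht
    rw [ρ.support_normed_eq, mem_ball_zero_iff] at this
    rw [Metric.mem_closedBall, dist_comm, dist_eq_norm]
    exact this.le
  have hts : tsupport ψ ⊆ Metric.closedBall x ρ.rOut :=
    closure_minimal hsub Metric.isClosed_closedBall
  have hc : HasCompactSupport ψ :=
    HasCompactSupport.of_support_subset_isCompact (isCompact_closedBall _ _) hsub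
  have hd : ∀ t, fderiv ℝ ψ t e = -fderiv ℝ (ρ.normed volume) (x - t) e := fun t => by
    have h1 : HasFDerivAt (fun t : ℝ × ℝ => x - t) (-ContinuousLinearMap.id ℝ (ℝ × ℝ)) t :=
      (hasFDerivAt_id t).const_sub x
    have h2 := ((ContDiffBump.contDiff_normed (μ := volume) (n := 1) ρ).differentiable
      one_ne_zero (x - t)).hasFDerivAt.comp t h1
    rw [show ψ = (ρ.normed volume) ∘ (fun t : ℝ × ℝ => x - t) from rfl, h2.fderiv]
    simp
  have key := h.integral_eq hψ hc (hts.trans (hx.trans hSU))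
  have e1 : ∀ t, fderiv ℝ (ρ.normed volume) (x - t) e • S.indicator u t
      = -(fderiv ℝ ψ t e • u t) := fun t => by
    by_cases ht : t ∈ S
    · rw [indicator_of_mem ht, hd, neg_smul, neg_neg]
    · have : fderiv ℝ ψ t e = 0 := image_eq_zero_of_notMem_tsupport
        (f := fun p => fderiv ℝ ψ p e)
        (fun h' => ht (hx (hts (tsupport_fderiv_apply_subset' ψ e h'))))
      rw [this, indicator_of_notMem ht]
      simp
  have e2 : ∀ t, (ContinuousLinearMap.lsmul ℝ ℝ) (ρ.normed volume (x - t)) (S.indicator v t)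
      = ψ t • v t := fun t => by
    by_cases ht : t ∈ S
    · rw [indicator_of_mem ht]; rfl
    · have : ψ t = 0 := image_eq_zero_of_notMem_tsupport (fun h' => ht (hx (hts h')))
      rw [this, indicator_of_notMem ht]
      simp
  simp only [e1, e2]
  rw [integral_neg, key, neg_neg]

/-! ### Smooth approximation and the chain rule -/

/-- A sequence of bump functions with radii tending to `0`. -/
noncomputable def shrinkingBump {E : Type*} [NormedAddCommGroup E] [NormedSpace ℝ E] (δ : ℝ)
    (hδ : 0 < δ) (n : ℕ) : ContDiffBump (0 : E) where
  rIn := δ / (2 * (n + 1))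
  rOut := δ / (n + 1)
  rIn_pos := by positivity
  rIn_lt_rOut := by
    apply div_lt_div_of_pos_left hδ (by positivity)
    linarith [show (0 : ℝ) ≤ n from n.cast_nonneg]

theorem shrinkingBump_rOut_le {E : Type*} [NormedAddCommGroup E] [NormedSpace ℝ E] {δ : ℝ}
    (hδ : 0 < δ) (n : ℕ) : (shrinkingBump δ hδ n : ContDiffBump (0 : E)).rOut ≤ δ :=
  div_le_self hδ.le (by linarith [show (0 : ℝ) ≤ n from n.cast_nonneg])

theorem tendsto_shrinkingBump_rOut {E : Type*} [NormedAddCommGroup E] [NormedSpace ℝ E] {δ : ℝ}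
    (hδ : 0 < δ) :
    Tendsto (fun n => (shrinkingBump δ hδ n : ContDiffBump (0 : E)).rOut) atTop (𝓝 0) := by
  have := (tendsto_one_div_add_atTop_nhds_zero_nat (𝕜 := ℝ)).const_mul δ
  simpa [shrinkingBump, div_eq_mul_inv] using this

theorem ae_tendsto_mollify_shrinkingBump {E : Type*} [NormedAddCommGroup E] [NormedSpace ℝ E]
    [FiniteDimensional ℝ E] [MeasurableSpace E] [BorelSpace E] {μ : Measure E}
    [μ.IsAddHaarMeasure] [CompleteSpace F] {δ : ℝ} (hδ : 0 < δ) {w : E → F}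
    (hw : LocallyIntegrable w μ) :
    ∀ᵐ x ∂μ, Tendsto (fun n => mollify μ (shrinkingBump δ hδ n) w x) atTop (𝓝 (w x)) := by
  -- Convergence at Lebesgue points needs `rOut / rIn` bounded; here the quotient is always 2.
  refine ContDiffBump.ae_convolution_tendsto_right_of_locallyIntegrable (K := 2)
    (tendsto_shrinkingBump_rOut hδ) (Eventually.of_forall fun n => le_of_eq ?_) hw
  simp only [shrinkingBump]
  field_simp

/-- The function is cut off to a compact thickening `S` of `K` inside `U` and mollified at radii at
most the thickness, so that over `K` the cut-off is invisible and mollification commutes with the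
weak derivative. -/
theorem HasWeakPartial.exists_contDiff_approx [CompleteSpace F] {U : Set (ℝ × ℝ)} (hU : IsOpen U)
    {e : ℝ × ℝ} {u v : ℝ × ℝ → F} (h : HasWeakPartial U e u v) {K : Set (ℝ × ℝ)}
    (hK : IsCompact K) (hKU : K ⊆ U) :
    ∃ w : ℕ → ℝ × ℝ → F, (∀ n, ContDiff ℝ ∞ (w n)) ∧
      Tendsto (fun n => ∫⁻ x in K, ‖w n x - u x‖ₑ) atTop (𝓝 0) ∧
      Tendsto (fun n => ∫⁻ x in K, ‖fderiv ℝ (w n) x e - v x‖ₑ) atTop (𝓝 0) ∧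
      ∀ᵐ x ∂(volume.restrict K), Tendsto (fun n => w n x) atTop (𝓝 (u x)) := by
  obtain ⟨δ, hδ, hδU⟩ := hK.exists_cthickening_subset_open hU hKU
  set S := Metric.cthickening δ K with hSdef
  have hSc : IsCompact S := hK.cthickening
  have hKS : K ⊆ S := Metric.self_subset_cthickening _
  have hu : IntegrableOn u S := h.1.integrableOn_compact_subset hδU hSc
  have hv : IntegrableOn v S := h.2.1.integrableOn_compact_subset hδU hSc
  have hu' := (integrable_indicator_iff hSc.measurableSet).2 hu
  have hv' := (integrable_indicator_iff hSc.measurableSet).2 hv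
  have hL : ∀ w : ℝ × ℝ → F, Integrable (S.indicator w) → Tendsto (fun n => ∫⁻ x in K,
      ‖mollify volume (shrinkingBump δ hδ n) (S.indicator w) x - w x‖ₑ) atTop (𝓝 0) := by
    intro w hw
    have := tendsto_eLpNorm_mollify_sub (tendsto_shrinkingBump_rOut hδ) le_rfl ENNReal.one_ne_top
      (memLp_one_iff_integrable.2 hw)
    refine tendsto_of_tendsto_of_tendsto_of_le_of_le tendsto_const_nhds this (fun _ => zero_le)
      fun n => ?_
    simp only
    rw [eLpNorm_one_eq_lintegral_enorm]
    refine le_trans (setLIntegral_mono' hK.measurableSet fun x hx => ?_) (setLIntegral_le_lintegral K _)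
    rw [Pi.sub_apply, indicator_of_mem (hKS hx)]
  refine ⟨fun n => mollify volume (shrinkingBump δ hδ n) (S.indicator u),
    fun n => contDiff_mollify _ hu'.locallyIntegrable, hL u hu', ?_, ?_⟩
  · refine (hL v hv').congr fun n => setLIntegral_congr_fun hK.measurableSet fun x hx => ?_
    simp only
    rw [h.fderiv_mollify hSc.measurableSet hδU hu]
    refine fun t ht => Metric.mem_cthickening_of_dist_le t x δ K hx ?_
    exact (Metric.mem_closedBall.1 ht).trans (shrinkingBump_rOut_le hδ n)
  · rw [ae_restrict_iff' hK.measurableSet]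
    filter_upwards [ae_tendsto_mollify_shrinkingBump hδ hu'.locallyIntegrable] with x hx hxK
    rwa [indicator_of_mem (hKS hxK)] at hx

theorem locallyIntegrableOn_of_isCompact {E F : Type*} [TopologicalSpace E] [LocallyCompactSpace E]
    [T2Space E] [MeasurableSpace E] [NormedAddCommGroup F] {μ : Measure E} {U : Set E}
    (hU : IsOpen U) {f : E → F} (h : ∀ K ⊆ U, IsCompact K → IntegrableOn f K μ) :
    LocallyIntegrableOn f U μ :=
  (locallyIntegrableOn_iff hU.isLocallyClosed).2 h

theorem locallyIntegrableOn_mul_bdd {U : Set (ℝ × ℝ)} {g v : ℝ × ℝ → ℝ} {L : ℝ}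
    (hv : LocallyIntegrableOn v U) (hg : AEStronglyMeasurable g (volume.restrict U))
    (hL : ∀ q, |g q| ≤ L) (hU : IsOpen U) : LocallyIntegrableOn (fun q => g q * v q) U :=
  locallyIntegrableOn_of_isCompact hU fun _ hK hKc =>
    (hv.integrableOn_compact_subset hK hKc).bdd_mul (c := L)
      (hg.mono_measure (Measure.restrict_mono hK le_rfl)) (Eventually.of_forall hL)

theorem locallyIntegrableOn_comp_lipschitz {U : Set (ℝ × ℝ)} {u : ℝ × ℝ → ℝ} {G : ℝ → ℝ} {L : ℝ}
    (hu : LocallyIntegrableOn u U) (hG : Continuous G) (hL : ∀ s t, |G s - G t| ≤ L * |s - t|)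
    (hU : IsOpen U) : LocallyIntegrableOn (fun q => G (u q)) U :=
  locallyIntegrableOn_of_isCompact hU fun K hK hKc => by
    have h1 := (hu.integrableOn_compact_subset hK hKc)
    have : IsFiniteMeasure (volume.restrict K) := ⟨by simpa using hKc.measure_lt_top⟩
    refine Integrable.mono' ((integrable_const |G 0|).add (h1.norm.const_mul L))
      (hG.comp_aestronglyMeasurable h1.aestronglyMeasurable) (Eventually.of_forall fun q => ?_)
    have := hL (u q) 0
    rw [sub_zero] at this
    simp only [Real.norm_eq_abs, Pi.add_apply]
    have h3 := abs_sub_abs_le_abs_sub (G (u q)) (G 0)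
    linarith

theorem abs_sub_le_of_hasDerivAt {G G' : ℝ → ℝ} (hG : ∀ t, HasDerivAt G (G' t) t) {L : ℝ}
    (hL : ∀ t, |G' t| ≤ L) (s t : ℝ) : |G s - G t| ≤ L * |s - t| :=
  convex_univ.norm_image_sub_le_of_norm_hasDerivWithin_le
    (fun x _ => (hG x).hasDerivWithinAt) (fun x _ => hL x) (mem_univ t) (mem_univ s)

/-- The chain rule for weak derivatives, tested with `C¹` functions. -/
theorem HasWeakPartial.integral_comp {U : Set (ℝ × ℝ)} (hU : IsOpen U)
    {e : ℝ × ℝ} {u v : ℝ × ℝ → ℝ} (h : HasWeakPartial U e u v) {G G' : ℝ → ℝ}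
    (hG : ∀ t, HasDerivAt G (G' t) t) (hG' : Continuous G') {L : ℝ} (hL : ∀ t, |G' t| ≤ L)
    {ψ : ℝ × ℝ → ℝ} (hψ : ContDiff ℝ 1 ψ) (hc : HasCompactSupport ψ) (hs : tsupport ψ ⊆ U) :
    ∫ p, fderiv ℝ ψ p e * G (u p) = -∫ p, ψ p * (G' (u p) * v p) := by
  set K := tsupport ψ with hKdef
  have hK : IsCompact K := hc
  have hGc : Continuous G := continuous_iff_continuousAt.2 fun t => (hG t).continuousAt
  have hGC1 : ContDiff ℝ 1 G := contDiff_one_iff_deriv.2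
    ⟨fun t => (hG t).differentiableAt, by rwa [show deriv G = G' from funext fun t => (hG t).deriv]⟩
  have hLip := abs_sub_le_of_hasDerivAt hG hL
  have hL0 : 0 ≤ L := (abs_nonneg _).trans (hL 0)
  obtain ⟨w, hw, hwu, hwv, hwae⟩ := h.exists_contDiff_approx hU hK hs
  have hψ' : Continuous (fun p => fderiv ℝ ψ p e) :=
    (hψ.continuous_fderiv one_ne_zero).clm_apply continuous_const
  have hψ's := tsupport_fderiv_apply_subset' ψ e
  obtain ⟨C, hC⟩ := hψ.continuous.bounded_above_of_compact_support hc
  obtain ⟨C', hC'⟩ := hψ'.bounded_above_of_compact_support (hc.fderiv_apply ℝ e)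
  have hvK : IntegrableOn v K := h.2.1.integrableOn_compact_subset hs hK
  have huK : IntegrableOn u K := h.1.integrableOn_compact_subset hs hK
  have hGu : LocallyIntegrableOn (fun q => G (u q)) U := locallyIntegrableOn_comp_lipschitz h.1 hGc hLip hU
  have hG'u : LocallyIntegrableOn (fun q => G' (u q) * v q) U :=
    locallyIntegrableOn_mul_bdd h.2.1 (hG'.comp_aestronglyMeasurable h.1.aestronglyMeasurable)
      (fun q => hL _) hU
  have hwn : ∀ n, Continuous (fun p => fderiv ℝ (w n) p e) := fun n =>
    ((hw n).continuous_fderiv (by simp)).clm_apply continuous_const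
  have hdG : ∀ n p, fderiv ℝ (fun q => G (w n q)) p e = G' (w n p) * fderiv ℝ (w n) p e := by
    intro n p
    have h1 := ((hw n).differentiable (by simp) p).hasFDerivAt
    have := (hG (w n p)).comp_hasFDerivAt p h1
    rw [show (fun q => G (w n q)) = G ∘ w n from rfl, this.fderiv]
    rfl
  have hint : ∀ {f : ℝ × ℝ → ℝ} {θ : ℝ × ℝ → ℝ}, Continuous f → Continuous θ →
      HasCompactSupport θ → Integrable (fun p => θ p * f p) := fun hf hθ hθc =>
    (hθ.mul hf).integrable_of_hasCompactSupport hθc.mul_right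
  have hn : ∀ n, ∫ p in K, fderiv ℝ ψ p e * G (w n p)
      = -∫ p in K, ψ p * (G' (w n p) * fderiv ℝ (w n) p e) := by
    intro n
    have hGw : Continuous (fun q => G (w n q)) := hGc.comp (hw n).continuous
    have hG'w : Continuous (fun p => G' (w n p) * fderiv ℝ (w n) p e) :=
      (hG'.comp (hw n).continuous).mul (hwn n)
    have := integral_mul_fderiv_eq_neg_fderiv_mul_of_integrable (𝕜 := ℝ) (μ := volume)
      (f := fun q => G (w n q)) (g := ψ) (v := e)
      (by simpa only [hdG, mul_comm] using hint hG'w hψ.continuous hc)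
      (by simpa only [mul_comm] using hint hGw hψ' (hc.fderiv_apply ℝ e))
      (by simpa only [mul_comm] using hint hGw hψ.continuous hc)
      (fun x _ => (hGC1.differentiable one_ne_zero _).comp x ((hw n).differentiable (by simp) x))
      (fun x _ => hψ.differentiable one_ne_zero x)
    have e1 := setIntegral_smul_eq_integral (μ := volume) (f := fun q => G (w n q)) hψ's
    have e2 := setIntegral_smul_eq_integral (μ := volume) (U := K) (ψ := ψ)
      (f := fun p => G' (w n p) * fderiv ℝ (w n) p e) subset_rfl
    simp only [smul_eq_mul] at e1 e2
    rw [e1, e2]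
    simp only [hdG] at this
    simpa only [mul_comm, mul_left_comm, mul_assoc] using this
  have e1 := setIntegral_smul_eq_integral (μ := volume) (f := fun q => G (u q)) hψ's
  have e2 := setIntegral_smul_eq_integral (μ := volume) (U := K) (ψ := ψ)
    (f := fun p => G' (u p) * v p) subset_rfl
  simp only [smul_eq_mul] at e1 e2
  rw [← e1, ← e2]
  have hlim1 : Tendsto (fun n => ∫ p in K, fderiv ℝ ψ p e * G (w n p)) atTop
      (𝓝 (∫ p in K, fderiv ℝ ψ p e * G (u p))) := by
    refine tendsto_integral_of_L1 _ (by
      simpa using (integrable_smul_of_tsupport_subset hGu hψ' (hc.fderiv_apply ℝ e)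
        (hψ's.trans hs)).integrableOn.aestronglyMeasurable) (Eventually.of_forall fun n =>
      (hint (hGc.comp (hw n).continuous) hψ' (hc.fderiv_apply ℝ e)).integrableOn) ?_
    have := ENNReal.Tendsto.const_mul (a := ENNReal.ofReal (C' * L)) hwu
      (Or.inr ENNReal.ofReal_ne_top)
    rw [mul_zero] at this
    refine tendsto_of_tendsto_of_tendsto_of_le_of_le tendsto_const_nhds this (fun _ => zero_le)
      fun n => ?_
    simp only
    rw [← lintegral_const_mul' _ _ ENNReal.ofReal_ne_top]
    refine lintegral_mono fun p => ?_
    rw [← mul_sub, enorm_mul, ENNReal.ofReal_mul ((norm_nonneg _).trans (hC' 0)), mul_assoc]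
    refine mul_le_mul' ?_ ?_
    · rw [← ofReal_norm]; exact ENNReal.ofReal_le_ofReal (hC' p)
    · rw [← ofReal_norm, ← ofReal_norm, ← ENNReal.ofReal_mul hL0]
      exact ENNReal.ofReal_le_ofReal (hLip _ _)
  have hlim2 : Tendsto (fun n => ∫ p in K, ψ p * (G' (w n p) * fderiv ℝ (w n) p e)) atTop
      (𝓝 (∫ p in K, ψ p * (G' (u p) * v p))) := by
    refine tendsto_integral_of_L1 _ (by
      simpa using (integrable_smul_of_tsupport_subset hG'u hψ.continuous hc hs).integrableOn.aestronglyMeasurable)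
      (Eventually.of_forall fun n =>
      (hint ((hG'.comp (hw n).continuous).mul (hwn n)) hψ.continuous hc).integrableOn) ?_
    -- The difference of the two products is `G'(wₙ)(∂wₙ - v) + (G'(wₙ) - G'(u)) v`. The first term
    -- tends to zero in `L¹` because `G'` is bounded, the second by dominated convergence along the
    -- a.e. convergent `wₙ`.
    have hA : Tendsto (fun n => ∫⁻ p in K, ‖(G' (w n p) - G' (u p)) * v p‖ₑ) atTop (𝓝 0) := by
      have := tendsto_lintegral_of_dominated_convergence' (μ := volume.restrict K)
        (F := fun n p => ‖(G' (w n p) - G' (u p)) * v p‖ₑ) (f := fun _ => 0)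
        (fun p => ENNReal.ofReal (2 * L) * ‖v p‖ₑ) (fun n => ?_) (fun n => ?_) ?_ ?_
      · simpa using this
      · exact ((((hG'.comp (hw n).continuous).aestronglyMeasurable).sub
          (hG'.comp_aestronglyMeasurable huK.aestronglyMeasurable)).mul
            hvK.aestronglyMeasurable).enorm
      · refine Eventually.of_forall fun p => ?_
        simp only
        rw [enorm_mul]
        refine mul_le_mul' ?_ le_rfl
        rw [← ofReal_norm]
        refine ENNReal.ofReal_le_ofReal ((norm_sub_le _ _).trans ?_)
        have a1 := hL (w n p)
        have a2 := hL (u p)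
        simp only [Real.norm_eq_abs]
        linarith
      · rw [lintegral_const_mul' _ _ ENNReal.ofReal_ne_top]
        exact ENNReal.mul_ne_top ENNReal.ofReal_ne_top hvK.2.ne
      · filter_upwards [hwae] with p hp
        have h1 : Tendsto (fun n => (G' (w n p) - G' (u p)) * v p) atTop (𝓝 0) := by
          have := ((((hG'.tendsto _).comp hp).sub_const (G' (u p))).mul_const (v p))
          simpa using this
        simpa using h1.enorm
    have := ENNReal.Tendsto.const_mul (a := ENNReal.ofReal C)
      ((ENNReal.Tendsto.const_mul (a := ENNReal.ofReal L) hwv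
      (Or.inr ENNReal.ofReal_ne_top)).add hA) (Or.inr ENNReal.ofReal_ne_top)
    rw [mul_zero, zero_add, mul_zero] at this
    refine tendsto_of_tendsto_of_tendsto_of_le_of_le tendsto_const_nhds this (fun _ => zero_le)
      fun n => ?_
    simp only
    rw [← lintegral_const_mul' _ _ ENNReal.ofReal_ne_top, ← lintegral_add_left',
      ← lintegral_const_mul' _ _ ENNReal.ofReal_ne_top]
    · refine lintegral_mono fun p => ?_
      rw [← mul_sub, enorm_mul]
      refine mul_le_mul' ?_ ?_
      · rw [← ofReal_norm]; exact ENNReal.ofReal_le_ofReal (hC p)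
      · rw [show G' (w n p) * fderiv ℝ (w n) p e - G' (u p) * v p
          = G' (w n p) * (fderiv ℝ (w n) p e - v p) + (G' (w n p) - G' (u p)) * v p by ring]
        refine (enorm_add_le _ _).trans (add_le_add ?_ le_rfl)
        rw [enorm_mul]
        refine mul_le_mul' ?_ le_rfl
        rw [← ofReal_norm]
        exact ENNReal.ofReal_le_ofReal (hL _)
    · exact (((hwn n).aestronglyMeasurable.sub hvK.aestronglyMeasurable).enorm).const_mul _
  refine tendsto_nhds_unique hlim1 ?_
  simp only [hn]
  exact hlim2.neg

/-- Weak derivatives may be tested with `C¹` functions. -/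
theorem HasWeakPartial.integral_eq_of_contDiff_one {U : Set (ℝ × ℝ)} (hU : IsOpen U)
    {e : ℝ × ℝ} {u v : ℝ × ℝ → ℝ} (h : HasWeakPartial U e u v)
    {ψ : ℝ × ℝ → ℝ} (hψ : ContDiff ℝ 1 ψ) (hc : HasCompactSupport ψ) (hs : tsupport ψ ⊆ U) :
    ∫ p, fderiv ℝ ψ p e * u p = -∫ p, ψ p * v p := by
  simpa using h.integral_comp hU (G := id) (G' := fun _ => 1) (fun t => hasDerivAt_id t)
    continuous_const (L := 1) (by simp) hψ hc hs

/-! ### Truncation, and the derivative on the zero set -/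

/-- The truncation `t ↦ M arctan (t / M)`. -/
noncomputable def trunc (M t : ℝ) : ℝ := M * Real.arctan (t / M)

theorem hasDerivAt_trunc {M : ℝ} (hM : M ≠ 0) (t : ℝ) :
    HasDerivAt (trunc M) (1 / (1 + (t / M) ^ 2)) t := by
  have h := (((hasDerivAt_id t).div_const M).arctan).const_mul M
  refine h.congr_deriv ?_
  simp only [id]
  field_simp

theorem continuous_trunc_deriv (M : ℝ) : Continuous fun t : ℝ => 1 / (1 + (t / M) ^ 2) := by
  refine continuous_const.div (by fun_prop) fun t => by positivity

theorem abs_trunc_deriv_le (M t : ℝ) : |1 / (1 + (t / M) ^ 2)| ≤ 1 := by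
  rw [abs_of_pos (by positivity), div_le_one (by positivity)]
  nlinarith [sq_nonneg (t / M)]

theorem abs_trunc_le_mul_pi (M t : ℝ) : |trunc M t| ≤ |M| * (Real.pi / 2) := by
  rw [trunc, abs_mul]
  refine mul_le_mul_of_nonneg_left ?_ (abs_nonneg M)
  rw [abs_le]
  exact ⟨by linarith [Real.neg_pi_div_two_lt_arctan (t / M)],
    (Real.arctan_lt_pi_div_two (t / M)).le⟩

theorem abs_trunc_le {M : ℝ} (hM : M ≠ 0) (t : ℝ) : |trunc M t| ≤ |t| := by
  have := abs_sub_le_of_hasDerivAt (hasDerivAt_trunc hM) (abs_trunc_deriv_le M) t 0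
  simpa [trunc] using this

theorem tendsto_trunc (t : ℝ) :
    Tendsto (fun n : ℕ => trunc ((n : ℝ) + 1) t) atTop (𝓝 t) := by
  have h0 : Tendsto (fun n : ℕ => ((n : ℝ) + 1)) atTop atTop :=
    tendsto_atTop_add_const_right _ _ tendsto_natCast_atTop_atTop
  have h := (Real.hasDerivAt_arctan 0).hasFDerivAt.lim t (c := fun n : ℕ => ((n : ℝ) + 1))
    (l := atTop) (tendsto_norm_atTop_atTop.comp h0)
  refine (h.congr fun n => ?_).trans (le_of_eq (by simp))
  simp [trunc, div_eq_inv_mul]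

theorem tendsto_trunc_deriv (t : ℝ) :
    Tendsto (fun n : ℕ => 1 / (1 + (t / ((n : ℝ) + 1)) ^ 2)) atTop (𝓝 1) := by
  have h := (tendsto_one_div_add_atTop_nhds_zero_nat (𝕜 := ℝ)).const_mul t
  have h2 := (tendsto_const_nhds (x := (1 : ℝ))).div ((h.pow 2).const_add 1) (by simp)
  refine (h2.congr fun n => ?_).trans (le_of_eq (by simp))
  simp [div_eq_mul_inv]

/-- The weak derivative of `u` vanishes almost everywhere on the zero set of `u`. -/
theorem HasWeakPartial.ae_eq_zero_of_eq_zero {U : Set (ℝ × ℝ)} (hU : IsOpen U)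
    {e : ℝ × ℝ} {u v : ℝ × ℝ → ℝ} (h : HasWeakPartial U e u v) :
    ∀ᵐ q ∂(volume.restrict U), u q = 0 → v q = 0 := by
  -- With `ε → 0`, the functions `ε arctan(t/ε)` tend uniformly to 0 while their derivatives tend
  -- boundedly to the indicator of `{0}`. In the limit of the chain rule, the indicator of `{u = 0}`
  -- times `v` integrates to zero against every test function.
  set ε : ℕ → ℝ := fun n => 1 / ((n : ℝ) + 1) with hε
  have hε0 : ∀ n, 0 < ε n := fun n => by positivity
  have hεlim : Tendsto ε atTop (𝓝 0) := tendsto_one_div_add_atTop_nhds_zero_nat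
  set D : ℕ → ℝ → ℝ := fun n t => 1 / (1 + (t / ε n) ^ 2) with hD
  set χ : ℝ → ℝ := fun t => if t = 0 then 1 else 0 with hχ
  have hDlim : ∀ t, Tendsto (fun n => D n t) atTop (𝓝 (χ t)) := by
    intro t
    by_cases ht : t = 0
    · simp [hD, hχ, ht]
    · simp only [hχ, ht, if_false, hD]
      refine tendsto_const_nhds.div_atTop ?_
      refine tendsto_atTop_add_const_left _ _ ?_
      have h1 : Tendsto (fun n : ℕ => t ^ 2 * ((n : ℝ) + 1) ^ 2) atTop atTop := by
        refine Tendsto.const_mul_atTop (by positivity) ?_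
        exact (tendsto_pow_atTop two_ne_zero).comp
          (tendsto_atTop_add_const_right _ _ tendsto_natCast_atTop_atTop)
      refine h1.congr fun n => ?_
      simp [hε]
      ring
  have hDm : ∀ n, AEStronglyMeasurable (fun q => D n (u q)) (volume.restrict U) := fun n =>
    (continuous_trunc_deriv (ε n)).comp_aestronglyMeasurable h.1.aestronglyMeasurable
  have hχm : AEStronglyMeasurable (fun q => χ (u q)) (volume.restrict U) :=
    aestronglyMeasurable_of_tendsto_ae atTop hDm (Eventually.of_forall fun q => hDlim (u q))
  have hχ1 : ∀ t, |χ t| ≤ 1 := fun t => by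
    by_cases ht : t = 0 <;> simp [hχ, ht]
  have hχv : LocallyIntegrableOn (fun q => χ (u q) * v q) U :=
    locallyIntegrableOn_mul_bdd h.2.1 hχm (fun q => hχ1 _) hU
  have key : ∀ᵐ q, q ∈ U → χ (u q) * v q = 0 := by
    refine hU.ae_eq_zero_of_integral_contDiff_smul_eq_zero hχv fun ψ hψ hc hs => ?_
    have hψ' : Continuous (fun p => fderiv ℝ ψ p e) :=
      (hψ.continuous_fderiv (by simp)).clm_apply continuous_const
    have hψ'i : Integrable (fun p => fderiv ℝ ψ p e) :=
      hψ'.integrable_of_hasCompactSupport (hc.fderiv_apply ℝ e)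
    have hn : ∀ n, ∫ p, fderiv ℝ ψ p e * trunc (ε n) (u p) = -∫ p, ψ p * (D n (u p) * v p) :=
      fun n => h.integral_comp hU (hasDerivAt_trunc (hε0 n).ne') (continuous_trunc_deriv _)
        (abs_trunc_deriv_le _) (hψ.of_le (by simp)) hc hs
    have l1 : Tendsto (fun n => ∫ p, fderiv ℝ ψ p e * trunc (ε n) (u p)) atTop (𝓝 0) := by
      refine squeeze_zero_norm (a := fun n => ε n * (Real.pi / 2) * ∫ p, ‖fderiv ℝ ψ p e‖)
        (fun n => ?_) ?_
      · rw [← integral_const_mul]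
        refine norm_integral_le_of_norm_le (hψ'i.norm.const_mul _) (Eventually.of_forall fun p => ?_)
        rw [norm_mul, mul_comm]
        refine mul_le_mul_of_nonneg_right ?_ (norm_nonneg _)
        have := abs_trunc_le_mul_pi (ε n) (u p)
        rwa [abs_of_pos (hε0 n)] at this
      · have := (hεlim.mul_const (Real.pi / 2)).mul_const (∫ p, ‖fderiv ℝ ψ p e‖)
        simpa using this
    have hψv := integrable_smul_of_tsupport_subset h.2.1 hψ.continuous hc hs
    have l2 : Tendsto (fun n => ∫ p in U, ψ p • (D n (u p) * v p)) atTop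
        (𝓝 (∫ p in U, ψ p • (χ (u p) * v p))) := by
      refine tendsto_integral_of_dominated_convergence (fun p => ‖ψ p • v p‖) (fun n => ?_)
        hψv.norm.integrableOn (fun n => Eventually.of_forall fun p => ?_)
        (Eventually.of_forall fun p => ?_)
      · exact hψ.continuous.aestronglyMeasurable.smul ((hDm n).mul h.2.1.aestronglyMeasurable)
      · rw [norm_smul, norm_smul, norm_mul]
        refine mul_le_mul_of_nonneg_left ?_ (norm_nonneg _)
        exact mul_le_of_le_one_left (norm_nonneg _) (abs_trunc_deriv_le _ _)
      · exact ((hDlim (u p)).mul_const (v p)).const_smul (ψ p)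
    rw [setIntegral_smul_eq_integral hs] at l2
    have e2 : ∀ n, ∫ p in U, ψ p • (D n (u p) * v p)
        = -∫ p, fderiv ℝ ψ p e * trunc (ε n) (u p) := fun n => by
      rw [setIntegral_smul_eq_integral hs, hn n, neg_neg]
      rfl
    simp only [e2] at l2
    exact tendsto_nhds_unique l2 (by simpa using l1.neg)
  rw [ae_restrict_iff' hU.measurableSet]
  filter_upwards [key] with q hq hqU h0
  simpa [hχ, h0] using hq hqU

/-! ### The chain rule for signed powers -/

/-- The primitive `t |t|^α / (α + 1)` of `|t|^α`. -/
noncomputable def signedPow (α t : ℝ) : ℝ := t * |t| ^ α / (α + 1)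

theorem hasDerivAt_signedPow {α : ℝ} (hα : 0 < α) (t : ℝ) :
    HasDerivAt (signedPow α) (|t| ^ α) t := by
  have hα1 : α + 1 ≠ 0 := by positivity
  rcases lt_trichotomy t 0 with ht | rfl | ht
  · have h1 : HasDerivAt (fun t : ℝ => -((-t) ^ (α + 1) / (α + 1))) (|t| ^ α) t := by
      have := (((hasDerivAt_id t).neg.rpow_const (p := α + 1)
        (Or.inl (by simpa using ht.ne))).div_const (α + 1)).neg
      refine this.congr_deriv ?_
      simp only [id, abs_of_neg ht, add_sub_cancel_right, Pi.neg_apply]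
      field_simp
    refine h1.congr_of_eventuallyEq ?_
    filter_upwards [eventually_lt_nhds ht] with x hx
    rw [signedPow, abs_of_neg hx, Real.rpow_add_one (by linarith)]
    ring
  · rw [abs_zero, Real.zero_rpow hα.ne', hasDerivAt_iff_tendsto_slope]
    have hc : Tendsto (fun x : ℝ => |x| ^ α / (α + 1)) (𝓝[≠] 0) (𝓝 0) := by
      have : ContinuousAt (fun x : ℝ => |x| ^ α / (α + 1)) 0 :=
        ((continuous_abs.continuousAt).rpow_const (Or.inr hα.le)).div_const _
      have := this.tendsto
      simp only [abs_zero, Real.zero_rpow hα.ne', zero_div] at this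
      exact this.mono_left nhdsWithin_le_nhds
    refine hc.congr' ?_
    filter_upwards [self_mem_nhdsWithin] with x hx
    have hx : x ≠ 0 := hx
    simp only [slope, signedPow, vsub_eq_sub, sub_zero, zero_mul, zero_div, smul_eq_mul]
    field_simp
  · have h1 : HasDerivAt (fun t : ℝ => t ^ (α + 1) / (α + 1)) (|t| ^ α) t := by
      have := ((hasDerivAt_id t).rpow_const (p := α + 1) (Or.inl (by simpa using ht.ne'))).div_const
        (α + 1)
      refine this.congr_deriv ?_
      simp only [id, abs_of_pos ht, add_sub_cancel_right]
      field_simp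
    refine h1.congr_of_eventuallyEq ?_
    filter_upwards [eventually_gt_nhds ht] with x hx
    rw [signedPow, abs_of_pos hx, Real.rpow_add_one hx.ne']
    ring

theorem continuous_signedPow {α : ℝ} (hα : 0 < α) : Continuous (signedPow α) :=
  continuous_iff_continuousAt.2 fun t => (hasDerivAt_signedPow hα t).continuousAt

theorem continuous_abs_rpow {α : ℝ} (hα : 0 < α) : Continuous fun t : ℝ => |t| ^ α :=
  continuous_abs.rpow_const fun _ => Or.inr hα.le

theorem abs_signedPow {α : ℝ} (hα : 0 < α) (t : ℝ) :
    |signedPow α t| = |t| ^ (α + 1) / (α + 1) := by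
  rw [signedPow, abs_div, abs_mul, abs_of_pos (by positivity : 0 < α + 1),
    abs_of_nonneg (by positivity : 0 ≤ |t| ^ α)]
  rcases eq_or_ne t 0 with rfl | ht
  · simp [Real.zero_rpow (by positivity : α + 1 ≠ 0)]
  · rw [Real.rpow_add_one (by simpa using ht), mul_comm]

theorem hasDerivAt_signedPow_trunc {α M : ℝ} (hα : 0 < α) (hM : M ≠ 0) (t : ℝ) :
    HasDerivAt (fun t => signedPow α (trunc M t)) (|trunc M t| ^ α * (1 / (1 + (t / M) ^ 2))) t :=
  (hasDerivAt_signedPow hα (trunc M t)).comp t (hasDerivAt_trunc hM t)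

theorem continuous_trunc {M : ℝ} (hM : M ≠ 0) : Continuous (trunc M) :=
  continuous_iff_continuousAt.2 fun t => (hasDerivAt_trunc hM t).continuousAt

theorem continuous_signedPow_trunc_deriv {α M : ℝ} (hα : 0 < α) (hM : M ≠ 0) :
    Continuous fun t => |trunc M t| ^ α * (1 / (1 + (t / M) ^ 2)) :=
  ((continuous_abs_rpow hα).comp (continuous_trunc hM)).mul (continuous_trunc_deriv M)

theorem abs_signedPow_trunc_deriv_le {α M : ℝ} (hα : 0 < α) (hM : M ≠ 0) (t : ℝ) :
    |(|trunc M t| ^ α * (1 / (1 + (t / M) ^ 2)))| ≤ |t| ^ α := by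
  rw [abs_mul, abs_of_nonneg (by positivity : 0 ≤ |trunc M t| ^ α)]
  calc _ ≤ |trunc M t| ^ α * 1 :=
        mul_le_mul_of_nonneg_left (abs_trunc_deriv_le M t) (by positivity)
    _ ≤ |t| ^ α := by
        rw [mul_one]
        exact Real.rpow_le_rpow (abs_nonneg _) (abs_trunc_le hM t) hα.le

theorem abs_signedPow_trunc_deriv_le_const {α M : ℝ} (hα : 0 < α) (t : ℝ) :
    |(|trunc M t| ^ α * (1 / (1 + (t / M) ^ 2)))| ≤ (|M| * (Real.pi / 2)) ^ α := by
  rw [abs_mul, abs_of_nonneg (by positivity : 0 ≤ |trunc M t| ^ α)]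
  calc _ ≤ |trunc M t| ^ α * 1 :=
        mul_le_mul_of_nonneg_left (abs_trunc_deriv_le M t) (by positivity)
    _ ≤ _ := by
        rw [mul_one]
        exact Real.rpow_le_rpow (abs_nonneg _) (abs_trunc_le_mul_pi M t) hα.le

theorem abs_signedPow_trunc_le {α M : ℝ} (hα : 0 < α) (hM : M ≠ 0) (t : ℝ) :
    |signedPow α (trunc M t)| ≤ |signedPow α t| := by
  rw [abs_signedPow hα, abs_signedPow hα]
  exact div_le_div_of_nonneg_right
    (Real.rpow_le_rpow (abs_nonneg _) (abs_trunc_le hM t) (by positivity)) (by positivity)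

/-- Removal of the truncation in an integration by parts formula. -/
theorem integral_signedPow_of_trunc {E : Type*} [MeasurableSpace E] {μ : Measure E} {α : ℝ}
    (hα : 0 < α) {u θ η : E → ℝ}
    (hu : AEStronglyMeasurable u μ) (hθ : AEStronglyMeasurable θ μ)
    (hη : AEStronglyMeasurable η μ) (h1 : Integrable (fun q => θ q * signedPow α (u q)) μ)
    (h2 : Integrable (fun q => η q * |u q| ^ α) μ)
    (h : ∀ n : ℕ, ∫ q, θ q * signedPow α (trunc ((n : ℝ) + 1) (u q)) ∂μ =
      -∫ q, η q * (|trunc ((n : ℝ) + 1) (u q)| ^ α * (1 / (1 + (u q / ((n : ℝ) + 1)) ^ 2))) ∂μ) :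
    ∫ q, θ q * signedPow α (u q) ∂μ = -∫ q, η q * |u q| ^ α ∂μ := by
  have hM : ∀ n : ℕ, (n : ℝ) + 1 ≠ 0 := fun n => by positivity
  have l1 : Tendsto (fun n : ℕ => ∫ q, θ q * signedPow α (trunc ((n : ℝ) + 1) (u q)) ∂μ) atTop
      (𝓝 (∫ q, θ q * signedPow α (u q) ∂μ)) := by
    refine tendsto_integral_of_dominated_convergence (fun q => ‖θ q * signedPow α (u q)‖)
      (fun n => ?_) h1.norm
      (fun n => Eventually.of_forall fun q => ?_) (Eventually.of_forall fun q => ?_)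
    · exact hθ.mul (((continuous_signedPow hα).comp
        (continuous_trunc (hM n))).comp_aestronglyMeasurable hu)
    · rw [norm_mul, norm_mul]
      exact mul_le_mul_of_nonneg_left (abs_signedPow_trunc_le hα (hM n) (u q)) (norm_nonneg (θ q))
    · exact (((continuous_signedPow hα).tendsto _).comp (tendsto_trunc (u q))).const_mul _
  have l2 : Tendsto (fun n : ℕ => ∫ q, η q * (|trunc ((n : ℝ) + 1) (u q)| ^ α *
      (1 / (1 + (u q / ((n : ℝ) + 1)) ^ 2))) ∂μ) atTop (𝓝 (∫ q, η q * |u q| ^ α ∂μ)) := by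
    refine tendsto_integral_of_dominated_convergence (fun q => ‖η q * |u q| ^ α‖)
      (fun n => ?_) h2.norm
      (fun n => Eventually.of_forall fun q => ?_) (Eventually.of_forall fun q => ?_)
    · exact hη.mul ((continuous_signedPow_trunc_deriv hα (hM n)).comp_aestronglyMeasurable hu)
    · rw [norm_mul (η q), norm_mul (η q)]
      refine mul_le_mul_of_nonneg_left ?_ (norm_nonneg (η q))
      refine (abs_signedPow_trunc_deriv_le hα (hM n) (u q)).trans (le_abs_self _)
    · have := ((((continuous_abs_rpow hα).tendsto _).comp (tendsto_trunc (u q))).mul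
        (tendsto_trunc_deriv (u q))).const_mul (η q)
      simpa using this
  refine tendsto_nhds_unique l1 ?_
  simp only [h]
  exact l2.neg

/-- The chain rule for the weak derivative of `u |u|^α / (α + 1)`. -/
theorem HasWeakPartial.signedPow_comp {α : ℝ} (hα : 0 < α) {U : Set (ℝ × ℝ)} (hU : IsOpen U)
    {e : ℝ × ℝ} {u v : ℝ × ℝ → ℝ} (h : HasWeakPartial U e u v)
    (hs : LocallyIntegrableOn (fun q => signedPow α (u q)) U)
    (hv : LocallyIntegrableOn (fun q => |u q| ^ α * v q) U) :
    HasWeakPartial U e (fun q => signedPow α (u q)) (fun q => |u q| ^ α * v q) := by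
  refine ⟨hs, hv, fun ψ hψ hc hsupp => ?_⟩
  have hψ' : Continuous (fun p => fderiv ℝ ψ p e) :=
    (hψ.continuous_fderiv (by simp)).clm_apply continuous_const
  have hds := (tsupport_fderiv_apply_subset' ψ e).trans hsupp
  have := integral_signedPow_of_trunc (μ := volume.restrict U) hα (u := u)
    (θ := fun p => fderiv ℝ ψ p e) (η := fun p => ψ p * v p) h.1.aestronglyMeasurable
    hψ'.aestronglyMeasurable
    (hψ.continuous.aestronglyMeasurable.mul h.2.1.aestronglyMeasurable)
    (integrable_smul_of_tsupport_subset hs hψ' (hc.fderiv_apply ℝ e) hds).integrableOn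
    (by
      refine (integrable_smul_of_tsupport_subset hv hψ.continuous hc hsupp).integrableOn.congr
        (Eventually.of_forall fun p => ?_)
      simp only [smul_eq_mul]; ring) fun n => ?_
  · simp only [smul_eq_mul]
    rw [this]
    congr 1
    refine integral_congr_ae (Eventually.of_forall fun p => ?_)
    simp only; ring
  · have hM : (n : ℝ) + 1 ≠ 0 := by positivity
    -- The power itself is not Lipschitz, but its composition with the bounded truncation has a
    -- bounded continuous derivative.
    have := h.integral_comp hU (hasDerivAt_signedPow_trunc hα hM)
      (continuous_signedPow_trunc_deriv hα hM) (abs_signedPow_trunc_deriv_le_const hα)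
      (hψ.of_le (by simp)) hc hsupp
    have e1 := setIntegral_smul_eq_integral (μ := volume)
      (f := fun q => signedPow α (trunc ((n : ℝ) + 1) (u q))) hds
    have e2 := setIntegral_smul_eq_integral (μ := volume) (U := U) (ψ := ψ)
      (f := fun p => |trunc ((n : ℝ) + 1) (u p)| ^ α * (1 / (1 + (u p / ((n : ℝ) + 1)) ^ 2)) * v p)
      hsupp
    simp only [smul_eq_mul] at e1 e2
    rw [e1, this, ← e2]
    congr 1
    refine integral_congr_ae (Eventually.of_forall fun p => ?_)
    simp only; ring

/-! ### Weighted integration by parts and integrability across the axis -/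

theorem isClosed_yAxis : IsClosed yAxis := isClosed_eq continuous_fst continuous_const

theorem volume_yAxis : volume yAxis = 0 := by
  have : yAxis = ({0} : Set ℝ) ×ˢ (univ : Set ℝ) := by
    ext q; simp [yAxis]
  rw [this, Measure.volume_eq_prod, Measure.prod_prod]
  simp

/-- For small `α` the weight `|x|^α` is not `C¹`, so `|x|^α ψ` is not an admissible test function.
The weight is replaced by `(x² + 1/(n+1))^(α/2)`, which is `C¹`, decreases to it, and is constant in
`y`, so that it passes through `∂_y`. -/
theorem integral_weight_comp {U : Set (ℝ × ℝ)} (hU : IsOpen U) {α : ℝ} (hα : 0 < α)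
    {u v : ℝ × ℝ → ℝ} (h : HasWeakPartial U (0, 1) u v) {G G' : ℝ → ℝ}
    (hG : ∀ t, HasDerivAt G (G' t) t) (hG' : Continuous G') {L : ℝ} (hL : ∀ t, |G' t| ≤ L)
    {ψ : ℝ × ℝ → ℝ} (hψ : ContDiff ℝ 1 ψ) (hc : HasCompactSupport ψ) (hs : tsupport ψ ⊆ U) :
    ∫ p, |p.1| ^ α * fderiv ℝ ψ p (0, 1) * G (u p) =
      -∫ p, |p.1| ^ α * ψ p * (G' (u p) * v p) := by
  set a : ℕ → ℝ × ℝ → ℝ := fun n p => (p.1 ^ 2 + 1 / ((n : ℝ) + 1)) ^ (α / 2) with ha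
  have hpos : ∀ (n : ℕ) (p : ℝ × ℝ), 0 < p.1 ^ 2 + 1 / ((n : ℝ) + 1) := fun n p => by positivity
  have haC : ∀ n, ContDiff ℝ 1 (a n) := fun n =>
    ContDiff.rpow_const_of_ne (by fun_prop) fun p => (hpos n p).ne'
  have halim : ∀ p : ℝ × ℝ, Tendsto (fun n => a n p) atTop (𝓝 (|p.1| ^ α)) := fun p => by
    have h1 := (tendsto_one_div_add_atTop_nhds_zero_nat (𝕜 := ℝ)).const_add (p.1 ^ 2)
    have h2 := h1.rpow_const (p := α / 2) (Or.inr (by positivity))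
    refine h2.trans (le_of_eq ?_)
    rw [add_zero, ← sq_abs, ← Real.rpow_natCast, ← Real.rpow_mul (abs_nonneg _)]
    congr 2
    push_cast
    ring
  have hale : ∀ n p, a n p ≤ a 0 p := fun n p => by
    refine Real.rpow_le_rpow (hpos n p).le ?_ (by positivity)
    have : 1 / ((n : ℝ) + 1) ≤ 1 / (((0 : ℕ) : ℝ) + 1) :=
      one_div_le_one_div_of_le (by norm_num) (by simp)
    linarith
  have ha0 : ∀ n p, 0 ≤ a n p := fun n p => Real.rpow_nonneg (hpos n p).le _
  have hda : ∀ n p, fderiv ℝ (a n) p (0, 1) = 0 := fun n p => by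
    have h1 : HasLineDerivAt ℝ (a n) 0 p (0, 1) := by
      have : (fun t : ℝ => a n (p + t • ((0 : ℝ), (1 : ℝ)))) = fun _ => a n p := by
        funext t; simp [ha]
      rw [HasLineDerivAt, this]
      exact hasDerivAt_const _ _
    exact (((haC n).differentiable one_ne_zero p).lineDeriv_eq_fderiv).symm.trans h1.lineDeriv
  have hd : ∀ n p, fderiv ℝ (fun q => a n q * ψ q) p (0, 1) = a n p * fderiv ℝ ψ p (0, 1) := by
    intro n p
    rw [fderiv_fun_mul ((haC n).differentiable one_ne_zero p) (hψ.differentiable one_ne_zero p)]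
    simp [hda]
  have hψ' : Continuous (fun p => fderiv ℝ ψ p (0, 1)) :=
    (hψ.continuous_fderiv one_ne_zero).clm_apply continuous_const
  have hψ's := tsupport_fderiv_apply_subset' ψ (0, 1)
  have hGu : LocallyIntegrableOn (fun q => G (u q)) U := locallyIntegrableOn_comp_lipschitz h.1
    (continuous_iff_continuousAt.2 fun t => (hG t).continuousAt)
    (abs_sub_le_of_hasDerivAt hG hL) hU
  have hG'u : LocallyIntegrableOn (fun q => G' (u q) * v q) U :=
    locallyIntegrableOn_mul_bdd h.2.1 (hG'.comp_aestronglyMeasurable h.1.aestronglyMeasurable)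
      (fun q => hL _) hU
  have hlim : ∀ {θ f : ℝ × ℝ → ℝ}, Continuous θ → HasCompactSupport θ → tsupport θ ⊆ U →
      LocallyIntegrableOn f U → Tendsto (fun n => ∫ p, a n p * θ p * f p) atTop
        (𝓝 (∫ p, |p.1| ^ α * θ p * f p)) := by
    intro θ f hθ hθc hθs hf
    have hi : ∀ n, Integrable (fun p => (a n p * θ p) * f p) := fun n =>
      integrable_smul_of_tsupport_subset (ψ := fun p => a n p * θ p) hf
        ((haC n).continuous.mul hθ) hθc.mul_left ((tsupport_mul_subset_right).trans hθs)
    refine tendsto_integral_of_dominated_convergence (fun p => ‖(a 0 p * θ p) * f p‖)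
      (fun n => (hi n).aestronglyMeasurable) (hi 0).norm
      (fun n => Eventually.of_forall fun p => ?_) (Eventually.of_forall fun p => ?_)
    · rw [norm_mul, norm_mul, norm_mul, norm_mul]
      gcongr
      rw [Real.norm_of_nonneg (ha0 _ _), Real.norm_of_nonneg (ha0 _ _)]
      exact hale n p
    · exact ((halim p).mul_const _).mul_const _
  refine tendsto_nhds_unique (hlim hψ' (hc.fderiv_apply ℝ _) (hψ's.trans hs) hGu) ?_
  refine ((hlim hψ.continuous hc hs hG'u).neg).congr fun n => ?_
  have := h.integral_comp hU hG hG' hL ((haC n).mul hψ) hc.mul_left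
    ((tsupport_mul_subset_right).trans hs)
  simp only [hd] at this
  exact this.symm

theorem integral_weight {U : Set (ℝ × ℝ)} (hU : IsOpen U) {α : ℝ} (hα : 0 < α)
    {u v : ℝ × ℝ → ℝ} (h : HasWeakPartial U (0, 1) u v)
    {ψ : ℝ × ℝ → ℝ} (hψ : ContDiff ℝ 1 ψ) (hc : HasCompactSupport ψ) (hs : tsupport ψ ⊆ U) :
    ∫ p, |p.1| ^ α * fderiv ℝ ψ p (0, 1) * u p = -∫ p, |p.1| ^ α * ψ p * v p := by
  simpa using integral_weight_comp hU hα h (G := id) (G' := fun _ => 1)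
    (fun t => hasDerivAt_id t) continuous_const (L := 1) (by simp) hψ hc hs

/-- Only the weighted product `|x|^α |u|^α v` is known to be integrable across the axis, so the
power's `y`-derivative is never used without its weight; the truncation is removed under the
weighted integral. -/
theorem integral_weight_signedPow {U : Set (ℝ × ℝ)} (hU : IsOpen U) {α : ℝ} (hα : 0 < α)
    {u v : ℝ × ℝ → ℝ} (h : HasWeakPartial U (0, 1) u v)
    (hsu : LocallyIntegrableOn (fun q => signedPow α (u q)) U)
    (hv : LocallyIntegrableOn (fun q => |q.1| ^ α * (|u q| ^ α * v q)) U)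
    {ψ : ℝ × ℝ → ℝ} (hψ : ContDiff ℝ 1 ψ) (hc : HasCompactSupport ψ) (hs : tsupport ψ ⊆ U) :
    ∫ p, |p.1| ^ α * fderiv ℝ ψ p (0, 1) * signedPow α (u p) =
      -∫ p, ψ p * (|p.1| ^ α * (|u p| ^ α * v p)) := by
  have hψ' : Continuous (fun p => fderiv ℝ ψ p (0, 1)) :=
    (hψ.continuous_fderiv one_ne_zero).clm_apply continuous_const
  have hwt : Continuous fun p : ℝ × ℝ => |p.1| ^ α := (continuous_abs_rpow hα).comp continuous_fst
  have hθ : Continuous fun p => |p.1| ^ α * fderiv ℝ ψ p (0, 1) := hwt.mul hψ'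
  have hθs : tsupport (fun p => |p.1| ^ α * fderiv ℝ ψ p (0, 1)) ⊆ U :=
    (tsupport_mul_subset_right.trans (tsupport_fderiv_apply_subset' ψ _)).trans hs
  have hηs : tsupport (fun p => |p.1| ^ α * ψ p) ⊆ U := tsupport_mul_subset_right.trans hs
  have := integral_signedPow_of_trunc (μ := volume.restrict U) hα (u := u)
    (θ := fun p => |p.1| ^ α * fderiv ℝ ψ p (0, 1)) (η := fun p => |p.1| ^ α * ψ p * v p)
    h.1.aestronglyMeasurable hθ.aestronglyMeasurable
    ((hwt.mul hψ.continuous).aestronglyMeasurable.mul h.2.1.aestronglyMeasurable)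
    (integrable_smul_of_tsupport_subset hsu hθ (hc.fderiv_apply ℝ _).mul_left hθs).integrableOn
    (by
      refine (integrable_smul_of_tsupport_subset hv hψ.continuous hc hs).integrableOn.congr
        (Eventually.of_forall fun p => ?_)
      simp only [smul_eq_mul]; ring) fun n => ?_
  · have e1 := setIntegral_smul_eq_integral (μ := volume) (f := fun q => signedPow α (u q)) hθs
    have e2 := setIntegral_smul_eq_integral (μ := volume) (U := U) (ψ := ψ)
      (f := fun p => |p.1| ^ α * (|u p| ^ α * v p)) hs
    simp only [smul_eq_mul] at e1 e2
    rw [← e1, this, ← e2]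
    congr 1
    refine integral_congr_ae (Eventually.of_forall fun p => ?_)
    simp only; ring
  · have hM : (n : ℝ) + 1 ≠ 0 := by positivity
    have := integral_weight_comp hU hα h (hasDerivAt_signedPow_trunc hα hM)
      (continuous_signedPow_trunc_deriv hα hM) (abs_signedPow_trunc_deriv_le_const hα) hψ hc hs
    have e1 := setIntegral_smul_eq_integral (μ := volume)
      (f := fun q => signedPow α (trunc ((n : ℝ) + 1) (u q))) hθs
    have e2 := setIntegral_smul_eq_integral (μ := volume) (U := U)
      (f := fun p => |trunc ((n : ℝ) + 1) (u p)| ^ α * (1 / (1 + (u p / ((n : ℝ) + 1)) ^ 2)) * v p)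
      hηs
    simp only [smul_eq_mul] at e1 e2
    rw [e1, this, ← e2]
    congr 1
    refine integral_congr_ae (Eventually.of_forall fun p => ?_)
    simp only; ring

/-- A function of class `HW` whose power `u |u|^α` is locally integrable off the axis, and has
locally integrable derivative in the direction transversal to the axis, has a locally integrable
power across the axis. -/
theorem locallyIntegrableOn_signedPow_of_diff_yAxis {α : ℝ} (hα : 0 < α) {Ω : Set (ℝ × ℝ)}
    (hΩ : IsOpen Ω) {u v : ℝ × ℝ → ℝ} (h : HasWeakPartial Ω (1, 0) u v)
    (hs : LocallyIntegrableOn (fun q => signedPow α (u q)) (Ω \ yAxis))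
    (hv : LocallyIntegrableOn (fun q => |u q| ^ α * v q) Ω) :
    LocallyIntegrableOn (fun q => signedPow α (u q)) Ω := by
  intro q hq
  by_cases hq0 : q ∈ yAxis
  swap
  · have := hs q ⟨hq, hq0⟩
    rwa [(hΩ.sdiff isClosed_yAxis).nhdsWithin_eq ⟨hq, hq0⟩, ← hΩ.nhdsWithin_eq hq] at this
  have hq0 : q.1 = 0 := hq0
  obtain ⟨r, hr, hrΩ⟩ := Metric.isOpen_iff.1 hΩ q hq
  set a := r / 4 with ha
  have ha0 : 0 < a := by positivity
  let b : ContDiffBump (0 : ℝ) := ⟨a, 2 * a, ha0, by linarith⟩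
  let c : ContDiffBump (q.2 : ℝ) := ⟨a, 2 * a, ha0, by linarith⟩
  have hb : ContDiff ℝ ∞ (b : ℝ → ℝ) := b.contDiff
  have hcC : ContDiff ℝ ∞ (c : ℝ → ℝ) := c.contDiff
  have hsub : Metric.closedBall q (2 * a) ⊆ Ω :=
    (Metric.closedBall_subset_ball (by linarith)).trans hrΩ
  -- The test function is `x` times a bump `β` centred on the axis. Its `x`-derivative is `β + κ`,
  -- where `κ` contains `b'` and so vanishes for `|x| < a`. The integral against `β` is thus
  -- controlled by integrals off the axis, where the power is integrable, and by the transversal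
  -- derivative.
  set Θ : ℝ × ℝ → ℝ := fun p => p.1 * (b p.1 * c p.2) with hΘ
  set β : ℝ × ℝ → ℝ := fun p => b p.1 * c p.2 with hβ
  set κ : ℝ × ℝ → ℝ := fun p => p.1 * deriv b p.1 * c p.2 with hκ
  have hβC : ContDiff ℝ ∞ β := (hb.comp contDiff_fst).mul (hcC.comp contDiff_snd)
  have hΘC : ContDiff ℝ ∞ Θ := contDiff_fst.mul hβC
  have hβs : Function.support β ⊆ Metric.closedBall q (2 * a) := by
    intro p hp
    have h1 : b p.1 ≠ 0 := left_ne_zero_of_mul hp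
    have h2 : c p.2 ≠ 0 := right_ne_zero_of_mul hp
    have h1' : p.1 ∈ Function.support b := h1
    have h2' : p.2 ∈ Function.support c := h2
    rw [b.support_eq] at h1'
    rw [c.support_eq] at h2'
    rw [Metric.mem_closedBall, Prod.dist_eq, hq0]
    exact max_le (Metric.mem_ball.1 h1').le (Metric.mem_ball.1 h2').le
  have hβts : tsupport β ⊆ Metric.closedBall q (2 * a) :=
    closure_minimal hβs Metric.isClosed_closedBall
  have hβc : HasCompactSupport β :=
    HasCompactSupport.of_support_subset_isCompact (isCompact_closedBall _ _) hβs
  have hΘts : tsupport Θ ⊆ Metric.closedBall q (2 * a) := tsupport_mul_subset_right.trans hβts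
  have hΘc : HasCompactSupport Θ := hβc.mul_left
  have hΘ' : ∀ p, fderiv ℝ Θ p (1, 0) = β p + κ p := by
    intro p
    have h1 : HasLineDerivAt ℝ Θ (β p + κ p) p (1, 0) := by
      rw [HasLineDerivAt]
      have e : (fun t : ℝ => Θ (p + t • ((1 : ℝ), (0 : ℝ))))
          = fun t => (p.1 + t) * (b (p.1 + t) * c p.2) := by
        funext t; simp [hΘ]
      rw [e]
      have h1 : HasDerivAt (fun t : ℝ => p.1 + t) 1 0 := (hasDerivAt_id (0 : ℝ)).const_add p.1
      have h2 : HasDerivAt (fun t : ℝ => b (p.1 + t)) (deriv b p.1) 0 := by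
        have : HasDerivAt b (deriv b p.1) (p.1 + 0) := by
          rw [add_zero]; exact (hb.differentiable (by simp) p.1).hasDerivAt
        exact (this.comp 0 h1).congr_deriv (mul_one _)
      refine (h1.mul (h2.mul_const (c p.2))).congr_deriv ?_
      simp [hβ, hκ]
      ring
    exact ((hΘC.differentiable (by simp) p).lineDeriv_eq_fderiv).symm.trans h1.lineDeriv
  have hκC : Continuous κ := by
    have : Continuous (deriv (b : ℝ → ℝ)) := hb.continuous_deriv (by simp)
    exact (continuous_fst.mul (this.comp continuous_fst)).mul (hcC.continuous.comp continuous_snd)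
  have hκeq : κ = fun p => fderiv ℝ Θ p (1, 0) - β p := by
    funext p; rw [hΘ']; ring
  have hκs : Function.support κ ⊆ Metric.closedBall q (2 * a) ∩ {p | a ≤ |p.1|} := by
    intro p hp
    refine ⟨?_, ?_⟩
    · by_contra hcon
      refine hp ?_
      rw [hκeq]
      simp only
      rw [image_eq_zero_of_notMem_tsupport (fun h => hcon (hβts h)),
        image_eq_zero_of_notMem_tsupport (f := fun p => fderiv ℝ Θ p (1, 0))
          (fun h => hcon (hΘts (tsupport_fderiv_apply_subset' Θ _ h))), sub_zero]
    · by_contra hcon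
      refine hp ?_
      have h1 : p.1 ∈ Metric.ball (0 : ℝ) a := by simpa using hcon
      have h2 : (b : ℝ → ℝ) =ᶠ[𝓝 p.1] fun _ => 1 := b.eventuallyEq_one_of_mem_ball h1
      simp [hκ, h2.deriv_eq]
  have hκcl : IsClosed (Metric.closedBall q (2 * a) ∩ {p : ℝ × ℝ | a ≤ |p.1|}) :=
    Metric.isClosed_closedBall.inter (isClosed_le continuous_const continuous_fst.abs)
  have hκts : tsupport κ ⊆ Ω \ yAxis := (closure_minimal hκs hκcl).trans fun p hp =>
    ⟨hsub hp.1, fun h0 => by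
      have h1 : a ≤ |p.1| := hp.2
      have h0 : p.1 = 0 := h0
      rw [h0, abs_zero] at h1
      linarith⟩
  have hκc : HasCompactSupport κ := HasCompactSupport.of_support_subset_isCompact
    (isCompact_closedBall _ _) (hκs.trans inter_subset_left)
  have hκi : Integrable κ := hκC.integrable_of_hasCompactSupport hκc
  have hκsi : Integrable (fun p => κ p * signedPow α (u p)) :=
    integrable_smul_of_tsupport_subset hs hκC hκc hκts
  have hΘvi : Integrable (fun p => Θ p * (|u p| ^ α * v p)) :=
    integrable_smul_of_tsupport_subset hv hΘC.continuous hΘc (hΘts.trans hsub)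
  have hβ0 : ∀ p, 0 ≤ β p := fun p => mul_nonneg b.nonneg c.nonneg
  set C := ∫ p, (|κ p| + |κ p * signedPow α (u p)| + |Θ p * (|u p| ^ α * v p)|) with hC
  have hCi : Integrable (fun p => |κ p| + |κ p * signedPow α (u p)| + |Θ p * (|u p| ^ α * v p)|) :=
    (hκi.abs.add hκsi.abs).add hΘvi.abs
  have bound : ∀ n : ℕ, ∫⁻ p, ENNReal.ofReal
      (β p * |signedPow α (trunc ((n : ℝ) + 1) (u p))|) ≤ ENNReal.ofReal C := by
    intro n
    set M := (n : ℝ) + 1 with hMdef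
    have hM : M ≠ 0 := by positivity
    set S : ℝ → ℝ := fun t => signedPow α (trunc M t) with hS
    set S' : ℝ → ℝ := fun t => |trunc M t| ^ α * (1 / (1 + (t / M) ^ 2)) with hS'
    have hSd : ∀ t, HasDerivAt S (S' t) t := hasDerivAt_signedPow_trunc hα hM
    have hSc : Continuous S := continuous_iff_continuousAt.2 fun t => (hSd t).continuousAt
    have hS'c : Continuous S' := continuous_signedPow_trunc_deriv hα hM
    -- A `C¹` substitute for `|S|`, so that the chain rule applies: it satisfies `|S| ≤ N ≤ 1 +
    -- |signedPow|` and `|N'| ≤ |S'|`, whence the bound `C` does not depend on the truncation level.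
    set N : ℝ → ℝ := fun t => Real.sqrt (1 + S t ^ 2) with hN
    set N' : ℝ → ℝ := fun t => S t * S' t / Real.sqrt (1 + S t ^ 2) with hN'
    have hpos : ∀ t, 0 < 1 + S t ^ 2 := fun t => by positivity
    have hNd : ∀ t, HasDerivAt N (N' t) t := fun t => by
      have := ((((hSd t).pow 2).const_add 1)).sqrt (hpos t).ne'
      refine this.congr_deriv ?_
      have : Real.sqrt (1 + S t ^ 2) ≠ 0 := (Real.sqrt_pos.2 (hpos t)).ne'
      simp only [hN', Pi.pow_apply]
      field_simp
      simp
      ring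
    have hN'c : Continuous N' := (hSc.mul hS'c).div
      ((continuous_const.add (hSc.pow 2)).sqrt) fun t => (Real.sqrt_pos.2 (hpos t)).ne'
    have hSN : ∀ t, |S t| ≤ N t := fun t => by
      rw [← Real.sqrt_sq_eq_abs]
      exact Real.sqrt_le_sqrt (by linarith)
    have hN'S : ∀ t, |N' t| ≤ |S' t| := fun t => by
      have h0 : 0 < Real.sqrt (1 + S t ^ 2) := Real.sqrt_pos.2 (hpos t)
      simp only [hN']
      rw [abs_div, abs_mul, abs_of_pos h0, div_le_iff₀ h0, mul_comm]
      exact mul_le_mul_of_nonneg_left (hSN t) (abs_nonneg _)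
    have hNle : ∀ t, N t ≤ 1 + |signedPow α t| := fun t => by
      have h1 : |S t| ≤ |signedPow α t| := abs_signedPow_trunc_le hα hM t
      rw [hN, Real.sqrt_le_left (by positivity), ← sq_abs (S t)]
      nlinarith [abs_nonneg (S t), abs_nonneg (signedPow α t)]
    have hN0 : ∀ t, 0 ≤ N t := fun t => Real.sqrt_nonneg _
    have hNL : ∀ t, |N' t| ≤ (|M| * (Real.pi / 2)) ^ α := fun t =>
      (hN'S t).trans (abs_signedPow_trunc_deriv_le_const hα t)
    have key := h.integral_comp hΩ hNd hN'c hNL (hΘC.of_le (by simp)) hΘc (hΘts.trans hsub)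
    simp only [hΘ'] at key
    have hNu : LocallyIntegrableOn (fun p => N (u p)) Ω := locallyIntegrableOn_comp_lipschitz h.1
      (continuous_iff_continuousAt.2 fun t => (hNd t).continuousAt)
      (abs_sub_le_of_hasDerivAt hNd hNL) hΩ
    have hi1 : Integrable (fun p => β p * N (u p)) :=
      integrable_smul_of_tsupport_subset hNu hβC.continuous hβc (hβts.trans hsub)
    have hi2 : Integrable (fun p => κ p * N (u p)) :=
      integrable_smul_of_tsupport_subset hNu hκC hκc (hκts.trans sdiff_subset)
    have hi3 : Integrable (fun p => Θ p * (N' (u p) * v p)) :=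
      integrable_smul_of_tsupport_subset (locallyIntegrableOn_mul_bdd h.2.1
        (hN'c.comp_aestronglyMeasurable h.1.aestronglyMeasurable) (fun p => hNL _) hΩ)
        hΘC.continuous hΘc (hΘts.trans hsub)
    have e1 : ∫ p, β p * N (u p) = ∫ p, (-(Θ p * (N' (u p) * v p)) - κ p * N (u p)) := by
      simp only [add_mul] at key
      rw [integral_add hi1 hi2] at key
      have : ∫ p, (-(Θ p * (N' (u p) * v p)) - κ p * N (u p))
          = -(∫ p, Θ p * (N' (u p) * v p)) - ∫ p, κ p * N (u p) := by
        rw [← integral_neg]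
        exact integral_sub hi3.neg hi2
      rw [this]
      linarith
    have e2 : ∫ p, β p * N (u p) ≤ C := by
      rw [e1]
      refine integral_mono (hi3.neg.sub hi2) hCi fun p => ?_
      have i1 : |Θ p * (N' (u p) * v p)| ≤ |Θ p * (|u p| ^ α * v p)| := by
        rw [abs_mul (Θ p), abs_mul (N' _), abs_mul (Θ p), abs_mul (|u p| ^ α)]
        refine mul_le_mul_of_nonneg_left (mul_le_mul_of_nonneg_right ?_ (abs_nonneg _))
          (abs_nonneg _)
        refine (hN'S _).trans ((abs_signedPow_trunc_deriv_le hα hM _).trans (le_abs_self _))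
      have i2 : |κ p * N (u p)| ≤ |κ p| + |κ p * signedPow α (u p)| := by
        rw [abs_mul (κ p), abs_mul (κ p), abs_of_nonneg (hN0 _)]
        nlinarith [abs_nonneg (κ p), hNle (u p)]
      simp only
      have i3 := neg_abs_le (Θ p * (N' (u p) * v p))
      have i4 := neg_abs_le (κ p * N (u p))
      linarith
    calc _ ≤ ∫⁻ p, ENNReal.ofReal (β p * N (u p)) := lintegral_mono fun p =>
          ENNReal.ofReal_le_ofReal (mul_le_mul_of_nonneg_left (hSN _) (hβ0 p))
      _ = ENNReal.ofReal (∫ p, β p * N (u p)) := (ofReal_integral_eq_lintegral_ofReal hi1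
          (Eventually.of_forall fun p => mul_nonneg (hβ0 p) (hN0 _))).symm
      _ ≤ _ := ENNReal.ofReal_le_ofReal e2
  have hball : Metric.ball q a ⊆ Ω := (Metric.ball_subset_closedBall.trans
    (Metric.closedBall_subset_closedBall (by linarith))).trans hsub
  have hum : AEStronglyMeasurable u (volume.restrict (Metric.ball q a)) :=
    h.1.aestronglyMeasurable.mono_measure (Measure.restrict_mono hball le_rfl)
  refine ⟨Metric.ball q a, mem_nhdsWithin_of_mem_nhds (Metric.ball_mem_nhds q ha0),
    (continuous_signedPow hα).comp_aestronglyMeasurable hum, ?_⟩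
  have hf : ∫⁻ p in Metric.ball q a, ‖signedPow α (u p)‖ₑ ≤ ENNReal.ofReal C := by
    have hlim : ∀ p, Tendsto (fun n : ℕ => ENNReal.ofReal
        (β p * |signedPow α (trunc ((n : ℝ) + 1) (u p))|)) atTop
        (𝓝 (ENNReal.ofReal (β p * |signedPow α (u p)|))) := fun p =>
      ENNReal.tendsto_ofReal ((((continuous_signedPow hα).abs.tendsto _).comp
        (tendsto_trunc (u p))).const_mul (β p))
    have hle : ∫⁻ p in Metric.ball q a, ENNReal.ofReal (β p * |signedPow α (u p)|)
        ≤ ENNReal.ofReal C := by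
      -- Fatou's lemma removes the truncation, since the bound is uniform; on the small ball both
      -- cut-offs equal 1.
      have hF := lintegral_liminf_le' (μ := volume.restrict (Metric.ball q a)) (u := atTop)
        (f := fun (n : ℕ) p => ENNReal.ofReal (β p * |signedPow α (trunc ((n : ℝ) + 1) (u p))|))
        fun n => by
          have hM : (n : ℝ) + 1 ≠ 0 := by positivity
          refine AEMeasurable.ennreal_ofReal (hβC.continuous.aemeasurable.mul ?_)
          exact ((continuous_signedPow hα).abs.comp
            (continuous_trunc hM)).measurable.comp_aemeasurable hum.aemeasurable
      simp only [fun p => (hlim p).liminf_eq] at hF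
      refine hF.trans (liminf_le_of_le (by isBoundedDefault) fun x hx => ?_)
      obtain ⟨n, hn⟩ := hx.exists
      exact hn.trans ((setLIntegral_le_lintegral _ _).trans (bound n))
    refine le_trans (le_of_eq ?_) hle
    refine setLIntegral_congr_fun Metric.isOpen_ball.measurableSet fun p hp => ?_
    have hp' : dist p.1 q.1 < a ∧ dist p.2 q.2 < a := by
      rw [Metric.mem_ball, Prod.dist_eq] at hp
      exact max_lt_iff.1 hp
    have h1 : b p.1 = 1 := b.one_of_mem_closedBall (by
      have := hp'.1.le
      rw [hq0] at this
      exact this)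
    have h2 : c p.2 = 1 := c.one_of_mem_closedBall hp'.2.le
    simp only [hβ, h1, h2, one_mul]
    rw [← Real.norm_eq_abs, ofReal_norm]
  exact hf.trans_lt ENNReal.ofReal_lt_top

/-! ### Local Sobolev embedding in the plane -/

open scoped Manifold in
theorem exists_contDiff_cutoff {E : Type*} [NormedAddCommGroup E] [NormedSpace ℝ E]
    [FiniteDimensional ℝ E] {K U : Set E} (hK : IsCompact K) (hU : IsOpen U) (hKU : K ⊆ U) :
    ∃ χ : E → ℝ, ContDiff ℝ ∞ χ ∧ HasCompactSupport χ ∧ tsupport χ ⊆ U ∧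
      (∀ᶠ x in 𝓝ˢ K, χ x = 1) := by
  obtain ⟨δ, hδ, hδU⟩ := hK.exists_cthickening_subset_open hU hKU
  have hsub : K ⊆ interior (Metric.cthickening δ K) :=
    (Metric.self_subset_thickening hδ K).trans
      (interior_maximal (Metric.thickening_subset_cthickening δ K) Metric.isOpen_thickening)
  obtain ⟨f, h1, h0, -⟩ := exists_contMDiffMap_one_nhds_of_subset_interior (n := (⊤ : ℕ∞)) 𝓘(ℝ, E)
    hK.isClosed hsub
  have hs : Function.support f ⊆ Metric.cthickening δ K := fun x hx => by
    by_contra h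
    exact hx (h0 x h)
  exact ⟨f, f.contMDiff.contDiff, HasCompactSupport.of_support_subset_isCompact hK.cthickening hs,
    (closure_minimal hs Metric.isClosed_cthickening).trans hδU, h1⟩

theorem HasWeakPartial.cutoff_mul {U : Set (ℝ × ℝ)} {e : ℝ × ℝ} {u v : ℝ × ℝ → ℝ}
    (h : HasWeakPartial U e u v) {χ : ℝ × ℝ → ℝ} (hχ : ContDiff ℝ ∞ χ) (hc : HasCompactSupport χ)
    (hs : tsupport χ ⊆ U) :
    HasWeakPartial univ e (fun q => χ q * u q) (fun q => χ q * v q + fderiv ℝ χ q e * u q) := by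
  have hχ' : Continuous (fun p => fderiv ℝ χ p e) :=
    (hχ.continuous_fderiv (by simp)).clm_apply continuous_const
  have hχ's := (tsupport_fderiv_apply_subset' χ e).trans hs
  have i1 : Integrable (fun q => χ q * u q) :=
    integrable_smul_of_tsupport_subset h.1 hχ.continuous hc hs
  have i2 : Integrable (fun q => χ q * v q) :=
    integrable_smul_of_tsupport_subset h.2.1 hχ.continuous hc hs
  have i3 : Integrable (fun q => fderiv ℝ χ q e * u q) :=
    integrable_smul_of_tsupport_subset h.1 hχ' (hc.fderiv_apply ℝ e) hχ's
  refine .of_integral_eq (i1.locallyIntegrable.locallyIntegrableOn _)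
    ((i2.add i3).locallyIntegrable.locallyIntegrableOn _) fun ψ hψ hψc _ => ?_
  have hψ' : Continuous (fun p => fderiv ℝ ψ p e) :=
    (hψ.continuous_fderiv (by simp)).clm_apply continuous_const
  have key := h.integral_eq (hψ.mul hχ) hc.mul_left (tsupport_mul_subset_right.trans hs)
  have hd : ∀ p, fderiv ℝ (fun q => ψ q * χ q) p e
      = fderiv ℝ ψ p e * χ p + ψ p * fderiv ℝ χ p e := fun p => by
    rw [fderiv_fun_mul (hψ.differentiable (by simp) p) (hχ.differentiable (by simp) p)]
    simp
    ring
  simp only [hd, smul_eq_mul, mul_assoc, add_mul] at key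
  simp only [smul_eq_mul, mul_add]
  have j1 : Integrable (fun p => fderiv ℝ ψ p e * (χ p * u p)) :=
    integrable_smul_of_tsupport_subset (i1.locallyIntegrable.locallyIntegrableOn univ) hψ'
      (hψc.fderiv_apply ℝ e) (subset_univ _)
  have j2 : Integrable (fun p => ψ p * (χ p * v p)) :=
    integrable_smul_of_tsupport_subset (i2.locallyIntegrable.locallyIntegrableOn univ)
      hψ.continuous hψc (subset_univ _)
  have j3 : Integrable (fun p => ψ p * (fderiv ℝ χ p e * u p)) :=
    integrable_smul_of_tsupport_subset (i3.locallyIntegrable.locallyIntegrableOn univ)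
      hψ.continuous hψc (subset_univ _)
  rw [integral_add j1 j3] at key
  rw [integral_add j2 j3]
  linarith

theorem MemLp.mul_of_tsupport_subset {U : Set (ℝ × ℝ)} {f θ : ℝ × ℝ → ℝ} {p : ℝ≥0∞}
    (hf : ∀ K ⊆ U, IsCompact K → MemLp f p (volume.restrict K)) (hθ : Continuous θ)
    (hc : HasCompactSupport θ) (hs : tsupport θ ⊆ U) : MemLp (fun q => θ q * f q) p := by
  obtain ⟨C, hC⟩ := hθ.bounded_above_of_compact_support hc
  have hcm : MeasurableSet (tsupport θ) := (isClosed_tsupport θ).measurableSet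
  have e : (fun q => θ q * f q) = (tsupport θ).indicator (fun q => θ q * f q) := by
    rw [eq_comm, indicator_eq_self]
    exact fun q hq => subset_tsupport θ (left_ne_zero_of_mul hq)
  rw [e, memLp_indicator_iff_restrict hcm]
  exact (hf _ hs hc).of_le_mul (c := C) (hθ.aestronglyMeasurable.mul (hf _ hs hc).1)
    (Eventually.of_forall fun q => by
      rw [norm_mul]
      exact mul_le_mul_of_nonneg_right (hC q) (norm_nonneg _))

theorem norm_clm_prod_le (A : ℝ × ℝ →L[ℝ] ℝ) : ‖A‖ ≤ ‖A (1, 0)‖ + ‖A (0, 1)‖ := by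
  refine A.opNorm_le_bound (by positivity) fun x => ?_
  have hx : A x = x.1 * A (1, 0) + x.2 * A (0, 1) := by
    rw [← smul_eq_mul, ← smul_eq_mul, ← map_smul, ← map_smul, ← map_add]
    congr 1
    ext <;> simp
  rw [hx]
  refine (norm_add_le _ _).trans ?_
  rw [norm_mul, norm_mul, add_mul, mul_comm, mul_comm ‖x.2‖]
  exact add_le_add (mul_le_mul_of_nonneg_left (norm_fst_le x) (norm_nonneg _))
    (mul_le_mul_of_nonneg_left (norm_snd_le x) (norm_nonneg _))

/-- Local Sobolev embedding in the plane: functions with square integrable weak gradient are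
locally in `L^q` for all finite `q`. -/
theorem memLp_of_hasWeakPartial {U : Set (ℝ × ℝ)} (hU : IsOpen U) {u v₁ v₂ : ℝ × ℝ → ℝ}
    (h₁ : HasWeakPartial U (1, 0) u v₁) (h₂ : HasWeakPartial U (0, 1) u v₂)
    (hu : ∀ K ⊆ U, IsCompact K → MemLp u 2 (volume.restrict K))
    (hv₁ : ∀ K ⊆ U, IsCompact K → MemLp v₁ 2 (volume.restrict K))
    (hv₂ : ∀ K ⊆ U, IsCompact K → MemLp v₂ 2 (volume.restrict K))
    {K : Set (ℝ × ℝ)} (hK : IsCompact K) (hKU : K ⊆ U) {q : NNReal} (hq : 2 ≤ q) :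
    MemLp u q (volume.restrict K) := by
  obtain ⟨χ, hχ, hc, hs, h1⟩ := exists_contDiff_cutoff hK hU hKU
  have hχ' : ∀ e, Continuous (fun p => fderiv ℝ χ p e) := fun e =>
    (hχ.continuous_fderiv (by simp)).clm_apply continuous_const
  set w : ℝ × ℝ → ℝ := fun p => χ p * u p with hw
  set w₁ : ℝ × ℝ → ℝ := fun q => χ q * v₁ q + fderiv ℝ χ q (1, 0) * u q with hw₁
  set w₂ : ℝ × ℝ → ℝ := fun q => χ q * v₂ q + fderiv ℝ χ q (0, 1) * u q with hw₂
  have H₁ : HasWeakPartial univ (1, 0) w w₁ := h₁.cutoff_mul hχ hc hs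
  have H₂ : HasWeakPartial univ (0, 1) w w₂ := h₂.cutoff_mul hχ hc hs
  have hq0 : (0 : ℝ) < q := by
    have : (2 : ℝ) ≤ q := by exact_mod_cast hq
    linarith
  -- The exponent whose Sobolev conjugate in dimension two is `q`: `1/q = 1/r - 1/2`. The assumption
  -- `2 ≤ q` gives `1 ≤ r`, and `r ≤ 2` makes square integrability on compact sets sufficient.
  set r : NNReal := 2 * q / (q + 2) with hr
  have hr1 : 1 ≤ r := by
    rw [hr, one_le_div (by positivity), two_mul]
    exact add_le_add_right hq q
  have hr2 : r ≤ 2 := by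
    rw [hr, div_le_iff₀ (by positivity)]
    gcongr
    simp
  have hrq : ((q : ℝ))⁻¹ = (r : ℝ)⁻¹ - ((Module.finrank ℝ (ℝ × ℝ) : ℕ) : ℝ)⁻¹ := by
    have : Module.finrank ℝ (ℝ × ℝ) = 2 := by simp
    rw [this, hr]
    push_cast
    field_simp
    ring
  have hfin : ∀ {f θ : ℝ × ℝ → ℝ}, (∀ K ⊆ U, IsCompact K → MemLp f 2 (volume.restrict K)) →
      Continuous θ → HasCompactSupport θ → tsupport θ ⊆ U → MemLp (fun q => θ q * f q) r :=
    fun hf hθ hθc hθs => MemLp.mul_of_tsupport_subset (fun K hK hKc => by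
      have : IsFiniteMeasure (volume.restrict K) := ⟨by simpa using hKc.measure_lt_top⟩
      exact (hf K hK hKc).mono_exponent (by exact_mod_cast hr2)) hθ hθc hθs
  have M₁ : MemLp w₁ r := (hfin hv₁ hχ.continuous hc hs).add
    (hfin hu (hχ' _) (hc.fderiv_apply ℝ _) ((tsupport_fderiv_apply_subset' χ _).trans hs))
  have M₂ : MemLp w₂ r := (hfin hv₂ hχ.continuous hc hs).add
    (hfin hu (hχ' _) (hc.fderiv_apply ℝ _) ((tsupport_fderiv_apply_subset' χ _).trans hs))
  have hwi : Integrable w := integrable_smul_of_tsupport_subset h₁.1 hχ.continuous hc hs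
  have hwl : LocallyIntegrable w := hwi.locallyIntegrable
  have hwc : HasCompactSupport w := hc.mul_right
  set ρ : ℕ → ContDiffBump (0 : ℝ × ℝ) := shrinkingBump 1 one_pos with hρ
  have hmol : ∀ n e w', HasWeakPartial univ e w w' → ∀ x,
      fderiv ℝ (mollify volume (ρ n) w) x e = mollify volume (ρ n) w' x := by
    intro n e w' H x
    have := H.fderiv_mollify MeasurableSet.univ (subset_univ _) hwi.integrableOn (ρ n) (x := x)
      (subset_univ _)
    simpa using this
  have hCw : ∀ n, ContDiff ℝ ∞ (mollify volume (ρ n) w) := fun n => contDiff_mollify _ hwl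
  have hbound : ∀ n, eLpNorm (mollify volume (ρ n) w) q ≤
      (SNormLESNormFDerivOfEqConst ℝ (volume : Measure (ℝ × ℝ)) r : ℝ≥0∞) *
        (eLpNorm w₁ r + eLpNorm w₂ r) := by
    intro n
    refine (eLpNorm_le_eLpNorm_fderiv_of_eq volume ((hCw n).of_le (by simp))
      ((ρ n).hasCompactSupport_normed.convolution _ hwc) hr1 (by simp) hrq).trans ?_
    refine mul_le_mul_right ?_ _
    have hm : ∀ w' : ℝ × ℝ → ℝ, MemLp w' r → AEStronglyMeasurable (mollify volume (ρ n) w') :=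
      fun w' hw' => (contDiff_mollify (ρ n) (hw'.locallyIntegrable
        (by exact_mod_cast hr1))).continuous.aestronglyMeasurable
    calc eLpNorm (fderiv ℝ (mollify volume (ρ n) w)) r volume
        ≤ eLpNorm ((fun x => ‖mollify volume (ρ n) w₁ x‖) + fun x => ‖mollify volume (ρ n) w₂ x‖)
          r volume := by
          refine eLpNorm_mono_real fun x => ?_
          rw [Pi.add_apply, ← hmol n _ _ H₁, ← hmol n _ _ H₂]
          exact norm_clm_prod_le _
      _ ≤ eLpNorm (fun x => ‖mollify volume (ρ n) w₁ x‖) r volume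
          + eLpNorm (fun x => ‖mollify volume (ρ n) w₂ x‖) r volume :=
        eLpNorm_add_le (hm _ M₁).norm (hm _ M₂).norm (by exact_mod_cast hr1)
      _ ≤ _ := by
        rw [eLpNorm_norm, eLpNorm_norm]
        exact add_le_add (eLpNorm_mollify_le _ M₁.1 (by exact_mod_cast hr1) ENNReal.coe_ne_top)
          (eLpNorm_mollify_le _ M₂.1 (by exact_mod_cast hr1) ENNReal.coe_ne_top)
  -- The Sobolev inequality for compactly supported `C¹` functions bounds the mollifications
  -- uniformly in `L^q`; lower semicontinuity along the a.e. convergence passes the bound to `w`.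
  have hwq : MemLp w q := by
    refine ⟨hwi.1, ?_⟩
    refine (Lp.eLpNorm_lim_le_liminf_eLpNorm (fun n => (hCw n).continuous.aestronglyMeasurable) w
      (ae_tendsto_mollify_shrinkingBump one_pos hwl)).trans_lt ?_
    refine lt_of_le_of_lt (liminf_le_of_le (by isBoundedDefault) fun b hb => ?_)
      (ENNReal.mul_lt_top (ENNReal.coe_lt_top (r := SNormLESNormFDerivOfEqConst ℝ (volume : Measure (ℝ × ℝ)) r))
        (ENNReal.add_lt_top.2 ⟨M₁.2, M₂.2⟩))
    obtain ⟨n, hn⟩ := hb.exists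
    exact hn.trans (hbound n)
  refine (hwq.restrict K).ae_eq ?_
  filter_upwards [ae_restrict_mem hK.measurableSet] with x hx
  rw [hw]
  simp only
  rw [(h1.self_of_nhdsSet x hx), one_mul]

/-! ### Weyl's lemma for the Cauchy-Riemann operator -/

/-- The mean value inequality on discs for holomorphic functions. -/
theorem enorm_mul_le_lintegral_ball {h : ℂ → ℂ} (hc : Continuous h) {z : ℂ} {r : ℝ} (hr : 0 < r)
    (hd : DifferentiableOn ℂ h (Metric.ball z r)) :
    ‖h z‖ₑ * ENNReal.ofReal (Real.pi * r ^ 2) ≤ ∫⁻ w in Metric.ball z r, ‖h w‖ₑ := by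
  have hcirc : ∀ ρ ∈ Ioo 0 r, ‖h z‖ₑ * ENNReal.ofReal (2 * Real.pi) ≤
      ∫⁻ θ in Ioo (-Real.pi) Real.pi, ‖h (circleMap z ρ θ)‖ₑ := by
    intro ρ hρ
    have h1 : Real.circleAverage h z ρ = h z := by
      refine DiffContOnCl.circleAverage ?_
      rw [abs_of_pos hρ.1]
      exact hd.diffContOnCl_ball (Metric.closedBall_subset_ball hρ.2)
    rw [Real.circleAverage_eq_integral_add (-Real.pi),
      intervalIntegral.integral_comp_add_right (fun θ ↦ h (circleMap z ρ θ))] at h1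
    rw [show 2 * Real.pi + -Real.pi = Real.pi by ring, zero_add,
      intervalIntegral.integral_of_le (by linarith [Real.pi_pos]),
      integral_Ioc_eq_integral_Ioo] at h1
    have h2 : ∫ θ in Ioo (-Real.pi) Real.pi, h (circleMap z ρ θ) = (2 * Real.pi) • h z := by
      rw [← h1, smul_smul, mul_inv_cancel₀ (by positivity), one_smul]
    have h3 := enorm_integral_le_lintegral_enorm (μ := volume.restrict (Ioo (-Real.pi) Real.pi))
      (fun θ => h (circleMap z ρ θ))
    rw [h2, enorm_smul, mul_comm, Real.enorm_of_nonneg (by positivity)] at h3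
    exact h3
  have hm : Measurable fun w => (Metric.ball z r).indicator (fun w => ‖h w‖ₑ) w :=
    hc.enorm.measurable.indicator Metric.isOpen_ball.measurableSet
  have hpt : ∀ p : ℝ × ℝ, z + Complex.polarCoord.symm p = circleMap z p.1 p.2 := by
    intro p
    rw [Complex.polarCoord_symm_apply, circleMap, Complex.exp_mul_I]
    push_cast
    rfl
  have hpm : Measurable fun p : ℝ × ℝ => ENNReal.ofReal p.1 *
      (Metric.ball z r).indicator (fun w => ‖h w‖ₑ) (circleMap z p.1 p.2) := by
    have : Continuous fun p : ℝ × ℝ => circleMap z p.1 p.2 := by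
      unfold circleMap; fun_prop
    exact (measurable_fst.ennreal_ofReal).mul (hm.comp this.measurable)
  -- The inequality on circles is integrated against `ρ dρ` over `(0, r)` and read in polar
  -- coordinates centred at `z`.
  calc ‖h z‖ₑ * ENNReal.ofReal (Real.pi * r ^ 2)
      = ∫⁻ ρ in Ioo 0 r, ENNReal.ofReal ρ * (‖h z‖ₑ * ENNReal.ofReal (2 * Real.pi)) := by
        have e : ∫⁻ ρ in Ioo 0 r, ENNReal.ofReal ρ = ENNReal.ofReal (r ^ 2 / 2) := by
          rw [← ofReal_integral_eq_lintegral_ofReal, ← integral_Ioc_eq_integral_Ioo,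
            ← intervalIntegral.integral_of_le hr.le, integral_id]
          · simp
          · exact (continuous_id.integrableOn_Icc (a := 0) (b := r)).mono_set Ioo_subset_Icc_self
          · filter_upwards [ae_restrict_mem measurableSet_Ioo] with x hx using hx.1.le
        rw [lintegral_mul_const _ ENNReal.measurable_ofReal, e, mul_left_comm,
          ← ENNReal.ofReal_mul (by positivity)]
        congr 2
        ring
    _ ≤ ∫⁻ ρ in Ioo 0 r, ENNReal.ofReal ρ *
          ∫⁻ θ in Ioo (-Real.pi) Real.pi, ‖h (circleMap z ρ θ)‖ₑ :=
        setLIntegral_mono' measurableSet_Ioo fun ρ hρ => mul_le_mul_right (hcirc ρ hρ) _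
    _ = ∫⁻ ρ in Ioo 0 r, ∫⁻ θ in Ioo (-Real.pi) Real.pi, ENNReal.ofReal ρ *
          (Metric.ball z r).indicator (fun w => ‖h w‖ₑ) (circleMap z ρ θ) := by
        refine setLIntegral_congr_fun measurableSet_Ioo fun ρ hρ => ?_
        rw [← lintegral_const_mul' _ _ ENNReal.ofReal_ne_top]
        refine lintegral_congr fun θ => ?_
        rw [indicator_of_mem]
        rw [Metric.mem_ball, dist_eq_norm, circleMap_sub_center, norm_circleMap_zero,
          abs_of_pos hρ.1]
        exact hρ.2
    _ ≤ ∫⁻ ρ in Ioi 0, ∫⁻ θ in Ioo (-Real.pi) Real.pi, ENNReal.ofReal ρ *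
          (Metric.ball z r).indicator (fun w => ‖h w‖ₑ) (circleMap z ρ θ) :=
        lintegral_mono_set Ioo_subset_Ioi_self
    _ = ∫⁻ p in polarCoord.target, ENNReal.ofReal p.1 *
          (Metric.ball z r).indicator (fun w => ‖h w‖ₑ) (circleMap z p.1 p.2) := by
        rw [polarCoord_target, Measure.volume_eq_prod, ← Measure.prod_restrict,
          lintegral_prod _ hpm.aemeasurable]
    _ = ∫⁻ p in polarCoord.target, ENNReal.ofReal p.1 •
          (fun w => (Metric.ball z r).indicator (fun w => ‖h w‖ₑ) (z + w))
            (Complex.polarCoord.symm p) := by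
        refine setLIntegral_congr_fun polarCoord.open_target.measurableSet fun p hp => ?_
        simp only [smul_eq_mul]
        rw [hpt p]
    _ = ∫⁻ w, (Metric.ball z r).indicator (fun w => ‖h w‖ₑ) (z + w) :=
        Complex.lintegral_comp_polarCoord_symm
          (fun w => (Metric.ball z r).indicator (fun w => ‖h w‖ₑ) (z + w))
    _ = ∫⁻ w in Metric.ball z r, ‖h w‖ₑ := by
        rw [lintegral_add_left_eq_self (fun w => (Metric.ball z r).indicator (fun w => ‖h w‖ₑ) w) z,
          lintegral_indicator Metric.isOpen_ball.measurableSet]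

/-- Mollifications of `f` satisfy the classical Cauchy-Riemann equation, since translated bumps are
test functions. They converge in `L¹`; by the mean value inequality on discs they are then uniformly
Cauchy on a smaller disc, so the limit is holomorphic. The radii `r`, `2r`, `3r` leave room `r` for
the discs and `r` for the bumps. -/
theorem exists_holomorphic_ball {D : Set ℂ} {f : ℂ → ℂ} (hf : LocallyIntegrableOn f D)
    (h : ∀ ψ : ℂ → ℝ, ContDiff ℝ ∞ ψ → HasCompactSupport ψ → tsupport ψ ⊆ D →
      ∫ z, ((fderiv ℝ ψ z 1 : ℂ) + Complex.I * (fderiv ℝ ψ z Complex.I : ℂ)) * f z = 0)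
    {z₀ : ℂ} {r : ℝ} (hr : 0 < r) (hD : Metric.closedBall z₀ (3 * r) ⊆ D) :
    ∃ F : ℂ → ℂ, DifferentiableOn ℂ F (Metric.ball z₀ r) ∧
      ∀ᵐ z, z ∈ Metric.ball z₀ r → f z = F z := by
  set S := Metric.closedBall z₀ (3 * r) with hS
  have hSm : MeasurableSet S := Metric.isClosed_closedBall.measurableSet
  have hSc : IsCompact S := isCompact_closedBall _ _
  set w := S.indicator f with hw
  have hwi : Integrable w :=
    (integrable_indicator_iff hSm).2 (hf.integrableOn_compact_subset hD hSc)
  have hwl := hwi.locallyIntegrable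
  set ρ : ℕ → ContDiffBump (0 : ℂ) := shrinkingBump r hr with hρ
  set g : ℕ → ℂ → ℂ := fun n => mollify volume (ρ n) w with hg
  have hgC : ∀ n, ContDiff ℝ ∞ (g n) := fun n => contDiff_mollify _ hwl
  have hgd : ∀ n, DifferentiableOn ℂ (g n) (Metric.ball z₀ (2 * r)) := by
    intro n z hz
    refine DifferentiableAt.differentiableWithinAt ?_
    refine differentiableAt_complex_iff_differentiableAt_real.2
      ⟨(hgC n).differentiable (by simp) z, ?_⟩
    rw [hg]
    simp only
    rw [fderiv_mollify_apply _ hwl, fderiv_mollify_apply _ hwl]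
    set ψ : ℂ → ℝ := fun t => (ρ n).normed volume (z - t) with hψdef
    have hψ : ContDiff ℝ ∞ ψ :=
      (ContDiffBump.contDiff_normed (μ := volume) (ρ n)).comp (contDiff_const.sub contDiff_id)
    have hsub : Function.support ψ ⊆ Metric.closedBall z (ρ n).rOut := fun t ht => by
      have : z - t ∈ Function.support ((ρ n).normed volume) := ht
      rw [(ρ n).support_normed_eq, mem_ball_zero_iff] at this
      rw [Metric.mem_closedBall, dist_comm, dist_eq_norm]
      exact this.le
    have hts : tsupport ψ ⊆ S := (closure_minimal hsub Metric.isClosed_closedBall).trans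
      (Metric.closedBall_subset_closedBall' (by
        have := shrinkingBump_rOut_le (E := ℂ) hr n
        have := Metric.mem_ball.1 hz
        linarith))
    have hc : HasCompactSupport ψ :=
      HasCompactSupport.of_support_subset_isCompact (isCompact_closedBall _ _) hsub
    have hd : ∀ t e, fderiv ℝ ((ρ n).normed volume) (z - t) e = -fderiv ℝ ψ t e := fun t e => by
      have h1 : HasFDerivAt (fun t : ℂ => z - t) (-ContinuousLinearMap.id ℝ ℂ) t :=
        (hasFDerivAt_id t).const_sub z
      have h2 := ((ContDiffBump.contDiff_normed (μ := volume) (n := 1) (ρ n)).differentiable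
        one_ne_zero (z - t)).hasFDerivAt.comp t h1
      rw [show ψ = ((ρ n).normed volume) ∘ (fun t : ℂ => z - t) from rfl, h2.fderiv]
      simp
    have key := h ψ hψ hc (hts.trans hD)
    have e1 : ∀ e t, fderiv ℝ ψ t e • w t = fderiv ℝ ψ t e • f t := fun e t => by
      by_cases ht : t ∈ S
      · rw [hw, indicator_of_mem ht]
      · have : fderiv ℝ ψ t e = 0 := image_eq_zero_of_notMem_tsupport
          (f := fun p => fderiv ℝ ψ p e)
          (fun h' => ht (hts (tsupport_fderiv_apply_subset' ψ e h')))
        rw [this, zero_smul, zero_smul]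
    have hi : ∀ e, Integrable fun t => fderiv ℝ ψ t e • f t := fun e =>
      integrable_smul_of_tsupport_subset hf
        ((hψ.continuous_fderiv (by simp)).clm_apply continuous_const) (hc.fderiv_apply ℝ e)
        ((tsupport_fderiv_apply_subset' ψ e).trans (hts.trans hD))
    simp only [hd, neg_smul, e1, integral_neg]
    have key2 : (∫ t, fderiv ℝ ψ t 1 • f t) + Complex.I * ∫ t, fderiv ℝ ψ t Complex.I • f t = 0 := by
      rw [← integral_const_mul, ← integral_add (hi 1) ((hi Complex.I).const_mul _), ← key]
      refine integral_congr_ae (Eventually.of_forall fun t => ?_)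
      simp only [Complex.real_smul]
      ring
    rw [smul_eq_mul]
    linear_combination Complex.I * key2 - (∫ t, fderiv ℝ ψ t Complex.I • f t) * Complex.I_mul_I
  have hL1 := tendsto_eLpNorm_mollify_sub (μ := volume) (tendsto_shrinkingBump_rOut (E := ℂ) hr)
    le_rfl ENNReal.one_ne_top (memLp_one_iff_integrable.2 hwi)
  set a : ℕ → ℝ := fun n => (eLpNorm (g n - w) 1 volume).toReal with ha
  have hfin : ∀ n, eLpNorm (g n - w) 1 volume ≠ ⊤ := fun n => by
    have hgi : Integrable (g n) := by
      have := eLpNorm_mollify_le (μ := volume) (ρ n) hwi.1 le_rfl ENNReal.one_ne_top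
      refine memLp_one_iff_integrable.1 ⟨(hgC n).continuous.aestronglyMeasurable,
        this.trans_lt (memLp_one_iff_integrable.2 hwi).2⟩
    exact (memLp_one_iff_integrable.2 (hgi.sub hwi)).2.ne
  have halim : Tendsto a atTop (𝓝 0) := by
    have := (ENNReal.tendsto_toReal ENNReal.zero_ne_top).comp hL1
    exact this.trans (le_of_eq (by simp))
  have hpr : 0 < Real.pi * r ^ 2 := by positivity
  have hCauchy : ∀ m n, ∀ z ∈ Metric.ball z₀ r,
      ‖g m z - g n z‖ ≤ (a m + a n) / (Real.pi * r ^ 2) := by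
    intro m n z hz
    rw [le_div_iff₀ hpr]
    have hsub : Metric.ball z r ⊆ Metric.ball z₀ (2 * r) := Metric.ball_subset_ball' (by
      have := Metric.mem_ball.1 hz
      linarith)
    have h1 := enorm_mul_le_lintegral_ball (h := fun z => g m z - g n z) (z := z)
      ((hgC m).continuous.sub (hgC n).continuous) hr (((hgd m).sub (hgd n)).mono hsub)
    have h2 : ∫⁻ w in Metric.ball z r, ‖g m w - g n w‖ₑ ≤
        eLpNorm (g m - w) 1 volume + eLpNorm (g n - w) 1 volume := by
      refine (setLIntegral_le_lintegral _ _).trans ?_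
      rw [eLpNorm_one_eq_lintegral_enorm, eLpNorm_one_eq_lintegral_enorm, ← lintegral_add_left'
        ((hgC m).continuous.aestronglyMeasurable.sub hwi.1).enorm]
      refine lintegral_mono fun x => ?_
      have : g m x - g n x = (g m - w) x - (g n - w) x := by simp
      rw [this]
      exact enorm_sub_le
    have h3 := ENNReal.toReal_mono (ENNReal.add_ne_top.2 ⟨hfin m, hfin n⟩) (h1.trans h2)
    rwa [ENNReal.toReal_mul, ENNReal.toReal_add (hfin m) (hfin n), toReal_enorm,
      ENNReal.toReal_ofReal hpr.le] at h3
  have hU : UniformCauchySeqOn g atTop (Metric.ball z₀ r) := by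
    rw [Metric.uniformCauchySeqOn_iff]
    intro ε hε
    have hε' : 0 < ε * (Real.pi * r ^ 2) / 2 := by positivity
    obtain ⟨N, hN⟩ := eventually_atTop.1 ((tendsto_order.1 halim).2 _ hε')
    refine ⟨N, fun m hm n hn z hz => ?_⟩
    rw [dist_eq_norm]
    refine (hCauchy m n z hz).trans_lt ?_
    rw [div_lt_iff₀ hpr]
    have := hN m hm
    have := hN n hn
    linarith
  have hlim : ∀ z, ∃ l, z ∈ Metric.ball z₀ r → Tendsto (fun n => g n z) atTop (𝓝 l) := by
    intro z
    by_cases hz : z ∈ Metric.ball z₀ r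
    · obtain ⟨l, hl⟩ := cauchySeq_tendsto_of_complete (hU.cauchySeq hz)
      exact ⟨l, fun _ => hl⟩
    · exact ⟨0, fun h => absurd h hz⟩
  choose F hF using hlim
  refine ⟨F, ?_, ?_⟩
  · exact ((hU.tendstoUniformlyOn_of_tendsto fun z hz => hF z hz).tendstoLocallyUniformlyOn
      ).differentiableOn (Eventually.of_forall fun n =>
        (hgd n).mono (Metric.ball_subset_ball (by linarith))) Metric.isOpen_ball
  · filter_upwards [ae_tendsto_mollify_shrinkingBump hr hwl] with z hz hzb
    rw [tendsto_nhds_unique (hF z hzb) hz, hw, indicator_of_mem]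
    exact Metric.ball_subset_closedBall (Metric.ball_subset_ball (by linarith) hzb)

/-- Weyl's lemma for the Cauchy-Riemann operator. -/
theorem exists_holomorphic_of_weak_dbar {D : Set ℂ} (hD : IsOpen D) {f : ℂ → ℂ}
    (hf : LocallyIntegrableOn f D)
    (h : ∀ ψ : ℂ → ℝ, ContDiff ℝ ∞ ψ → HasCompactSupport ψ → tsupport ψ ⊆ D →
      ∫ z, ((fderiv ℝ ψ z 1 : ℂ) + Complex.I * (fderiv ℝ ψ z Complex.I : ℂ)) * f z = 0) :
    ∃ F : ℂ → ℂ, DifferentiableOn ℂ F D ∧ ∀ᵐ z ∂(volume.restrict D), f z = F z := by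
  have hloc : ∀ z : ℂ, ∃ (r : ℝ) (F : ℂ → ℂ), z ∈ D → 0 < r ∧ Metric.ball z r ⊆ D ∧
      DifferentiableOn ℂ F (Metric.ball z r) ∧ ∀ᵐ w, w ∈ Metric.ball z r → f w = F w := by
    intro z
    by_cases hz : z ∈ D
    · obtain ⟨ε, hε, hεD⟩ := Metric.isOpen_iff.1 hD z hz
      have hsub : Metric.closedBall z (3 * (ε / 4)) ⊆ D :=
        (Metric.closedBall_subset_ball (by linarith)).trans hεD
      obtain ⟨F, hF, hF'⟩ := exists_holomorphic_ball hf h (r := ε / 4) (by positivity) hsub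
      exact ⟨ε / 4, F, fun _ => ⟨by positivity,
        (Metric.ball_subset_ball (by linarith)).trans hεD, hF, hF'⟩⟩
    · exact ⟨0, 0, fun h => absurd h hz⟩
  choose r F hF using hloc
  -- Local representatives are continuous and a.e. equal on overlaps, hence equal there. The
  -- diagonal `z ↦ F z z` is therefore locally one of them.
  have heq : ∀ z ∈ D, ∀ w ∈ Metric.ball z (r z), F w w = F z w := by
    intro z hz w hw
    have hwD := (hF z hz).2.1 hw
    obtain ⟨hr, -, hd, ha⟩ := hF z hz
    obtain ⟨hr', -, hd', ha'⟩ := hF w hwD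
    have hO : IsOpen (Metric.ball z (r z) ∩ Metric.ball w (r w)) :=
      Metric.isOpen_ball.inter Metric.isOpen_ball
    have hEq : EqOn (F w) (F z) (Metric.ball z (r z) ∩ Metric.ball w (r w)) := by
      refine Measure.eqOn_open_of_ae_eq (μ := volume) ?_ hO
        (hd'.continuousOn.mono inter_subset_right) (hd.continuousOn.mono inter_subset_left)
      rw [Filter.EventuallyEq, ae_restrict_iff' hO.measurableSet]
      filter_upwards [ha, ha'] with x h1 h2 hx
      rw [← h1 hx.1, ← h2 hx.2]
    exact hEq ⟨hw, Metric.mem_ball_self hr'⟩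
  refine ⟨fun z => F z z, fun z hz => ?_, ?_⟩
  · obtain ⟨hr, -, hd, -⟩ := hF z hz
    have h1 : DifferentiableAt ℂ (F z) z := hd.differentiableAt (Metric.ball_mem_nhds z hr)
    refine (h1.congr_of_eventuallyEq ?_).differentiableWithinAt
    filter_upwards [Metric.ball_mem_nhds z hr] with w hw using heq z hz w hw
  · rw [ae_restrict_iff' hD.measurableSet]
    -- A countable subcover keeps the union of the exceptional null sets null.
    obtain ⟨T, hTc, hT⟩ := TopologicalSpace.isOpen_iUnion_countable
      (fun z : D => Metric.ball (z : ℂ) (r z)) fun z => Metric.isOpen_ball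
    have : ∀ᵐ w, ∀ z ∈ T, w ∈ Metric.ball (z : ℂ) (r z) → f w = F z w :=
      (ae_ball_iff hTc).2 fun z _ => (hF z z.2).2.2.2
    filter_upwards [this] with w hw hwD
    have hmem : w ∈ ⋃ i ∈ T, Metric.ball (i : ℂ) (r i) := by
      rw [hT]
      exact mem_iUnion.2 ⟨⟨w, hwD⟩, Metric.mem_ball_self (hF w hwD).1⟩
    simp only [mem_iUnion] at hmem
    obtain ⟨z, hzT, hwz⟩ := hmem
    rw [hw z hzT hwz, heq z z.2 w hwz]

/-! ### The Meyerson map as a change of variables -/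

theorem signedPow_neg (α t : ℝ) : signedPow α (-t) = -signedPow α t := by
  simp [signedPow, neg_div]

theorem signedPow_zero (α : ℝ) : signedPow α 0 = 0 := by simp [signedPow]

theorem signedPow_of_nonneg {α : ℝ} (hα : 0 < α) {t : ℝ} (ht : 0 ≤ t) :
    signedPow α t = t ^ (α + 1) / (α + 1) := by
  rcases ht.eq_or_lt with rfl | ht
  · rw [signedPow_zero, Real.zero_rpow (by positivity), zero_div]
  · rw [signedPow, abs_of_pos ht, Real.rpow_add_one ht.ne', mul_comm]

theorem strictMono_signedPow {α : ℝ} (hα : 0 < α) : StrictMono (signedPow α) := by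
  refine strictMono_of_odd_strictMonoOn_nonneg (signedPow_neg α) fun s hs t ht hst => ?_
  rw [signedPow_of_nonneg hα hs, signedPow_of_nonneg hα ht]
  exact div_lt_div_of_pos_right (Real.rpow_lt_rpow hs hst (by positivity)) (by positivity)

theorem surjective_signedPow {α : ℝ} (hα : 0 < α) : Function.Surjective (signedPow α) := by
  have hα1 : (0 : ℝ) < α + 1 := by positivity
  have key : ∀ y : ℝ, 0 ≤ y → ∃ t, signedPow α t = y := fun y hy => by
    refine ⟨((α + 1) * y) ^ (α + 1)⁻¹, ?_⟩
    rw [signedPow_of_nonneg hα (by positivity), Real.rpow_inv_rpow (by positivity) hα1.ne']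
    field_simp
  intro y
  rcases le_total 0 y with hy | hy
  · exact key y hy
  · obtain ⟨t, ht⟩ := key (-y) (by linarith)
    exact ⟨-t, by rw [signedPow_neg, ht, neg_neg]⟩

/-- `signedPow α` as a homeomorphism of the line. -/
noncomputable def signedPowHomeo {α : ℝ} (hα : 0 < α) : ℝ ≃ₜ ℝ :=
  ((strictMono_signedPow hα).orderIsoOfSurjective _ (surjective_signedPow hα)).toHomeomorph

theorem signedPowHomeo_apply {α : ℝ} (hα : 0 < α) (t : ℝ) :
    signedPowHomeo hα t = signedPow α t := rfl

/-- The Meyerson map as a homeomorphism. -/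
noncomputable def meyersonHomeo {α : ℝ} (hα : 0 < α) : ℝ × ℝ ≃ₜ ℂ :=
  ((signedPowHomeo hα).prodCongr (Homeomorph.refl ℝ)).trans
    Complex.equivRealProdCLM.symm.toHomeomorph

theorem meyersonHomeo_apply {α : ℝ} (hα : 0 < α) (q : ℝ × ℝ) :
    meyersonHomeo hα q = meyerson α q := rfl

theorem coe_meyersonHomeo {α : ℝ} (hα : 0 < α) : ⇑(meyersonHomeo hα) = meyerson α := rfl

theorem meyerson_re (α : ℝ) (q : ℝ × ℝ) : (meyerson α q).re = signedPow α q.1 := rfl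

theorem meyerson_im (α : ℝ) (q : ℝ × ℝ) : (meyerson α q).im = q.2 := rfl

theorem meyerson_eq (α : ℝ) (q : ℝ × ℝ) :
    meyerson α q = (signedPow α q.1 : ℂ) + Complex.I * (q.2 : ℂ) := by
  apply Complex.ext <;> simp [meyerson_re, meyerson_im]

theorem signedPow_eq_zero {α : ℝ} (hα : 0 < α) {t : ℝ} : signedPow α t = 0 ↔ t = 0 :=
  ⟨fun h => (strictMono_signedPow hα).injective (h.trans (signedPow_zero α).symm),
    fun h => h ▸ signedPow_zero α⟩

/-- The derivative of the Meyerson map. -/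
noncomputable def meyersonDeriv (α : ℝ) (q : ℝ × ℝ) : ℝ × ℝ →L[ℝ] ℂ :=
  (Complex.ofRealCLM.comp ((|q.1| ^ α) • ContinuousLinearMap.fst ℝ ℝ ℝ)) +
    Complex.I • (Complex.ofRealCLM.comp (ContinuousLinearMap.snd ℝ ℝ ℝ))

theorem meyersonDeriv_apply (α : ℝ) (q v : ℝ × ℝ) :
    meyersonDeriv α q v = ((|q.1| ^ α * v.1 : ℝ) : ℂ) + Complex.I * (v.2 : ℂ) := by
  simp [meyersonDeriv]

theorem hasFDerivAt_meyerson {α : ℝ} (hα : 0 < α) (q : ℝ × ℝ) :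
    HasFDerivAt (meyerson α) (meyersonDeriv α q) q := by
  have h1 : HasFDerivAt (fun q : ℝ × ℝ => signedPow α q.1)
      ((|q.1| ^ α) • ContinuousLinearMap.fst ℝ ℝ ℝ) q :=
    (hasDerivAt_signedPow hα q.1).comp_hasFDerivAt q hasFDerivAt_fst
  have h2 : HasFDerivAt (fun q : ℝ × ℝ => (signedPow α q.1 : ℂ))
      (Complex.ofRealCLM.comp ((|q.1| ^ α) • ContinuousLinearMap.fst ℝ ℝ ℝ)) q :=
    Complex.ofRealCLM.hasFDerivAt.comp q h1
  have h3 : HasFDerivAt (fun q : ℝ × ℝ => (q.2 : ℂ))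
      (Complex.ofRealCLM.comp (ContinuousLinearMap.snd ℝ ℝ ℝ)) q :=
    Complex.ofRealCLM.hasFDerivAt.comp q hasFDerivAt_snd
  have := h2.add (h3.const_smul Complex.I)
  rw [show meyerson α = fun q => (signedPow α q.1 : ℂ) + Complex.I * (q.2 : ℂ) from
    funext (meyerson_eq α)]
  exact this

theorem continuous_meyersonDeriv {α : ℝ} (hα : 0 < α) : Continuous (meyersonDeriv α) := by
  unfold meyersonDeriv
  have : Continuous fun q : ℝ × ℝ => |q.1| ^ α := (continuous_abs_rpow hα).comp continuous_fst
  fun_prop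

theorem contDiff_one_meyerson {α : ℝ} (hα : 0 < α) : ContDiff ℝ 1 (meyerson α) := by
  refine contDiff_one_iff_fderiv.2 ⟨fun q => (hasFDerivAt_meyerson hα q).differentiableAt, ?_⟩
  rw [show fderiv ℝ (meyerson α) = meyersonDeriv α from
    funext fun q => (hasFDerivAt_meyerson hα q).fderiv]
  exact continuous_meyersonDeriv hα

theorem continuous_weight {α : ℝ} (hα : 0 < α) : Continuous fun q : ℝ × ℝ => |q.1| ^ α :=
  (continuous_abs_rpow hα).comp continuous_fst

/-- The measure `|x|^α dx dy`. -/
noncomputable def weightMeasure (α : ℝ) : Measure (ℝ × ℝ) :=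
  volume.withDensity fun q => ENNReal.ofReal (|q.1| ^ α)

theorem measurable_weight {α : ℝ} (hα : 0 < α) :
    Measurable fun q : ℝ × ℝ => ENNReal.ofReal (|q.1| ^ α) :=
  (continuous_weight hα).measurable.ennreal_ofReal

/-- The Meyerson map transports `|x|^α dx dy` to Lebesgue measure. -/
theorem measurePreserving_meyerson {α : ℝ} (hα : 0 < α) :
    MeasurePreserving (meyerson α) (weightMeasure α) volume := by
  set φ : ℝ × ℝ → ℝ × ℝ := fun q => (signedPow α q.1, q.2) with hφ
  set φ' : ℝ × ℝ → ℝ × ℝ →L[ℝ] ℝ × ℝ := fun q =>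
    ((|q.1| ^ α) • ContinuousLinearMap.id ℝ ℝ).prodMap (ContinuousLinearMap.id ℝ ℝ) with hφ'
  have hφc : Continuous φ :=
    ((continuous_signedPow hα).comp continuous_fst).prodMk continuous_snd
  have hφd : ∀ q, HasFDerivAt φ (φ' q) q := fun q => by
    have h1 : HasFDerivAt (fun q : ℝ × ℝ => signedPow α q.1)
        ((|q.1| ^ α) • ContinuousLinearMap.fst ℝ ℝ ℝ) q :=
      (hasDerivAt_signedPow hα q.1).comp_hasFDerivAt q hasFDerivAt_fst
    refine (h1.prodMk hasFDerivAt_snd).congr_fderiv ?_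
    ext <;> simp [hφ']
  have hdet : ∀ q, |(φ' q).det| = |q.1| ^ α := fun q => by
    have : (φ' q).det = |q.1| ^ α := by
      change LinearMap.det ((φ' q : ℝ × ℝ →L[ℝ] ℝ × ℝ) : ℝ × ℝ →ₗ[ℝ] ℝ × ℝ) = _
      have : ((φ' q : ℝ × ℝ →L[ℝ] ℝ × ℝ) : ℝ × ℝ →ₗ[ℝ] ℝ × ℝ)
          = ((|q.1| ^ α) • (LinearMap.id : ℝ →ₗ[ℝ] ℝ)).prodMap LinearMap.id := rfl
      rw [this, LinearMap.det_prodMap, LinearMap.det_smul]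
      simp
    rw [this, abs_of_nonneg (by positivity)]
  have hφi : Function.Injective φ := fun p q h => by
    simp only [hφ, Prod.mk.injEq] at h
    exact Prod.ext ((strictMono_signedPow hα).injective h.1) h.2
  have hφs : Function.Surjective φ := fun p => by
    obtain ⟨t, ht⟩ := surjective_signedPow hα p.1
    exact ⟨(t, p.2), by simp [hφ, ht]⟩
  have h1 : MeasurePreserving φ (weightMeasure α) volume := by
    refine ⟨hφc.measurable, ?_⟩
    ext s hs
    rw [Measure.map_apply hφc.measurable hs, weightMeasure,
      withDensity_apply _ (hφc.measurable hs)]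
    have := lintegral_image_eq_lintegral_abs_det_fderiv_mul volume (hφc.measurable hs)
      (fun q _ => (hφd q).hasFDerivWithinAt) (hφi.injOn) (fun _ => 1)
    rw [image_preimage_eq s hφs, setLIntegral_one] at this
    rw [this]
    simp only [hdet, mul_one]
  have h2 : MeasurePreserving (Complex.measurableEquivRealProd.symm) :=
    Complex.volume_preserving_equiv_real_prod.symm
  exact h2.comp h1

/-- The density `|x|^α` vanishes only on the axis, a null set. This is what lets null sets of `ℂ` be
pulled back to Lebesgue null sets. -/
theorem volume_absolutelyContinuous_weightMeasure {α : ℝ} (hα : 0 < α) :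
    (volume : Measure (ℝ × ℝ)) ≪ weightMeasure α := by
  refine withDensity_absolutelyContinuous' (measurable_weight hα).aemeasurable ?_
  have : ∀ᵐ q : ℝ × ℝ, q ∉ yAxis := by
    rw [ae_iff]; simpa using volume_yAxis
  filter_upwards [this] with q hq
  have hq : q.1 ≠ 0 := hq
  have : 0 < |q.1| ^ α := by positivity
  simpa using this

theorem measurableEmbedding_meyerson {α : ℝ} (hα : 0 < α) : MeasurableEmbedding (meyerson α) :=
  (meyersonHomeo hα).measurableEmbedding

theorem integral_meyerson {α : ℝ} (hα : 0 < α) (θ : ℂ → ℂ) :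
    ∫ z, θ z = ∫ q : ℝ × ℝ, ((|q.1| ^ α : ℝ) : ℂ) * θ (meyerson α q) := by
  rw [← (measurePreserving_meyerson hα).integral_comp (measurableEmbedding_meyerson hα),
    weightMeasure, integral_withDensity_eq_integral_toReal_smul (measurable_weight hα)
      (Eventually.of_forall fun q => ENNReal.ofReal_lt_top)]
  refine integral_congr_ae (Eventually.of_forall fun q => ?_)
  simp only
  rw [ENNReal.toReal_ofReal (by positivity), Complex.real_smul]

theorem ae_of_ae_meyerson {α : ℝ} (hα : 0 < α) {P : ℂ → Prop} (h : ∀ᵐ z, P z) :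
    ∀ᵐ q : ℝ × ℝ, P (meyerson α q) :=
  (volume_absolutelyContinuous_weightMeasure hα).ae_le
    ((measurePreserving_meyerson hα).quasiMeasurePreserving.ae h)

/-- The change of variables multiplies the integrand by `|x|^α`, which is bounded on the compact
preimage. -/
theorem locallyIntegrableOn_comp_meyerson_symm {α : ℝ} (hα : 0 < α) {Ω : Set (ℝ × ℝ)}
    (hΩ : IsOpen Ω) {F : ℝ × ℝ → ℂ} (hF : LocallyIntegrableOn F Ω) :
    LocallyIntegrableOn (fun z => F ((meyersonHomeo hα).symm z)) (meyerson α '' Ω) := by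
  have hO : IsOpen (meyerson α '' Ω) := (meyersonHomeo hα).isOpenMap _ hΩ
  refine locallyIntegrableOn_of_isCompact hO fun K hK hKc => ?_
  have hK' : IsCompact (meyerson α ⁻¹' K) := (meyersonHomeo hα).isCompact_preimage.2 hKc
  have hsub : meyerson α ⁻¹' K ⊆ Ω := fun q hq => by
    obtain ⟨q', hq', he⟩ := hK hq
    rwa [← (meyersonHomeo hα).injective he]
  rw [← (measurePreserving_meyerson hα).integrableOn_comp_preimage (measurableEmbedding_meyerson hα)]
  have e : (fun z => F ((meyersonHomeo hα).symm z)) ∘ meyerson α = F := by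
    funext q
    exact congrArg F ((meyersonHomeo hα).symm_apply_apply q)
  rw [e, IntegrableOn, weightMeasure, restrict_withDensity hK'.measurableSet,
    integrable_withDensity_iff_integrable_smul' (measurable_weight hα)
      (Eventually.of_forall fun q => ENNReal.ofReal_lt_top)]
  have := (hF.integrableOn_compact_subset hsub hK').continuousOn_smul
    (continuous_weight hα).continuousOn hK'
  refine this.congr (Eventually.of_forall fun q => ?_)
  simp only
  rw [ENNReal.toReal_ofReal (by positivity)]

/-! ### Functions locally in the horizontal Sobolev space -/

/-- Weak derivatives on relatively compact open subsets glue. -/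
theorem exists_hasWeakPartial_of_local {Ω : Set (ℝ × ℝ)} (hΩ : IsOpen Ω) {e : ℝ × ℝ}
    {u : ℝ × ℝ → ℝ} (h : ∀ U : Set (ℝ × ℝ), IsOpen U → IsCompact (closure U) → closure U ⊆ Ω →
      ∃ v, HasWeakPartial U e u v) : ∃ v, HasWeakPartial Ω e u v := by
  set δ : ℕ → ℝ := fun n => 1 / ((n : ℝ) + 1) with hδ
  have hδ0 : ∀ n, 0 < δ n := fun n => by positivity
  have hδa : Antitone δ := fun m n hmn => one_div_le_one_div_of_le (by positivity)
    (by simpa using hmn)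
  -- An increasing exhaustion of `Ω` by relatively compact open sets; every compact subset of `Ω`,
  -- in particular the support of a test function, lies in some `U n`.
  set U : ℕ → Set (ℝ × ℝ) := fun n =>
    Metric.ball 0 ((n : ℝ) + 1) ∩ (Metric.cthickening (δ n) Ωᶜ)ᶜ with hU
  have hUo : ∀ n, IsOpen (U n) := fun n =>
    Metric.isOpen_ball.inter Metric.isClosed_cthickening.isOpen_compl
  have hUcl : ∀ n, closure (U n) ⊆
      Metric.closedBall 0 ((n : ℝ) + 1) ∩ (Metric.thickening (δ n) Ωᶜ)ᶜ := fun n =>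
    closure_minimal (inter_subset_inter Metric.ball_subset_closedBall
      (compl_subset_compl.2 (Metric.thickening_subset_cthickening _ _)))
      (Metric.isClosed_closedBall.inter Metric.isOpen_thickening.isClosed_compl)
  have hUc : ∀ n, IsCompact (closure (U n)) := fun n =>
    (isCompact_closedBall (0 : ℝ × ℝ) ((n : ℝ) + 1)).of_isClosed_subset isClosed_closure
      ((hUcl n).trans inter_subset_left)
  have hUΩ : ∀ n, closure (U n) ⊆ Ω := fun n q hq => by
    by_contra hcon
    exact (hUcl n hq).2 (Metric.self_subset_thickening (hδ0 n) _ hcon)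
  have hUm : Monotone U := fun m n hmn => by
    refine inter_subset_inter (Metric.ball_subset_ball (by simpa using hmn)) ?_
    exact compl_subset_compl.2 (Metric.cthickening_mono (hδa hmn) _)
  have hcov : Ω ⊆ ⋃ n, U n := fun q hq => by
    obtain ⟨ε, hε, hεΩ⟩ := Metric.isOpen_iff.1 hΩ q hq
    obtain ⟨n₁, hn₁⟩ := exists_nat_gt ‖q‖
    obtain ⟨n₂, hn₂⟩ := exists_nat_one_div_lt hε
    refine mem_iUnion.2 ⟨max n₁ n₂, ?_, fun hcon => ?_⟩
    · rw [mem_ball_zero_iff]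
      have : (n₁ : ℝ) ≤ (max n₁ n₂ : ℕ) := by exact_mod_cast le_max_left _ _
      linarith
    · have h1 := Metric.cthickening_mono (hδa (le_max_right n₁ n₂)) _ hcon
      have h2 := Metric.cthickening_subset_thickening' hε hn₂ _ h1
      obtain ⟨z, hz, hd⟩ := Metric.mem_thickening_iff.1 h2
      exact hz (hεΩ (by rwa [Metric.mem_ball, dist_comm]))
  have hUsub : ∀ n, U n ⊆ Ω := fun n => subset_closure.trans (hUΩ n)
  have hK : ∀ K ⊆ Ω, IsCompact K → ∃ n, K ⊆ U n := fun K hK hKc => by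
    obtain ⟨n, hn⟩ := hKc.elim_directed_cover U hUo (hK.trans hcov)
      (hUm.directed_le)
    exact ⟨n, hn⟩
  choose v hv using fun n => h (U n) (hUo n) (hUc n) (hUΩ n)
  have hex : ∀ q : ℝ × ℝ, ∃ n, q ∈ Ω → q ∈ U n := fun q => by
    by_cases hq : q ∈ Ω
    · obtain ⟨n, hn⟩ := mem_iUnion.1 (hcov hq)
      exact ⟨n, fun _ => hn⟩
    · exact ⟨0, fun h => absurd h hq⟩
  choose N hN using hex
  have hae : ∀ᵐ q, ∀ m n, q ∈ U m → q ∈ U n → v m q = v n q := by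
    rw [ae_all_iff]
    intro m
    rw [ae_all_iff]
    intro n
    -- By monotonicity the overlap is itself a member of the exhaustion, so uniqueness of weak
    -- derivatives applies on it.
    have hsub : U (min m n) = U m ∩ U n := by
      refine Subset.antisymm (subset_inter (hUm (min_le_left _ _)) (hUm (min_le_right _ _))) ?_
      rcases le_total m n with hmn | hmn
      · rw [min_eq_left hmn]; exact inter_subset_left
      · rw [min_eq_right hmn]; exact inter_subset_right
    have := ((hv m).mono (hUm (min_le_left m n))).unique (hUo _)
      ((hv n).mono (hUm (min_le_right m n)))
    rw [ae_restrict_iff' (hUo _).measurableSet] at this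
    filter_upwards [this] with q hq hm hn
    exact hq (by rw [hsub]; exact ⟨hm, hn⟩)
  set V : ℝ × ℝ → ℝ := fun q => v (N q) q with hV
  have hVn : ∀ n, HasWeakPartial (U n) e u V := fun n => by
    refine (hv n).congr (Eventually.of_forall fun _ => rfl) ?_
    rw [ae_restrict_iff' (hUo n).measurableSet]
    filter_upwards [hae] with q hq hqn
    exact hq n (N q) hqn (hN q (hUsub n hqn))
  refine ⟨V, .of_integral_eq ?_ ?_ fun ψ hψ hc hs => ?_⟩
  · refine locallyIntegrableOn_of_isCompact hΩ fun K hKΩ hKc => ?_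
    obtain ⟨n, hn⟩ := hK K hKΩ hKc
    exact (hVn n).1.integrableOn_compact_subset hn hKc
  · refine locallyIntegrableOn_of_isCompact hΩ fun K hKΩ hKc => ?_
    obtain ⟨n, hn⟩ := hK K hKΩ hKc
    exact (hVn n).2.1.integrableOn_compact_subset hn hKc
  · obtain ⟨n, hn⟩ := hK _ hs hc
    exact (hVn n).integral_eq hψ hc hn

/-- Properties of the weak derivatives of a function that is locally in a horizontal Sobolev
space. -/
structure LocalSobolev (α : ℝ) (p : ℝ≥0∞) (Ω : Set (ℝ × ℝ)) (u : ℝ × ℝ → ℝ) : Prop where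
  hasWeakPartial_x : HasWeakPartial Ω (1, 0) u (weakPartial Ω (1, 0) u)
  hasWeakPartial_y : HasWeakPartial Ω (0, 1) u (weakPartial Ω (0, 1) u)
  memLp : ∀ K ⊆ Ω, IsCompact K → MemLp u p (volume.restrict K)
  memLp_x : ∀ K ⊆ Ω, IsCompact K → MemLp (weakPartial Ω (1, 0) u) p (volume.restrict K)
  memLp_y : ∀ K ⊆ Ω, IsCompact K →
    MemLp (fun q => |q.1| ^ α * weakPartial Ω (0, 1) u q) p (volume.restrict K)

/-- The weak derivatives on `Ω` agree a.e. on each `U` with those supplied by the hypothesis on `U`,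
and inherit their `L^p` bounds. -/
theorem localSobolev_of_HW {α : ℝ} {p : ℝ≥0∞} {Ω : Set (ℝ × ℝ)} (hΩ : IsOpen Ω)
    {u : ℝ × ℝ → ℝ} (h : ∀ U : Set (ℝ × ℝ), IsOpen U → IsCompact (closure U) → closure U ⊆ Ω →
      HW α p U u) : LocalSobolev α p Ω u := by
  obtain ⟨_, hx⟩ := exists_hasWeakPartial_of_local hΩ (e := (1, 0)) (u := u) fun U h1 h2 h3 => by
    obtain ⟨-, ux, -, h, -⟩ := h U h1 h2 h3
    exact ⟨ux, h⟩
  obtain ⟨_, hy⟩ := exists_hasWeakPartial_of_local hΩ (e := (0, 1)) (u := u) fun U h1 h2 h3 => by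
    obtain ⟨-, -, uy, -, h, -⟩ := h U h1 h2 h3
    exact ⟨uy, h⟩
  have hx := hx.weakPartial_spec
  have hy := hy.weakPartial_spec
  have key : ∀ K ⊆ Ω, IsCompact K → ∃ U : Set (ℝ × ℝ), IsOpen U ∧ K ⊆ U ∧ U ⊆ Ω ∧ HW α p U u :=
    fun K hK hKc => by
      obtain ⟨U, hUo, hKU, hUΩ, hUc⟩ := exists_open_between_and_isCompact_closure hKc hΩ hK
      exact ⟨U, hUo, hKU, subset_closure.trans hUΩ, h U hUo hUc hUΩ⟩
  refine ⟨hx, hy, fun K hK hKc => ?_, fun K hK hKc => ?_, fun K hK hKc => ?_⟩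
  · obtain ⟨U, hUo, hKU, hUΩ, h, -⟩ := key K hK hKc
    exact h.mono_measure (Measure.restrict_mono hKU le_rfl)
  · obtain ⟨U, hUo, hKU, hUΩ, -, ux, uy, hux, huy, hm, -⟩ := key K hK hKc
    refine (hm.ae_eq ?_).mono_measure (Measure.restrict_mono hKU le_rfl)
    exact hux.unique hUo (hx.mono hUΩ)
  · obtain ⟨U, hUo, hKU, hUΩ, -, ux, uy, hux, huy, -, hm⟩ := key K hK hKc
    refine (hm.ae_eq ?_).mono_measure (Measure.restrict_mono hKU le_rfl)
    filter_upwards [huy.unique hUo (hy.mono hUΩ)] with q hq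
    rw [hq]

theorem LocalSobolev.hw {α : ℝ} {p : ℝ≥0∞} {Ω U : Set (ℝ × ℝ)} {u : ℝ × ℝ → ℝ}
    (h : LocalSobolev α p Ω u) {r : ℝ≥0∞} (hr : r ≤ p) (hUc : IsCompact (closure U))
    (hU : closure U ⊆ Ω) : HW α r U u := by
  have hUΩ : U ⊆ Ω := subset_closure.trans hU
  have : IsFiniteMeasure (volume.restrict (closure U)) := ⟨by simpa using hUc.measure_lt_top⟩
  have hle : volume.restrict U ≤ volume.restrict (closure U) :=
    Measure.restrict_mono subset_closure le_rfl
  exact ⟨((h.memLp _ hU hUc).mono_exponent hr).mono_measure hle, _, _,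
    h.hasWeakPartial_x.mono hUΩ, h.hasWeakPartial_y.mono hUΩ,
    ((h.memLp_x _ hU hUc).mono_exponent hr).mono_measure hle,
    ((h.memLp_y _ hU hUc).mono_exponent hr).mono_measure hle⟩

theorem LocalSobolev.of_HWloc_fst {α : ℝ} {p : ℝ≥0∞} {Ω Ω' : Set (ℝ × ℝ)} (hΩ : IsOpen Ω)
    {g : ℝ × ℝ → ℝ × ℝ} (h : HWloc α p Ω Ω' g) : LocalSobolev α p Ω (fun q => (g q).1) :=
  localSobolev_of_HW hΩ fun U h1 h2 h3 => (h.2 U h1 h2 h3).1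

theorem LocalSobolev.of_HWloc_snd {α : ℝ} {p : ℝ≥0∞} {Ω Ω' : Set (ℝ × ℝ)} (hΩ : IsOpen Ω)
    {g : ℝ × ℝ → ℝ × ℝ} (h : HWloc α p Ω Ω' g) : LocalSobolev α p Ω (fun q => (g q).2) :=
  localSobolev_of_HW hΩ fun U h1 h2 h3 => (h.2 U h1 h2 h3).2

theorem HWloc.mono_exponent {α : ℝ} {p r : ℝ≥0∞} {Ω Ω' : Set (ℝ × ℝ)} (hΩ : IsOpen Ω)
    {g : ℝ × ℝ → ℝ × ℝ} (h : HWloc α p Ω Ω' g) (hr : r ≤ p) : HWloc α r Ω Ω' g :=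
  ⟨h.1, fun _ _ h2 h3 => ⟨(LocalSobolev.of_HWloc_fst hΩ h).hw hr h2 h3,
    (LocalSobolev.of_HWloc_snd hΩ h).hw hr h2 h3⟩⟩

/-- On a compact set missing the axis the weight is bounded away from zero, so it can be divided
out. -/
theorem LocalSobolev.memLp_y_of_diff_yAxis {α : ℝ} (hα : 0 < α) {p : ℝ≥0∞} {Ω : Set (ℝ × ℝ)}
    {u : ℝ × ℝ → ℝ} (h : LocalSobolev α p Ω u) {K : Set (ℝ × ℝ)} (hK : K ⊆ Ω \ yAxis)
    (hKc : IsCompact K) : MemLp (weakPartial Ω (0, 1) u) p (volume.restrict K) := by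
  have hne : ∀ q ∈ K, |q.1| ^ α ≠ 0 := fun q hq => by
    have : q.1 ≠ 0 := (hK hq).2
    positivity
  have hcont : ContinuousOn (fun q : ℝ × ℝ => (|q.1| ^ α)⁻¹) K :=
    (continuous_weight hα).continuousOn.inv₀ hne
  obtain ⟨C, hC⟩ := hKc.exists_bound_of_continuousOn hcont
  have hm := h.memLp_y K (hK.trans sdiff_subset) hKc
  refine hm.of_le_mul (c := C) ?_ ?_
  · exact h.hasWeakPartial_y.2.1.aestronglyMeasurable.mono_measure
      (Measure.restrict_mono (hK.trans sdiff_subset) le_rfl)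
  · filter_upwards [ae_restrict_mem hKc.measurableSet] with q hq
    calc ‖weakPartial Ω (0, 1) u q‖
        = ‖(|q.1| ^ α)⁻¹‖ * ‖|q.1| ^ α * weakPartial Ω (0, 1) u q‖ := by
          rw [← norm_mul, inv_mul_cancel_left₀ (hne q hq)]
      _ ≤ _ := mul_le_mul_of_nonneg_right (hC q hq) (norm_nonneg _)

/-- Off the axis, a function locally in `HW^{1,2}` is locally in `L^t` for all `t`. -/
theorem LocalSobolev.integrableOn_rpow {α : ℝ} (hα : 0 < α) {p : ℝ≥0∞} (hp : 2 ≤ p)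
    {Ω : Set (ℝ × ℝ)} (hΩ : IsOpen Ω) {u : ℝ × ℝ → ℝ} (h : LocalSobolev α p Ω u)
    {K : Set (ℝ × ℝ)} (hK : K ⊆ Ω \ yAxis) (hKc : IsCompact K) {t : ℝ} (ht : 0 < t) :
    IntegrableOn (fun q => |u q| ^ t) K := by
  have hfin : ∀ K : Set (ℝ × ℝ), IsCompact K → IsFiniteMeasure (volume.restrict K) :=
    fun K hK => ⟨by simpa using hK.measure_lt_top⟩
  have := hfin K hKc
  have h1 := memLp_of_hasWeakPartial (hΩ.sdiff isClosed_yAxis)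
    (h.hasWeakPartial_x.mono sdiff_subset) (h.hasWeakPartial_y.mono sdiff_subset)
    (fun K hK hKc => by
      have := hfin K hKc
      exact (h.memLp K (hK.trans sdiff_subset) hKc).mono_exponent hp)
    (fun K hK hKc => by
      have := hfin K hKc
      exact (h.memLp_x K (hK.trans sdiff_subset) hKc).mono_exponent hp)
    (fun K hK hKc => by
      have := hfin K hKc
      exact (h.memLp_y_of_diff_yAxis hα hK hKc).mono_exponent hp) hKc hK
    -- The embedding is used with `t + 2 ≥ 2`; the exponent is then lowered to `t` on a set of
    -- finite measure.
    (q := t.toNNReal + 2) le_add_self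
  have h2 : MemLp u (ENNReal.ofReal t) (volume.restrict K) := h1.mono_exponent
    (ENNReal.coe_le_coe.2 le_self_add)
  have := h2.integrable_norm_rpow (by simpa using ht) ENNReal.ofReal_ne_top
  rwa [ENNReal.toReal_ofReal ht.le] at this

theorem LocalSobolev.locallyIntegrableOn_signedPow {α : ℝ} (hα : 0 < α) {p : ℝ≥0∞} (hp : 2 ≤ p)
    {Ω : Set (ℝ × ℝ)} (hΩ : IsOpen Ω) {u : ℝ × ℝ → ℝ} (h : LocalSobolev α p Ω u) :
    LocallyIntegrableOn (fun q => signedPow α (u q)) (Ω \ yAxis) := by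
  refine locallyIntegrableOn_of_isCompact (hΩ.sdiff isClosed_yAxis) fun K hK hKc => ?_
  have h1 := (h.integrableOn_rpow hα hp hΩ hK hKc (t := α + 1) (by positivity)).div_const (α + 1)
  have hu : AEStronglyMeasurable u (volume.restrict K) :=
    h.hasWeakPartial_x.1.aestronglyMeasurable.mono_measure
      (Measure.restrict_mono (hK.trans sdiff_subset) le_rfl)
  refine Integrable.mono' h1 ((continuous_signedPow hα).comp_aestronglyMeasurable hu)
    (Eventually.of_forall fun q => ?_)
  rw [Real.norm_eq_abs, abs_signedPow hα]

/-- The product is dominated by `|u|^(2α) + v²`: the first term is integrable by the Sobolev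
embedding, the second because `v` is square integrable. -/
theorem LocalSobolev.locallyIntegrableOn_rpow_mul {α : ℝ} (hα : 0 < α) {p : ℝ≥0∞} (hp : 2 ≤ p)
    {Ω : Set (ℝ × ℝ)} (hΩ : IsOpen Ω) {u : ℝ × ℝ → ℝ} (h : LocalSobolev α p Ω u)
    {v : ℝ × ℝ → ℝ} (hv : ∀ K ⊆ Ω \ yAxis, IsCompact K → MemLp v p (volume.restrict K)) :
    LocallyIntegrableOn (fun q => |u q| ^ α * v q) (Ω \ yAxis) := by
  refine locallyIntegrableOn_of_isCompact (hΩ.sdiff isClosed_yAxis) fun K hK hKc => ?_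
  have : IsFiniteMeasure (volume.restrict K) := ⟨by simpa using hKc.measure_lt_top⟩
  have h1 := h.integrableOn_rpow hα hp hΩ hK hKc (t := 2 * α) (by positivity)
  have hv2 : Integrable (fun q => v q ^ 2) (volume.restrict K) :=
    ((hv K hK hKc).mono_exponent hp).integrable_sq
  have hu : AEStronglyMeasurable u (volume.restrict K) :=
    h.hasWeakPartial_x.1.aestronglyMeasurable.mono_measure
      (Measure.restrict_mono (hK.trans sdiff_subset) le_rfl)
  refine Integrable.mono' (h1.add hv2)
    (((continuous_abs_rpow hα).comp_aestronglyMeasurable hu).mul (hv K hK hKc).1)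
    (Eventually.of_forall fun q => ?_)
  have e : |u q| ^ (2 * α) = (|u q| ^ α) ^ 2 := by
    rw [mul_comm, Real.rpow_mul (abs_nonneg _)]
    norm_cast
  rw [Pi.add_apply, e, norm_mul, Real.norm_eq_abs, Real.norm_eq_abs, ← sq_abs (v q),
    abs_of_nonneg (by positivity : 0 ≤ |u q| ^ α)]
  nlinarith [sq_nonneg (|u q| ^ α - |v q|), sq_nonneg (|u q| ^ α + |v q|), sq_nonneg (v q),
    sq_abs (v q)]

/-! ### The operator `W̄` and holomorphy in Meyerson coordinates -/

theorem hasWeakPartial_meyerson_comp {α : ℝ} (hα : 0 < α) {U : Set (ℝ × ℝ)} (hU : IsOpen U)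
    {e : ℝ × ℝ} {g : ℝ × ℝ → ℝ × ℝ} {v₁ v₂ : ℝ × ℝ → ℝ}
    (h₁ : HasWeakPartial U e (fun q => (g q).1) v₁) (h₂ : HasWeakPartial U e (fun q => (g q).2) v₂)
    (hs : LocallyIntegrableOn (fun q => signedPow α (g q).1) U)
    (hv : LocallyIntegrableOn (fun q => |(g q).1| ^ α * v₁ q) U) :
    HasWeakPartial U e (fun q => meyerson α (g q))
      (fun q => ((|(g q).1| ^ α * v₁ q : ℝ) : ℂ) + Complex.I * (v₂ q : ℂ)) := by
  have := ((h₁.signedPow_comp hα hU hs hv).clm_comp Complex.ofRealCLM).add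
    (h₂.clm_comp (Complex.I • Complex.ofRealCLM))
  simpa [meyerson_eq] using this

/-- Explicit formula for the operator `W̄`. -/
theorem wbar_ae_eq {α : ℝ} (hα : 0 < α) {p : ℝ≥0∞} (hp : 2 ≤ p) {Ω : Set (ℝ × ℝ)}
    (hΩ : IsOpen Ω) {g : ℝ × ℝ → ℝ × ℝ} (h₁ : LocalSobolev α p Ω (fun q => (g q).1))
    (h₂ : LocalSobolev α p Ω (fun q => (g q).2)) :
    ∀ᵐ q ∂(volume.restrict Ω), Wbar α Ω g q =
      ((|(g q).1| ^ α * X Ω (fun r => (g r).1) q - Y α Ω (fun r => (g r).2) q : ℝ) : ℂ) +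
      Complex.I *
        ((X Ω (fun r => (g r).2) q + |(g q).1| ^ α * Y α Ω (fun r => (g r).1) q : ℝ) : ℂ) := by
  have hU := hΩ.sdiff isClosed_yAxis
  have hs := h₁.locallyIntegrableOn_signedPow hα hp hΩ
  have hx := (hasWeakPartial_meyerson_comp hα hU (h₁.hasWeakPartial_x.mono sdiff_subset)
    (h₂.hasWeakPartial_x.mono sdiff_subset) hs (h₁.locallyIntegrableOn_rpow_mul hα hp hΩ
      fun K hK hKc => h₁.memLp_x K (hK.trans sdiff_subset) hKc)).ae_eq_weakPartial hU
  have hy := (hasWeakPartial_meyerson_comp hα hU (h₁.hasWeakPartial_y.mono sdiff_subset)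
    (h₂.hasWeakPartial_y.mono sdiff_subset) hs (h₁.locallyIntegrableOn_rpow_mul hα hp hΩ
      fun K hK hKc => h₁.memLp_y_of_diff_yAxis hα hK hKc)).ae_eq_weakPartial hU
  have e : volume.restrict (Ω \ yAxis) = volume.restrict Ω :=
    Measure.restrict_congr_set (sdiff_null_ae_eq_self volume_yAxis)
  rw [e] at hx hy
  filter_upwards [hx, hy] with q hqx hqy
  rw [Wbar, hqx, hqy, X, X, Y, Y]
  push_cast
  linear_combination (((|q.1| ^ α : ℝ) : ℂ) * ((weakPartial Ω (0, 1) (fun r => (g r).2) q : ℝ) : ℂ)) *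
    Complex.I_sq

/-- The equation `W̄ g = 0` as a Cauchy-Riemann system. -/
theorem wbar_ae_eq_zero_iff {α : ℝ} (hα : 0 < α) {p : ℝ≥0∞} (hp : 2 ≤ p) {Ω : Set (ℝ × ℝ)}
    (hΩ : IsOpen Ω) {g : ℝ × ℝ → ℝ × ℝ} (h₁ : LocalSobolev α p Ω (fun q => (g q).1))
    (h₂ : LocalSobolev α p Ω (fun q => (g q).2)) :
    (∀ᵐ q ∂(volume.restrict Ω), Wbar α Ω g q = 0) ↔ ∀ᵐ q ∂(volume.restrict Ω),
      |(g q).1| ^ α * X Ω (fun r => (g r).1) q = Y α Ω (fun r => (g r).2) q ∧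
      |(g q).1| ^ α * Y α Ω (fun r => (g r).1) q = -X Ω (fun r => (g r).2) q := by
  refine eventually_congr ?_
  filter_upwards [wbar_ae_eq hα hp hΩ h₁ h₂] with q hq
  rw [hq, Complex.ext_iff]
  simp only [Complex.add_re, Complex.ofReal_re, Complex.mul_re, Complex.I_re, Complex.I_im,
    Complex.ofReal_im, Complex.add_im, Complex.mul_im, Complex.zero_re, Complex.zero_im]
  constructor
  · rintro ⟨h1, h2⟩
    constructor <;> linarith
  · rintro ⟨h1, h2⟩
    constructor <;> linarith

/-- A solution of `W̄ g = 0` is holomorphic in Meyerson coordinates. -/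
theorem exists_holomorphic {α : ℝ} (hα : 0 < α) {p : ℝ≥0∞} (hp : 2 ≤ p) {Ω : Set (ℝ × ℝ)}
    (hΩ : IsOpen Ω) {g : ℝ × ℝ → ℝ × ℝ} (h₁ : LocalSobolev α p Ω (fun q => (g q).1))
    (h₂ : LocalSobolev α p Ω (fun q => (g q).2))
    (hW : ∀ᵐ q ∂(volume.restrict Ω), Wbar α Ω g q = 0) :
    ∃ h : ℂ → ℂ, DifferentiableOn ℂ h (meyerson α '' Ω) ∧
      ∀ᵐ q ∂(volume.restrict Ω), meyerson α (g q) = h (meyerson α q) := by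
  have hCR := (wbar_ae_eq_zero_iff hα hp hΩ h₁ h₂).1 hW
  have hD : IsOpen (meyerson α '' Ω) := by
    rw [← coe_meyersonHomeo hα]; exact (meyersonHomeo hα).isOpenMap _ hΩ
  set u : ℝ × ℝ → ℝ := fun q => (g q).1 with hu
  set t : ℝ × ℝ → ℝ := fun q => (g q).2 with ht
  -- Here the equation is decisive: the product equals `|x|^α ∂_y g₂` a.e., which is locally
  -- integrable also across the axis.
  have hvx : LocallyIntegrableOn (fun q => |u q| ^ α * weakPartial Ω (1, 0) u q) Ω := by
    refine locallyIntegrableOn_of_isCompact hΩ fun K hK hKc => ?_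
    have hy := h₂.hasWeakPartial_y.2.1.integrableOn_compact_subset hK hKc
    have := hy.continuousOn_mul (continuous_weight hα).continuousOn hKc
    refine Integrable.congr this ?_
    filter_upwards [ae_restrict_of_ae_restrict_of_subset hK hCR] with q hq
    exact hq.1.symm
  have hs : LocallyIntegrableOn (fun q => signedPow α (u q)) Ω :=
    locallyIntegrableOn_signedPow_of_diff_yAxis hα hΩ h₁.hasWeakPartial_x
      (h₁.locallyIntegrableOn_signedPow hα hp hΩ) hvx
  have hvy : LocallyIntegrableOn (fun q => |q.1| ^ α * (|u q| ^ α * weakPartial Ω (0, 1) u q)) Ω := by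
    refine locallyIntegrableOn_of_isCompact hΩ fun K hK hKc => ?_
    have hx := (h₂.hasWeakPartial_x.2.1.integrableOn_compact_subset hK hKc).neg
    refine Integrable.congr hx ?_
    filter_upwards [ae_restrict_of_ae_restrict_of_subset hK hCR] with q hq
    have := hq.2
    simp only [X, Y] at this
    rw [Pi.neg_apply, ← this]
    ring
  have hsx := h₁.hasWeakPartial_x.signedPow_comp hα hΩ hs hvx
  have hFloc : LocallyIntegrableOn (fun q => meyerson α (g q)) Ω := by
    refine locallyIntegrableOn_of_isCompact hΩ fun K hK hKc => ?_
    have i1 : IntegrableOn (fun q => ((signedPow α (u q) : ℝ) : ℂ)) K :=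
      (hs.integrableOn_compact_subset hK hKc).ofReal
    have i2 : IntegrableOn (fun q => ((t q : ℝ) : ℂ)) K :=
      (h₂.hasWeakPartial_x.1.integrableOn_compact_subset hK hKc).ofReal
    have := i1.add (i2.const_mul Complex.I)
    refine Integrable.congr this (Eventually.of_forall fun q => ?_)
    simp only [Pi.add_apply, meyerson_eq, hu, ht]
  obtain ⟨F, hF, hFe⟩ := exists_holomorphic_of_weak_dbar hD
    (locallyIntegrableOn_comp_meyerson_symm hα hΩ hFloc) fun Ψ hΨ hc hsupp => by
    set ψ : ℝ × ℝ → ℝ := Ψ ∘ meyersonHomeo hα with hψdef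
    have hψ : ContDiff ℝ 1 ψ := (hΨ.of_le (by simp)).comp (contDiff_one_meyerson hα)
    have hψc : HasCompactSupport ψ := hc.comp_homeomorph _
    have hψs : tsupport ψ ⊆ Ω := by
      have h1 : tsupport ψ ⊆ meyersonHomeo hα ⁻¹' tsupport Ψ :=
        closure_minimal (fun q hq => subset_tsupport _ hq)
          ((isClosed_tsupport Ψ).preimage (meyersonHomeo hα).continuous)
      intro q hq
      obtain ⟨q', hq', he⟩ := hsupp (h1 hq)
      rw [← coe_meyersonHomeo hα] at he
      rwa [← (meyersonHomeo hα).injective he]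
    have hfd : ∀ q, fderiv ℝ ψ q = (fderiv ℝ Ψ (meyerson α q)).comp (meyersonDeriv α q) :=
      fun q => ((hΨ.differentiable (by simp) _).hasFDerivAt.comp q
        (hasFDerivAt_meyerson hα q)).fderiv
    -- The Jacobian `|x|^α` of the change of variables turns `(∂₁ + i∂₂)Ψ` into `(∂_x + i|x|^α
    -- ∂_y)ψ`.
    have hA : ∀ q, |q.1| ^ α * fderiv ℝ Ψ (meyerson α q) 1 = fderiv ℝ ψ q (1, 0) := fun q => by
      rw [hfd, ContinuousLinearMap.comp_apply, meyersonDeriv_apply]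
      have : (((|q.1| ^ α * 1 : ℝ) : ℂ) + Complex.I * ((0 : ℝ) : ℂ)) = (|q.1| ^ α) • (1 : ℂ) := by
        simp
      rw [this, map_smul, smul_eq_mul]
    have hB : ∀ q, fderiv ℝ Ψ (meyerson α q) Complex.I = fderiv ℝ ψ q (0, 1) := fun q => by
      rw [hfd, ContinuousLinearMap.comp_apply, meyersonDeriv_apply]
      simp
    -- Since `φ` is in general only `C¹`, so is `ψ = Ψ ∘ φ`; hence the `C¹` versions of integration
    -- by parts. The real part uses `e1` and `e2`, the imaginary part `e3` and `e4`, and the two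
    -- equations of the system (`c1`, `c2`) make each cancel.
    have e1 := hsx.integral_eq_of_contDiff_one hΩ hψ hψc hψs
    have e2 := integral_weight hΩ hα h₂.hasWeakPartial_y hψ hψc hψs
    have e3 := h₂.hasWeakPartial_x.integral_eq_of_contDiff_one hΩ hψ hψc hψs
    have e4 := integral_weight_signedPow hΩ hα h₁.hasWeakPartial_y hs hvy hψ hψc hψs
    have hCR' : ∀ᵐ q, q ∈ tsupport ψ →
        |u q| ^ α * weakPartial Ω (1, 0) u q = |q.1| ^ α * weakPartial Ω (0, 1) t q ∧
        |u q| ^ α * (|q.1| ^ α * weakPartial Ω (0, 1) u q) = -weakPartial Ω (1, 0) t q := by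
      rw [ae_restrict_iff' hΩ.measurableSet] at hCR
      filter_upwards [hCR] with q hq hqs
      exact hq (hψs hqs)
    have c1 : ∫ q, ψ q * (|u q| ^ α * weakPartial Ω (1, 0) u q) =
        ∫ q, |q.1| ^ α * ψ q * weakPartial Ω (0, 1) t q := by
      refine integral_congr_ae ?_
      filter_upwards [hCR'] with q hq
      by_cases hqs : q ∈ tsupport ψ
      · rw [(hq hqs).1]; ring
      · rw [image_eq_zero_of_notMem_tsupport hqs]; ring
    have c2 : ∫ q, ψ q * (|q.1| ^ α * (|u q| ^ α * weakPartial Ω (0, 1) u q)) =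
        -∫ q, ψ q * weakPartial Ω (1, 0) t q := by
      rw [← integral_neg]
      refine integral_congr_ae ?_
      filter_upwards [hCR'] with q hq
      by_cases hqs : q ∈ tsupport ψ
      · linear_combination ψ q * (hq hqs).2
      · rw [image_eq_zero_of_notMem_tsupport hqs]; ring
    have cA : Continuous fun q => fderiv ℝ ψ q (1, 0) :=
      (hψ.continuous_fderiv (by simp)).clm_apply continuous_const
    have cB : Continuous fun q => fderiv ℝ ψ q (0, 1) :=
      (hψ.continuous_fderiv (by simp)).clm_apply continuous_const
    have int : ∀ (e : ℝ × ℝ) (w : ℝ × ℝ → ℝ) (f : ℝ × ℝ → ℝ), Continuous w →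
        LocallyIntegrableOn f Ω → Integrable fun q => w q * fderiv ℝ ψ q e * f q := by
      intro e w f hw hf
      have hsub : tsupport (fun q => w q * fderiv ℝ ψ q e) ⊆ tsupport ψ :=
        (tsupport_mul_subset_right (f := w)).trans (tsupport_fderiv_apply_subset' ψ e)
      exact integrable_smul_of_tsupport_subset hf
        (hw.mul ((hψ.continuous_fderiv (by simp)).clm_apply continuous_const))
        (hψc.of_isClosed_subset (isClosed_tsupport _) hsub) (hsub.trans hψs)
    have i1 : Integrable fun q => fderiv ℝ ψ q (1, 0) * signedPow α (u q) := by
      simpa using int (1, 0) (fun _ => 1) _ continuous_const hs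
    have i2 := int (0, 1) (fun q => |q.1| ^ α) _ (continuous_weight hα) h₂.hasWeakPartial_y.1
    have i3 : Integrable fun q => fderiv ℝ ψ q (1, 0) * t q := by
      simpa using int (1, 0) (fun _ => 1) _ continuous_const h₂.hasWeakPartial_x.1
    have i4 := int (0, 1) (fun q => |q.1| ^ α) _ (continuous_weight hα) hs
    rw [integral_meyerson hα]
    have hpt : ∀ q : ℝ × ℝ, ((|q.1| ^ α : ℝ) : ℂ) *
        (((fderiv ℝ Ψ (meyerson α q) 1 : ℂ) +
          Complex.I * (fderiv ℝ Ψ (meyerson α q) Complex.I : ℂ)) *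
          meyerson α (g ((meyersonHomeo hα).symm (meyerson α q)))) =
        ((fderiv ℝ ψ q (1, 0) * signedPow α (u q) -
          |q.1| ^ α * fderiv ℝ ψ q (0, 1) * t q : ℝ) : ℂ) + Complex.I *
        ((fderiv ℝ ψ q (1, 0) * t q +
          |q.1| ^ α * fderiv ℝ ψ q (0, 1) * signedPow α (u q) : ℝ) : ℂ) := fun q => by
      rw [← meyersonHomeo_apply hα q, (meyersonHomeo hα).symm_apply_apply, meyersonHomeo_apply,
        ← hA, ← hB, meyerson_eq α (g q)]
      push_cast
      linear_combination (((|q.1| ^ α : ℝ) : ℂ) * (fderiv ℝ Ψ (meyerson α q) Complex.I : ℂ) *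
        ((g q).2 : ℂ)) * Complex.I_sq
    rw [integral_congr_ae (Eventually.of_forall hpt), integral_add (i1.sub i2).ofReal
      ((i3.add i4).ofReal.const_mul _), integral_complex_ofReal, integral_const_mul, integral_complex_ofReal,
      integral_sub i1 i2, integral_add i3 i4, e1, e2, e3, e4, c1, c2]
    simp
  refine ⟨F, hF, ?_⟩
  rw [ae_restrict_iff' hD.measurableSet] at hFe
  rw [ae_restrict_iff' hΩ.measurableSet]
  filter_upwards [ae_of_ae_meyerson hα hFe] with q hq hqΩ
  have := hq (mem_image_of_mem _ hqΩ)
  rwa [← meyersonHomeo_apply hα q, (meyersonHomeo hα).symm_apply_apply, meyersonHomeo_apply] at this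

/-! ### The smooth representative -/

theorem contDiffAt_signedPow {α t : ℝ} (ht : t ≠ 0) : ContDiffAt ℝ ∞ (signedPow α) t :=
  (contDiffAt_id.mul ((contDiffAt_abs ht).rpow_const_of_ne (abs_ne_zero.2 ht))).div_const _

theorem meyersonHomeo_symm_apply {α : ℝ} (hα : 0 < α) (z : ℂ) :
    (meyersonHomeo hα).symm z = ((signedPowHomeo hα).symm z.re, z.im) := rfl

theorem contDiffAt_signedPowHomeo_symm {α s : ℝ} (hα : 0 < α) (hs : s ≠ 0) :
    ContDiffAt ℝ ∞ (signedPowHomeo hα).symm s := by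
  have ht : (signedPowHomeo hα).symm s ≠ 0 := fun h => hs (by
    have := congrArg (signedPowHomeo hα) h
    rwa [Homeomorph.apply_symm_apply, signedPowHomeo_apply, signedPow_zero] at this)
  exact (signedPowHomeo hα).toOpenPartialHomeomorph.contDiffAt_symm_deriv
    (f₀' := |(signedPowHomeo hα).symm s| ^ α) (by positivity) (mem_univ s)
    (hasDerivAt_signedPow hα _) (contDiffAt_signedPow ht)

theorem contDiffAt_meyerson {α : ℝ} {q : ℝ × ℝ} (hq : q.1 ≠ 0) :
    ContDiffAt ℝ ∞ (meyerson α) q := by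
  have h1 : ContDiffAt ℝ ∞ (fun q : ℝ × ℝ => (signedPow α q.1, q.2)) q :=
    ((contDiffAt_signedPow hq).comp q contDiffAt_fst).prodMk contDiffAt_snd
  exact Complex.equivRealProdCLM.symm.contDiff.contDiffAt.comp q h1

theorem contDiffAt_meyersonHomeo_symm {α : ℝ} (hα : 0 < α) {z : ℂ} (hz : z.re ≠ 0) :
    ContDiffAt ℝ ∞ (meyersonHomeo hα).symm z := by
  have h1 : ContDiffAt ℝ ∞ Complex.re z := Complex.reCLM.contDiff.contDiffAt
  have h2 : ContDiffAt ℝ ∞ Complex.im z := Complex.imCLM.contDiff.contDiffAt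
  exact ((contDiffAt_signedPowHomeo_symm hα hz).comp z h1).prodMk h2

theorem isOpen_meyerson_image {α : ℝ} (hα : 0 < α) {Ω : Set (ℝ × ℝ)} (hΩ : IsOpen Ω) :
    IsOpen (meyerson α '' Ω) := by
  rw [← coe_meyersonHomeo hα]; exact (meyersonHomeo hα).isOpenMap _ hΩ

theorem contDiffAt_of_differentiableOn {h : ℂ → ℂ} {D : Set ℂ} (hD : IsOpen D)
    (hh : DifferentiableOn ℂ h D) {z : ℂ} (hz : z ∈ D) : ContDiffAt ℝ ∞ h z :=
  ((hh.contDiffOn hD).contDiffAt (hD.mem_nhds hz)).restrict_scalars ℝ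

/-- The representative is `φ⁻¹ ∘ h ∘ φ`. It is continuous throughout; `φ` is smooth off the axis and
`φ⁻¹` is smooth where the real part is nonzero, and these conditions together describe the regular
set. -/
theorem exists_contDiffOn_representative {α : ℝ} (hα : 0 < α) {p : ℝ≥0∞} (hp : 2 ≤ p)
    {Ω : Set (ℝ × ℝ)} (hΩ : IsOpen Ω) {g : ℝ × ℝ → ℝ × ℝ}
    (h₁ : LocalSobolev α p Ω (fun q => (g q).1)) (h₂ : LocalSobolev α p Ω (fun q => (g q).2))
    (hW : ∀ᵐ q ∂(volume.restrict Ω), Wbar α Ω g q = 0) :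
    ∃ g' : ℝ × ℝ → ℝ × ℝ, (∀ᵐ q ∂(volume.restrict Ω), g q = g' q) ∧
      ContDiffOn ℝ ∞ g' (regularSet Ω g') ∧ ContinuousOn g' Ω := by
  obtain ⟨h, hh, hgh⟩ := exists_holomorphic hα hp hΩ h₁ h₂ hW
  have hD := isOpen_meyerson_image hα hΩ
  refine ⟨fun q => (meyersonHomeo hα).symm (h (meyerson α q)), ?_, fun q hq => ?_, ?_⟩
  · filter_upwards [hgh] with q hq
    rw [← hq, ← meyersonHomeo_apply hα, Homeomorph.symm_apply_apply]
  · have hqΩ : q ∈ Ω := hq.1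
    have hq1 : q.1 ≠ 0 := fun hcon => hq.2 ⟨hqΩ, Or.inl hcon⟩
    have hz : (h (meyerson α q)).re ≠ 0 := fun hcon => hq.2 ⟨hqΩ, Or.inr (by
      simp only [meyersonHomeo_symm_apply]
      rw [hcon]
      refine (signedPowHomeo hα).injective ?_
      rw [Homeomorph.apply_symm_apply, signedPowHomeo_apply, signedPow_zero])⟩
    have hc := (contDiffAt_of_differentiableOn hD hh (mem_image_of_mem _ hqΩ)).comp q
      (contDiffAt_meyerson (α := α) hq1)
    exact ((contDiffAt_meyersonHomeo_symm hα hz).comp q hc).contDiffWithinAt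
  · exact (meyersonHomeo hα).symm.continuous.comp_continuousOn
      (hh.continuousOn.comp (meyersonHomeo hα).continuous.continuousOn (mapsTo_image _ _))

/-! ### The singular set is null, and conformal maps satisfy the equation -/

theorem singularSet_subset {Ω : Set (ℝ × ℝ)} {g : ℝ × ℝ → ℝ × ℝ} :
    singularSet Ω g ⊆ yAxis ∪ {q ∈ Ω | (g q).1 = 0} := by
  rintro q ⟨hq, h | h⟩
  · exact Or.inl h
  · exact Or.inr ⟨hq, h⟩

/-- The weak gradient of `g₁` vanishes a.e. on `{g₁ = 0}`, which makes the first row of `D_H g` zero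
and contradicts a positive determinant. -/
theorem volume_singularSet {α : ℝ} {p : ℝ≥0∞} {Ω Ω' : Set (ℝ × ℝ)} (hΩ : IsOpen Ω)
    {g : ℝ × ℝ → ℝ × ℝ} (h₁ : LocalSobolev α p Ω (fun q => (g q).1))
    (hg : OrientationPreserving α Ω Ω' g) : volume (singularSet Ω g) = 0 := by
  refine measure_mono_null singularSet_subset (measure_union_null volume_yAxis ?_)
  have := hg.2
  rw [ae_restrict_iff' hΩ.measurableSet] at this
  have hx := h₁.hasWeakPartial_x.ae_eq_zero_of_eq_zero hΩ
  have hy := h₁.hasWeakPartial_y.ae_eq_zero_of_eq_zero hΩ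
  rw [ae_restrict_iff' hΩ.measurableSet] at hx hy
  have key : ∀ᵐ q, ¬ (q ∈ Ω ∧ (g q).1 = 0) := by
    filter_upwards [this, hx, hy] with q hdet hqx hqy hq
    have hd := hdet hq.1
    rw [horizontalD, Matrix.det_fin_two_of, X, Y, Y, hqx hq.1 hq.2, hqy hq.1 hq.2] at hd
    simp at hd
  exact measure_eq_zero_iff_ae_notMem.2 key

/-- Orthogonality gives `det² = 1`, hence `det = 1`, and `(Q₀₀ - Q₁₁)² + (Q₀₁ + Q₁₀)²` is the sum of
the squared entries minus `2 det`, that is `2 - 2 = 0`. -/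
theorem orthogonal_entries {Q : Matrix (Fin 2) (Fin 2) ℝ}
    (hQ : Q ∈ Matrix.orthogonalGroup (Fin 2) ℝ) (hd : 0 < Q.det) :
    Q 0 0 = Q 1 1 ∧ Q 0 1 = -Q 1 0 := by
  rw [Matrix.mem_orthogonalGroup_iff] at hQ
  have h00 := congrFun (congrFun hQ 0) 0
  have h01 := congrFun (congrFun hQ 0) 1
  have h11 := congrFun (congrFun hQ 1) 1
  simp only [Matrix.mul_apply, Fin.sum_univ_two, Matrix.transpose_apply, Matrix.one_apply_eq,
    Matrix.one_apply_ne (zero_ne_one : (0 : Fin 2) ≠ 1)] at h00 h01 h11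
  rw [Matrix.det_fin_two] at hd
  have hdet : Q 0 0 * Q 1 1 - Q 0 1 * Q 1 0 = 1 := by
    have : (Q 0 0 * Q 1 1 - Q 0 1 * Q 1 0) ^ 2 = 1 := by
      linear_combination (Q 1 0 * Q 1 0 + Q 1 1 * Q 1 1) * h00 + h11 -
        (Q 0 0 * Q 1 0 + Q 0 1 * Q 1 1) * h01
    nlinarith
  have : (Q 0 0 - Q 1 1) ^ 2 + (Q 0 1 + Q 1 0) ^ 2 = 0 := by linarith
  constructor
  · nlinarith [sq_nonneg (Q 0 0 - Q 1 1), sq_nonneg (Q 0 1 + Q 1 0)]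
  · nlinarith [sq_nonneg (Q 0 0 - Q 1 1), sq_nonneg (Q 0 1 + Q 1 0)]

/-- Where `D_α g = cQ`, one has `J_g = c² |g₁|^α det Q`, so positivity of `J_g` makes `Q` a
rotation, and the shape of a rotation is the Cauchy-Riemann system. The regular set has full
measure. -/
theorem Conformal.wbar_ae_eq_zero {α : ℝ} (hα : 0 < α) {p : ℝ≥0∞} (hp : 2 ≤ p)
    {Ω Ω' : Set (ℝ × ℝ)} (hΩ : IsOpen Ω) {g : ℝ × ℝ → ℝ × ℝ}
    (h₁ : LocalSobolev α p Ω (fun q => (g q).1)) (h₂ : LocalSobolev α p Ω (fun q => (g q).2))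
    (hc : Conformal α Ω Ω' g) (ho : OrientationPreserving α Ω Ω' g) :
    ∀ᵐ q ∂(volume.restrict Ω), Wbar α Ω g q = 0 := by
  refine (wbar_ae_eq_zero_iff hα hp hΩ h₁ h₂).2 ?_
  have hS := volume_singularSet hΩ h₁ ho
  have e : volume.restrict (regularSet Ω g) = volume.restrict Ω :=
    Measure.restrict_congr_set (sdiff_null_ae_eq_self hS)
  have hm := hc.2.2.1
  rw [e] at hm
  have hn : ∀ᵐ q ∂(volume.restrict Ω), q ∉ singularSet Ω g :=
    ae_restrict_of_ae (measure_eq_zero_iff_ae_notMem.1 hS)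
  filter_upwards [hm, ho.2, hn, ae_restrict_mem hΩ.measurableSet] with q ⟨c, hc, Q, hQ, he⟩ hd hq hqΩ
  have hg1 : (g q).1 ≠ 0 := fun h => hq ⟨hqΩ, Or.inr h⟩
  have hw : 0 < |(g q).1| ^ α := by positivity
  have e00 : X Ω (fun r => (g r).1) q = c * Q 0 0 := congrFun (congrFun he 0) 0
  have e01 : Y α Ω (fun r => (g r).1) q = c * Q 0 1 := congrFun (congrFun he 0) 1
  have e10 : X Ω (fun r => (g r).2) q / |(g q).1| ^ α = c * Q 1 0 := congrFun (congrFun he 1) 0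
  have e11 : Y α Ω (fun r => (g r).2) q / |(g q).1| ^ α = c * Q 1 1 := congrFun (congrFun he 1) 1
  rw [div_eq_iff hw.ne'] at e10 e11
  rw [horizontalD, Matrix.det_fin_two_of, e00, e01, e10, e11] at hd
  have hQd : 0 < Q.det := by
    rw [Matrix.det_fin_two]
    have : 0 < (c ^ 2 * |(g q).1| ^ α) * (Q 0 0 * Q 1 1 - Q 0 1 * Q 1 0) := by linarith
    exact (mul_pos_iff_of_pos_left (by positivity)).1 this
  obtain ⟨hq1, hq2⟩ := orthogonal_entries hQ hQd
  rw [e00, e01, e10, e11, hq1, hq2]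
  constructor <;> ring

/-! ### Holomorphic representation of homeomorphic solutions -/

/-- The derivative of an injective holomorphic function has no zeros. -/
theorem deriv_ne_zero_of_injOn {h : ℂ → ℂ} {D : Set ℂ} (hD : IsOpen D)
    (hh : DifferentiableOn ℂ h D) (hinj : InjOn h D) {z₀ : ℂ} (hz₀ : z₀ ∈ D) :
    deriv h z₀ ≠ 0 := by
  have hDz : D ∈ 𝓝 z₀ := hD.mem_nhds hz₀
  have han : AnalyticAt ℂ (fun z => h z - h z₀) z₀ :=
    (hh.analyticAt hDz).sub analyticAt_const
  have hne : ¬ ∀ᶠ z in 𝓝 z₀, h z - h z₀ = 0 := fun hcon => by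
    have h1 : ∀ᶠ z in 𝓝[≠] z₀, h z - h z₀ = 0 ∧ z ∈ D ∧ z ≠ z₀ :=
      (hcon.filter_mono nhdsWithin_le_nhds).and
        (Eventually.and (p := (· ∈ D)) (mem_nhdsWithin_of_mem_nhds hDz)
          self_mem_nhdsWithin)
    obtain ⟨z, hz, hzD, hzz⟩ := h1.exists
    exact hzz (hinj hzD hz₀ (sub_eq_zero.1 hz))
  obtain ⟨n, k, hk, hk0, hfk⟩ := han.exists_eventuallyEq_pow_smul_nonzero_iff.2 hne
  have hn0 : n ≠ 0 := fun hn => by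
    have := hfk.self_of_nhds
    simp [hn] at this
    exact hk0 this.symm
  obtain ⟨c, hc⟩ := IsAlgClosed.exists_pow_nat_eq (k z₀) (Nat.pos_of_ne_zero hn0)
  have hc0 : c ≠ 0 := fun hcon => hk0 (by rw [← hc, hcon, zero_pow hn0])
  -- An analytic `n`-th root of `k`: the quotient `k / k z₀` is near 1, where the logarithm is
  -- analytic. Then `h - h z₀ = φⁿ` with `φ = (z - z₀) r` locally invertible.
  set r : ℂ → ℂ := fun z => c * Complex.exp (Complex.log (k z / k z₀) / n) with hr
  have hslit : k z₀ / k z₀ ∈ Complex.slitPlane := by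
    rw [div_self hk0]; exact Complex.one_mem_slitPlane
  have hkd : AnalyticAt ℂ (fun z => k z / k z₀) z₀ := hk.div_const
  have hra : AnalyticAt ℂ r z₀ :=
    analyticAt_const.mul ((hkd.clog hslit).div_const).cexp
  have hr0 : r z₀ = c := by simp [hr, div_self hk0]
  have hrn : ∀ᶠ z in 𝓝 z₀, r z ^ n = k z := by
    filter_upwards [hk.continuousAt.eventually_ne hk0] with z hz
    have hn : (n : ℂ) ≠ 0 := by exact_mod_cast hn0
    rw [hr]
    simp only
    rw [mul_pow, ← Complex.exp_nat_mul, mul_div_cancel₀ _ hn, Complex.exp_log (div_ne_zero hz hk0),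
      hc, mul_div_cancel₀ _ hk0]
  set φ : ℂ → ℂ := fun z => (z - z₀) * r z with hφ
  have hφa : AnalyticAt ℂ φ z₀ := (analyticAt_id.sub analyticAt_const).mul hra
  have hφd : HasDerivAt φ c z₀ := by
    have := ((hasDerivAt_id z₀).sub_const z₀).mul hra.differentiableAt.hasDerivAt
    rw [id, sub_self, zero_mul, add_zero, one_mul, hr0] at this
    exact this
  have hφs : HasStrictDerivAt φ c z₀ := by
    have := hφa.hasStrictDerivAt
    rwa [hφd.deriv] at this
  have hpow : ∀ᶠ z in 𝓝 z₀, h z - h z₀ = φ z ^ n ∧ z ∈ D := by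
    filter_upwards [hfk, hrn, hDz] with z h1 h2 h3
    refine ⟨?_, h3⟩
    rw [h1, hφ]
    simp only
    rw [mul_pow, h2, smul_eq_mul]
  rcases eq_or_ne n 1 with rfl | hn1
  · have h2 : HasDerivAt h c z₀ := by
      have h1 := hφd.add_const (h z₀)
      refine h1.congr_of_eventuallyEq ?_
      filter_upwards [hpow] with z hz
      rw [← pow_one (φ z), ← hz.1]
      ring
    rw [h2.deriv]
    exact hc0
  · exfalso
    have hmap := hφs.map_nhds_eq hc0
    have himg : φ '' {z | h z - h z₀ = φ z ^ n ∧ z ∈ D} ∈ 𝓝 (φ z₀) := by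
      rw [← hmap]; exact image_mem_map hpow
    have hφ0 : φ z₀ = 0 := by simp [hφ]
    rw [hφ0] at himg
    obtain ⟨δ, hδ, hball⟩ := Metric.mem_nhds_iff.1 himg
    -- If `n ≥ 2`, points where `φ` takes the values `δ/2` and `ζ δ/2` are distinct but have the
    -- same image under `h`.
    obtain ⟨ζ, hζ⟩ : ∃ ζ : ℂ, IsPrimitiveRoot ζ n := ⟨_, Complex.isPrimitiveRoot_exp n hn0⟩
    have hζn : ‖ζ‖ = 1 := hζ.norm'_eq_one hn0
    have hζ1 : ζ ≠ 1 := hζ.ne_one (by omega)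
    have hε : ((δ / 2 : ℝ) : ℂ) ∈ Metric.ball (0 : ℂ) δ := by
      rw [mem_ball_zero_iff, Complex.norm_real, Real.norm_of_nonneg (by positivity)]
      linarith
    have hζε : ζ * ((δ / 2 : ℝ) : ℂ) ∈ Metric.ball (0 : ℂ) δ := by
      rw [mem_ball_zero_iff, norm_mul, hζn, one_mul]
      exact mem_ball_zero_iff.1 hε
    obtain ⟨z₁, ⟨h1, h1D⟩, e1⟩ := hball hε
    obtain ⟨z₂, ⟨h2, h2D⟩, e2⟩ := hball hζε
    have heq : z₁ = z₂ := hinj h1D h2D (by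
      have : h z₁ - h z₀ = h z₂ - h z₀ := by
        rw [h1, h2, e1, e2, mul_pow, hζ.pow_eq_one, one_mul]
      linear_combination this)
    rw [heq, e2] at e1
    have hδ0 : ((δ / 2 : ℝ) : ℂ) ≠ 0 := by
      exact_mod_cast (by positivity : δ / 2 ≠ 0)
    exact hζ1 (mul_right_cancel₀ hδ0 (by rw [e1, one_mul]))

/-- The classical partial derivatives of a `C¹` function are weak partial derivatives. -/
theorem hasWeakPartial_of_contDiffOn {U : Set (ℝ × ℝ)} (hU : IsOpen U) {u : ℝ × ℝ → ℝ}
    (hu : ContDiffOn ℝ 1 u U) (e : ℝ × ℝ) : HasWeakPartial U e u (fun q => fderiv ℝ u q e) := by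
  have hfd : ContinuousOn (fun q => fderiv ℝ u q e) U :=
    (hu.continuousOn_fderiv_of_isOpen hU le_rfl).clm_apply continuousOn_const
  refine .of_integral_eq (hu.continuousOn.locallyIntegrableOn hU.measurableSet)
    (hfd.locallyIntegrableOn hU.measurableSet) fun ψ hψ hc hs => ?_
  have hψ1 : ContDiff ℝ 1 ψ := hψ.of_le (by simp)
  have hs' := tsupport_fderiv_apply_subset' ψ e
  have key := integral_mul_fderiv_eq_neg_fderiv_mul_of_integrable (μ := volume) (v := e)
    (f := ψ) (g := u)
    (integrable_smul_of_tsupport_subset (hu.continuousOn.locallyIntegrableOn hU.measurableSet)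
      ((hψ1.continuous_fderiv (by simp)).clm_apply continuous_const)
      (hc.of_isClosed_subset (isClosed_tsupport _) hs') (hs'.trans hs))
    (integrable_smul_of_tsupport_subset (hfd.locallyIntegrableOn hU.measurableSet)
      hψ.continuous hc hs)
    (integrable_smul_of_tsupport_subset (hu.continuousOn.locallyIntegrableOn hU.measurableSet)
      hψ.continuous hc hs)
    (fun q _ => hψ1.differentiable (by simp) q)
    (fun q hq => (hu.differentiableOn (by simp)).differentiableAt (hU.mem_nhds (hs hq)))
  simp only [smul_eq_mul]
  rw [key, neg_neg]

theorem IsHomeo.continuousOn {Ω Ω' : Set (ℝ × ℝ)} {g : ℝ × ℝ → ℝ × ℝ} (h : IsHomeo Ω Ω' g) :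
    ContinuousOn g Ω := by
  obtain ⟨φ, hφ⟩ := h
  rw [continuousOn_iff_continuous_domRestrict]
  have : Ω.domRestrict g = fun q => (φ q : ℝ × ℝ) := funext fun q => (hφ q).symm
  rw [this]
  exact continuous_subtype_val.comp φ.continuous

theorem IsHomeo.injOn {Ω Ω' : Set (ℝ × ℝ)} {g : ℝ × ℝ → ℝ × ℝ} (h : IsHomeo Ω Ω' g) :
    InjOn g Ω := by
  obtain ⟨φ, hφ⟩ := h
  intro a ha b hb hab
  have : φ ⟨a, ha⟩ = φ ⟨b, hb⟩ := Subtype.ext (by rw [hφ, hφ]; exact hab)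
  exact congrArg Subtype.val (φ.injective this)

/-- `g` is the holomorphic function `h` in Meyerson coordinates, `h'` has no zeros, and the weak
derivatives of `g` are given by those of `h`. -/
structure HolomorphicRep (α : ℝ) (Ω : Set (ℝ × ℝ)) (g : ℝ × ℝ → ℝ × ℝ) (h : ℂ → ℂ) : Prop where
  differentiableOn : DifferentiableOn ℂ h (meyerson α '' Ω)
  meyerson_apply : ∀ q ∈ Ω, meyerson α (g q) = h (meyerson α q)
  deriv_ne_zero : ∀ q ∈ Ω, deriv h (meyerson α q) ≠ 0
  ae_eq : ∀ᵐ q ∂(volume.restrict Ω),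
    |(g q).1| ^ α * X Ω (fun r => (g r).1) q = |q.1| ^ α * (deriv h (meyerson α q)).re ∧
    |(g q).1| ^ α * Y α Ω (fun r => (g r).1) q = -(|q.1| ^ α * (deriv h (meyerson α q)).im) ∧
    X Ω (fun r => (g r).2) q = |q.1| ^ α * (deriv h (meyerson α q)).im ∧
    Y α Ω (fun r => (g r).2) q = |q.1| ^ α * (deriv h (meyerson α q)).re

/-- Continuity upgrades the a.e. identity to all of `Ω`, and injectivity of `g` passes to `h`. The
component `g₂ = Im h ∘ φ` is `C¹`, so its weak derivatives are classical. For `g₁`, which involves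
an inverse power singular at 0, they are read off from the system instead; hence the factor `|g₁|^α`
in the formulas. -/
theorem exists_holomorphicRep {α : ℝ} (hα : 0 < α) {p : ℝ≥0∞} (hp : 2 ≤ p)
    {Ω Ω' : Set (ℝ × ℝ)} (hΩ : IsOpen Ω) {g : ℝ × ℝ → ℝ × ℝ}
    (h₁ : LocalSobolev α p Ω (fun q => (g q).1)) (h₂ : LocalSobolev α p Ω (fun q => (g q).2))
    (hg : IsHomeo Ω Ω' g) (hW : ∀ᵐ q ∂(volume.restrict Ω), Wbar α Ω g q = 0) :
    ∃ h, HolomorphicRep α Ω g h := by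
  obtain ⟨h, hh, hgh⟩ := exists_holomorphic hα hp hΩ h₁ h₂ hW
  have hD := isOpen_meyerson_image hα hΩ
  have hmc : Continuous (meyerson α) := (meyersonHomeo hα).continuous
  have hmi : Function.Injective (meyerson α) := (meyersonHomeo hα).injective
  have heq : EqOn (fun q => meyerson α (g q)) (fun q => h (meyerson α q)) Ω :=
    Measure.eqOn_open_of_ae_eq hgh hΩ (hmc.comp_continuousOn hg.continuousOn)
      (hh.continuousOn.comp hmc.continuousOn (mapsTo_image _ _))
  have hinj : InjOn h (meyerson α '' Ω) := by
    rintro _ ⟨a, ha, rfl⟩ _ ⟨b, hb, rfl⟩ hab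
    have hab' := ((heq ha).trans hab).trans (heq hb).symm
    rw [hg.injOn ha hb (hmi hab')]
  have hsnd : EqOn (fun q => (g q).2) (fun q => (h (meyerson α q)).im) Ω := fun q hq => by
    have := congrArg Complex.im (heq hq)
    simpa only [meyerson_im] using this
  have hfd : ∀ q ∈ Ω, HasFDerivAt (fun q => (h (meyerson α q)).im)
      (Complex.imCLM.comp (((ContinuousLinearMap.toSpanSingleton ℂ
        (deriv h (meyerson α q))).restrictScalars ℝ).comp (meyersonDeriv α q))) q := fun q hq => by
    have hd : HasFDerivAt h (ContinuousLinearMap.toSpanSingleton ℂ (deriv h (meyerson α q)))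
        (meyerson α q) :=
      (hh.differentiableAt (hD.mem_nhds (mem_image_of_mem _ hq))).hasDerivAt.hasFDerivAt
    exact Complex.imCLM.hasFDerivAt.comp q
      ((hd.restrictScalars ℝ).comp q (hasFDerivAt_meyerson hα q))
  have hC1 : ContDiffOn ℝ 1 (fun q => (g q).2) Ω := by
    refine ContDiffOn.congr (fun q hq => ContDiffAt.contDiffWithinAt ?_) hsnd
    exact Complex.imCLM.contDiff.contDiffAt.comp q
      (((contDiffAt_of_differentiableOn hD hh (mem_image_of_mem _ hq)).of_le (by simp)).comp q
        (contDiff_one_meyerson hα).contDiffAt)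
  have hfd' : ∀ q ∈ Ω, ∀ e, fderiv ℝ (fun q => (g q).2) q e =
      (meyersonDeriv α q e * deriv h (meyerson α q)).im := fun q hq e => by
    rw [((hfd q hq).congr_of_eventuallyEq (hsnd.eventuallyEq_of_mem (hΩ.mem_nhds hq))).fderiv]
    rfl
  have hx := (hasWeakPartial_of_contDiffOn hΩ hC1 (1, 0)).ae_eq_weakPartial hΩ
  have hy := (hasWeakPartial_of_contDiffOn hΩ hC1 (0, 1)).ae_eq_weakPartial hΩ
  have hCR := (wbar_ae_eq_zero_iff hα hp hΩ h₁ h₂).1 hW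
  refine ⟨h, hh, heq, fun q hq => deriv_ne_zero_of_injOn hD hh hinj (mem_image_of_mem _ hq), ?_⟩
  filter_upwards [hx, hy, hCR, ae_restrict_mem hΩ.measurableSet] with q hqx hqy hq hqΩ
  have e1 : X Ω (fun r => (g r).2) q = |q.1| ^ α * (deriv h (meyerson α q)).im := by
    rw [X, hqx, hfd' q hqΩ, meyersonDeriv_apply]
    simp
  have e2 : Y α Ω (fun r => (g r).2) q = |q.1| ^ α * (deriv h (meyerson α q)).re := by
    rw [Y, hqy, hfd' q hqΩ, meyersonDeriv_apply]
    simp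
  exact ⟨by rw [hq.1, e2], by rw [hq.2, e1], e1, e2⟩

namespace HolomorphicRep

variable {α : ℝ} {Ω : Set (ℝ × ℝ)} {g : ℝ × ℝ → ℝ × ℝ} {h : ℂ → ℂ}

theorem re_apply (H : HolomorphicRep α Ω g h) {q : ℝ × ℝ} (hq : q ∈ Ω) :
    (h (meyerson α q)).re = signedPow α (g q).1 := by
  rw [← H.meyerson_apply q hq, meyerson_re]

theorem re_eq_zero_iff (H : HolomorphicRep α Ω g h) (hα : 0 < α) {q : ℝ × ℝ} (hq : q ∈ Ω) :
    (h (meyerson α q)).re = 0 ↔ (g q).1 = 0 := by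
  rw [H.re_apply hq, signedPow_eq_zero hα]

/-- The matrix of `D_α g` at the points of the regular set. -/
theorem grushinD_ae_eq (H : HolomorphicRep α Ω g h) :
    ∀ᵐ q ∂(volume.restrict Ω), q ∈ regularSet Ω g → grushinD α Ω g q =
      (|q.1| ^ α / |(g q).1| ^ α) •
        !![(deriv h (meyerson α q)).re, -(deriv h (meyerson α q)).im;
           (deriv h (meyerson α q)).im, (deriv h (meyerson α q)).re] := by
  filter_upwards [H.ae_eq] with q ⟨e1, e2, e3, e4⟩ hq
  have hg1 : (g q).1 ≠ 0 := fun hcon => hq.2 ⟨hq.1, Or.inr hcon⟩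
  have hw : |(g q).1| ^ α ≠ 0 := by positivity
  rw [grushinD, e3, e4]
  ext i j
  fin_cases i <;> fin_cases j
  · simp only [Matrix.smul_apply, smul_eq_mul]
    change X Ω (fun r => (g r).1) q = _ * (deriv h (meyerson α q)).re
    field_simp
    linarith
  · simp only [Matrix.smul_apply, smul_eq_mul]
    change Y α Ω (fun r => (g r).1) q = _ * -(deriv h (meyerson α q)).im
    field_simp
    linarith
  · simp only [Matrix.smul_apply, smul_eq_mul]
    change _ / |(g q).1| ^ α = _ * (deriv h (meyerson α q)).im
    ring
  · simp only [Matrix.smul_apply, smul_eq_mul]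
    change _ / |(g q).1| ^ α = _ * (deriv h (meyerson α q)).re
    ring

theorem continuousOn_deriv (H : HolomorphicRep α Ω g h) (hα : 0 < α) (hΩ : IsOpen Ω) :
    ContinuousOn (fun q => deriv h (meyerson α q)) Ω :=
  ((H.differentiableOn.deriv (isOpen_meyerson_image hα hΩ)).continuousOn.comp
    (meyersonHomeo hα).continuous.continuousOn (mapsTo_image _ _))

end HolomorphicRep

/-! ### The derivative at the axis and conformality -/

theorem norm_sq_eq_re_im (z : ℂ) : ‖z‖ ^ 2 = z.re ^ 2 + z.im ^ 2 := by
  rw [← Complex.normSq_eq_norm_sq, Complex.normSq_apply]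
  ring

theorem rotation_mem_orthogonalGroup {a b r : ℝ} (hr : 0 < r) (h : r ^ 2 = a ^ 2 + b ^ 2) :
    !![a / r, -b / r; b / r, a / r] ∈ Matrix.orthogonalGroup (Fin 2) ℝ := by
  rw [Matrix.mem_orthogonalGroup_iff]
  ext i j
  fin_cases i <;> fin_cases j <;>
    simp [Matrix.mul_apply, Fin.sum_univ_two] <;> field_simp <;> linarith

namespace HolomorphicRep

variable {α : ℝ} {Ω Ω' : Set (ℝ × ℝ)} {g : ℝ × ℝ → ℝ × ℝ} {h : ℂ → ℂ}

theorem hasDerivAt (H : HolomorphicRep α Ω g h) (hα : 0 < α) (hΩ : IsOpen Ω) {q : ℝ × ℝ}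
    (hq : q ∈ Ω) : HasDerivAt h (deriv h (meyerson α q)) (meyerson α q) :=
  (H.differentiableOn.differentiableAt
    ((isOpen_meyerson_image hα hΩ).mem_nhds (mem_image_of_mem _ hq))).hasDerivAt

/-- If `g₁` vanishes on the axis, then `h'` is real on the axis. -/
theorem im_deriv_eq_zero (H : HolomorphicRep α Ω g h) (hα : 0 < α) (hΩ : IsOpen Ω) {q₀ : ℝ × ℝ}
    (hq₀ : q₀ ∈ Ω) (hx : q₀.1 = 0) (hz : ∀ᶠ q in 𝓝 q₀, q.1 = 0 → (g q).1 = 0) :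
    (deriv h (meyerson α q₀)).im = 0 := by
  have hc : Continuous fun t : ℝ => (q₀.1, q₀.2 + t) := by fun_prop
  have ht : Tendsto (fun t : ℝ => (q₀.1, q₀.2 + t)) (𝓝 0) (𝓝 q₀) := by
    have := hc.tendsto 0
    simpa using this
  have hm : ∀ t : ℝ, meyerson α (q₀.1, q₀.2 + t) = meyerson α q₀ + Complex.I * t := fun t => by
    rw [meyerson_eq, meyerson_eq]
    push_cast
    ring
  -- Along the axis `Re h` vanishes, while its derivative in that direction is `Re(i h') = -Im h'`.
  have h1 : HasDerivAt (fun t : ℝ => h (meyerson α q₀ + Complex.I * t))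
      (deriv h (meyerson α q₀) * Complex.I) 0 := by
    have hcurve : HasDerivAt (fun t : ℝ => meyerson α q₀ + Complex.I * t) Complex.I 0 := by
      have := ((Complex.ofRealCLM.hasDerivAt (x := (0 : ℝ))).const_mul Complex.I).const_add
        (meyerson α q₀)
      simpa using this
    have hd := H.hasDerivAt hα hΩ hq₀
    have e : meyerson α q₀ = meyerson α q₀ + Complex.I * ((0 : ℝ) : ℂ) := by simp
    rw [e] at hd
    have := hd.comp (0 : ℝ) hcurve
    rw [← e] at this
    exact this
  have h2 : HasDerivAt (fun t : ℝ => (h (meyerson α q₀ + Complex.I * t)).re)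
      (deriv h (meyerson α q₀) * Complex.I).re 0 :=
    Complex.reCLM.hasFDerivAt.comp_hasDerivAt (0 : ℝ) h1
  have h3 : HasDerivAt (fun t : ℝ => (h (meyerson α q₀ + Complex.I * t)).re) 0 0 := by
    refine (hasDerivAt_const (0 : ℝ) (0 : ℝ)).congr_of_eventuallyEq ?_
    filter_upwards [ht.eventually hz, ht.eventually (hΩ.mem_nhds hq₀)] with t h1 h2
    rw [← hm, H.re_eq_zero_iff hα h2]
    exact h1 hx
  have := h2.unique h3
  simpa using this

/-- Each point is compared with its projection `(0, y)`, where `Re h = 0`; in Meyerson coordinates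
the two differ by the real number `signedPow α x`. Strict differentiability is needed: it makes the
error small relative to this difference, and not merely to the distance from `q₀`. -/
theorem tendsto_signedPow_div (H : HolomorphicRep α Ω g h) (hα : 0 < α) (hΩ : IsOpen Ω)
    {q₀ : ℝ × ℝ} (hq₀ : q₀ ∈ Ω) (hx : q₀.1 = 0)
    (hz : ∀ᶠ q in 𝓝 q₀, q.1 = 0 → (g q).1 = 0) :
    Tendsto (fun q => signedPow α (g q).1 / signedPow α q.1) (𝓝[{q | q.1 ≠ 0}] q₀)
      (𝓝 (deriv h (meyerson α q₀)).re) := by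
  have hmc : Continuous (meyerson α) := (meyersonHomeo hα).continuous
  have hs : HasStrictDerivAt h (deriv h (meyerson α q₀)) (meyerson α q₀) :=
    (H.differentiableOn.analyticAt ((isOpen_meyerson_image hα hΩ).mem_nhds
      (mem_image_of_mem _ hq₀))).hasStrictDerivAt
  have hc : Continuous fun q : ℝ × ℝ => ((0 : ℝ), q.2) := by fun_prop
  have hp : Tendsto (fun q : ℝ × ℝ => ((0 : ℝ), q.2)) (𝓝 q₀) (𝓝 q₀) := by
    have := hc.tendsto q₀
    have e : ((0 : ℝ), q₀.2) = q₀ := Prod.ext hx.symm rfl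
    rwa [e] at this
  have ht : Tendsto (fun q : ℝ × ℝ => (meyerson α q, meyerson α (0, q.2))) (𝓝 q₀)
      (𝓝 (meyerson α q₀, meyerson α q₀)) :=
    (hmc.tendsto q₀).prodMk_nhds ((hmc.tendsto q₀).comp hp)
  have ho := hs.isLittleO.comp_tendsto ht
  have hdiff : ∀ q : ℝ × ℝ, meyerson α q - meyerson α (0, q.2) = (signedPow α q.1 : ℂ) :=
    fun q => by
      rw [meyerson_eq, meyerson_eq]
      simp [signedPow_zero]
  rw [Metric.tendsto_nhds]
  intro ε hε
  have hb := (ho.def (half_pos hε)).filter_mono (nhdsWithin_le_nhds (s := {q | q.1 ≠ 0}))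
  have hΩ' : ∀ᶠ q in 𝓝[{q | q.1 ≠ 0}] q₀, q ∈ Ω := mem_nhdsWithin_of_mem_nhds (hΩ.mem_nhds hq₀)
  have hΩ0 : ∀ᶠ q in 𝓝[{q : ℝ × ℝ | q.1 ≠ 0}] q₀, ((0 : ℝ), q.2) ∈ Ω :=
    (hp.eventually (hΩ.mem_nhds hq₀)).filter_mono nhdsWithin_le_nhds
  have hz0 : ∀ᶠ q in 𝓝[{q : ℝ × ℝ | q.1 ≠ 0}] q₀, (g ((0 : ℝ), q.2)).1 = 0 :=
    ((hp.eventually hz).filter_mono nhdsWithin_le_nhds).mono fun q hq => hq rfl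
  filter_upwards [hb, hΩ', hΩ0, hz0, self_mem_nhdsWithin] with q hbq hqΩ hq0Ω hgq hq
  have hs0 : signedPow α q.1 ≠ 0 := fun hcon => hq ((signedPow_eq_zero hα).1 hcon)
  have hre : (h (meyerson α q) - h (meyerson α (0, q.2)) -
      (meyerson α q - meyerson α (0, q.2)) * deriv h (meyerson α q₀)).re =
      signedPow α (g q).1 - signedPow α q.1 * (deriv h (meyerson α q₀)).re := by
    rw [hdiff, Complex.sub_re, Complex.sub_re, H.re_apply hqΩ, (H.re_eq_zero_iff hα hq0Ω).2 hgq,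
      Complex.re_ofReal_mul, sub_zero]
  have hle : |signedPow α (g q).1 - signedPow α q.1 * (deriv h (meyerson α q₀)).re| ≤
      ε / 2 * |signedPow α q.1| := by
    rw [← hre]
    refine (Complex.abs_re_le_norm _).trans ?_
    have := hbq
    simp only [Function.comp_apply] at this
    rwa [hdiff, Complex.norm_real, ← hdiff] at this
  rw [Real.dist_eq]
  have e : signedPow α (g q).1 / signedPow α q.1 - (deriv h (meyerson α q₀)).re =
      (signedPow α (g q).1 - signedPow α q.1 * (deriv h (meyerson α q₀)).re) / signedPow α q.1 := by
    field_simp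
  rw [e, abs_div, div_lt_iff₀ (abs_pos.2 hs0)]
  have := abs_pos.2 hs0
  nlinarith

/-- The ratio is the power `-α/(α+1)` of the quotient of signed powers. The limit of that quotient
is nonzero because `h'` is real on the axis and has no zeros. -/
theorem tendsto_weight_ratio (H : HolomorphicRep α Ω g h) (hα : 0 < α) (hΩ : IsOpen Ω)
    {q₀ : ℝ × ℝ} (hq₀ : q₀ ∈ Ω) (hx : q₀.1 = 0)
    (hz : ∀ᶠ q in 𝓝 q₀, q.1 = 0 → (g q).1 = 0) :
    Tendsto (fun q => |q.1| ^ α / |(g q).1| ^ α) (𝓝[{q | q.1 ≠ 0}] q₀)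
      (𝓝 (|(deriv h (meyerson α q₀)).re| ^ (-(α / (α + 1))))) := by
  have hre : (deriv h (meyerson α q₀)).re ≠ 0 := fun hcon =>
    H.deriv_ne_zero q₀ hq₀ (Complex.ext hcon (H.im_deriv_eq_zero hα hΩ hq₀ hx hz))
  have h1 := (H.tendsto_signedPow_div hα hΩ hq₀ hx hz).abs
  refine (h1.rpow_const (p := -(α / (α + 1))) (Or.inl (abs_ne_zero.2 hre))).congr fun q => ?_
  have hα1 : α + 1 ≠ 0 := by positivity
  rw [abs_div, abs_signedPow hα, abs_signedPow hα, div_div_div_cancel_right₀ hα1,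
    ← Real.div_rpow (abs_nonneg _) (abs_nonneg _), ← Real.rpow_mul (by positivity),
    ← Real.div_rpow (abs_nonneg _) (abs_nonneg _)]
  have e : (α + 1) * -(α / (α + 1)) = -α := by field_simp
  rw [e, Real.rpow_neg (by positivity), ← Real.inv_rpow (by positivity), inv_div]

theorem volume_singularSet_eq_zero
    (hset : {q ∈ Ω | (g q).1 = 0} = Ω ∩ yAxis) : volume (singularSet Ω g) = 0 := by
  refine measure_mono_null (singularSet_subset.trans (union_subset Subset.rfl ?_)) volume_yAxis
  rw [hset]
  exact inter_subset_right

/-- Multiplied by `|g₁|^α`, the Jacobian becomes `|x|^(2α) |h'|²`, which is positive off the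
singular set. -/
theorem orientationPreserving (H : HolomorphicRep α Ω g h) (hΩ : IsOpen Ω)
    (hg : HWloc α 1 Ω Ω' g) (hset : {q ∈ Ω | (g q).1 = 0} = Ω ∩ yAxis) :
    OrientationPreserving α Ω Ω' g := by
  refine ⟨hg, ?_⟩
  have hn : ∀ᵐ q ∂(volume.restrict Ω), q ∉ singularSet Ω g :=
    ae_restrict_of_ae (measure_eq_zero_iff_ae_notMem.1 (volume_singularSet_eq_zero hset))
  filter_upwards [H.ae_eq, hn, ae_restrict_mem hΩ.measurableSet] with q ⟨e1, e2, e3, e4⟩ hq hqΩ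
  have hg1 : (g q).1 ≠ 0 := fun hcon => hq ⟨hqΩ, Or.inr hcon⟩
  have hq1 : q.1 ≠ 0 := fun hcon => hq ⟨hqΩ, Or.inl hcon⟩
  have hw : 0 < |(g q).1| ^ α := by positivity
  have hx : 0 < |q.1| ^ α := by positivity
  have hd : 0 < ‖deriv h (meyerson α q)‖ ^ 2 := by
    have := norm_pos_iff.2 (H.deriv_ne_zero q hqΩ)
    positivity
  rw [norm_sq_eq_re_im] at hd
  rw [horizontalD, Matrix.det_fin_two_of]
  refine (mul_pos_iff_of_pos_left hw).1 ?_
  rw [mul_sub, ← mul_assoc, ← mul_assoc, e1, e2, e3, e4]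
  have : 0 < (|q.1| ^ α) ^ 2 *
      ((deriv h (meyerson α q)).re ^ 2 + (deriv h (meyerson α q)).im ^ 2) := by positivity
  linarith

/-- On the regular set `D_α g` is a.e. the matrix of `h'` times a positive ratio, a scaled rotation.
Equality of the zero sets puts every singular point on the axis, where the ratio has a positive
limit and `h'` is continuous and nonzero. -/
theorem conformal (H : HolomorphicRep α Ω g h) (hα : 0 < α) (hΩ : IsOpen Ω)
    (hg : HWloc α 2 Ω Ω' g) (hhomeo : IsHomeo Ω Ω' g)
    (hset : {q ∈ Ω | (g q).1 = 0} = Ω ∩ yAxis) : Conformal α Ω Ω' g := by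
  have hS := volume_singularSet_eq_zero hset
  have hz : ∀ q ∈ Ω, (g q).1 = 0 ↔ q.1 = 0 := fun q hq => by
    have := Set.ext_iff.1 hset q
    simpa [hq, yAxis] using this
  have hR : regularSet Ω g ⊆ {q | q.1 ≠ 0} := fun q hq hcon => hq.2 ⟨hq.1, Or.inl hcon⟩
  have hae := H.grushinD_ae_eq
  rw [ae_restrict_iff' hΩ.measurableSet] at hae
  refine ⟨hg, hhomeo, ?_, fun q₀ hq₀ => ?_⟩
  · have e : volume.restrict (regularSet Ω g) = volume.restrict Ω :=
      Measure.restrict_congr_set (sdiff_null_ae_eq_self hS)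
    rw [e]
    have hn : ∀ᵐ q ∂(volume.restrict Ω), q ∉ singularSet Ω g :=
      ae_restrict_of_ae (measure_eq_zero_iff_ae_notMem.1 hS)
    filter_upwards [H.grushinD_ae_eq, hn, ae_restrict_mem hΩ.measurableSet] with q hD hq hqΩ
    have hg1 : (g q).1 ≠ 0 := fun hcon => hq ⟨hqΩ, Or.inr hcon⟩
    have hq1 : q.1 ≠ 0 := fun hcon => hq ⟨hqΩ, Or.inl hcon⟩
    have hn := norm_pos_iff.2 (H.deriv_ne_zero q hqΩ)
    refine ⟨|q.1| ^ α / |(g q).1| ^ α * ‖deriv h (meyerson α q)‖, by positivity, _,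
      rotation_mem_orthogonalGroup hn (norm_sq_eq_re_im _), ?_⟩
    rw [hD ⟨hqΩ, hq⟩, mul_smul]
    congr 1
    ext i j
    fin_cases i <;> fin_cases j <;> simp <;> field_simp
  · have hq₀Ω : q₀ ∈ Ω := hq₀.1
    have hx : q₀.1 = 0 := hq₀.2.elim id (hz q₀ hq₀Ω).1
    have hzev : ∀ᶠ q in 𝓝 q₀, q.1 = 0 → (g q).1 = 0 := by
      filter_upwards [hΩ.mem_nhds hq₀Ω] with q hq h
      exact (hz q hq).2 h
    have hre : (deriv h (meyerson α q₀)).re ≠ 0 := fun hcon =>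
      H.deriv_ne_zero q₀ hq₀Ω (Complex.ext hcon (H.im_deriv_eq_zero hα hΩ hq₀Ω hx hzev))
    set M : ℂ → Matrix (Fin 2) (Fin 2) ℝ := fun z => !![z.re, -z.im; z.im, z.re] with hM
    have hMc : Continuous M := by
      refine continuous_matrix fun i j => ?_
      fin_cases i <;> fin_cases j
      · exact Complex.continuous_re
      · exact Complex.continuous_im.neg
      · exact Complex.continuous_im
      · exact Complex.continuous_re
    refine ⟨|(deriv h (meyerson α q₀)).re| ^ (-(α / (α + 1))) • M (deriv h (meyerson α q₀)),
      fun hcon => ?_, ?_⟩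
    · have h00 := congrFun (congrFun hcon 0) 0
      have : |(deriv h (meyerson α q₀)).re| ^ (-(α / (α + 1))) * (deriv h (meyerson α q₀)).re = 0 :=
        h00
      exact (mul_ne_zero (by positivity) hre) this
    · have ht1 := (H.tendsto_weight_ratio hα hΩ hq₀Ω hx hzev).mono_left
        ((inf_le_left (b := ae volume)).trans (nhdsWithin_mono q₀ hR))
      have hdc : ContinuousAt (fun q => deriv h (meyerson α q)) q₀ :=
        (H.continuousOn_deriv hα hΩ).continuousAt (hΩ.mem_nhds hq₀Ω)
      have ht2 : Tendsto (fun q => M (deriv h (meyerson α q))) (𝓝[regularSet Ω g] q₀ ⊓ ae volume)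
          (𝓝 (M (deriv h (meyerson α q₀)))) :=
        ((hMc.tendsto _).comp hdc).mono_left (inf_le_left.trans nhdsWithin_le_nhds)
      refine (ht1.smul ht2).congr' ?_
      have hRm : ∀ᶠ q in 𝓝[regularSet Ω g] q₀, q ∈ regularSet Ω g := self_mem_nhdsWithin
      filter_upwards [hRm.filter_mono inf_le_left, hae.filter_mono inf_le_right] with q hq hD
      exact (hD hq.1 hq).symm

end HolomorphicRep

/-! ### Conformal maps preserve the axis -/

/-- Essential limits along the regular set are unique only if this filter is nontrivial. It is,
because nonempty open sets have positive measure and the singular set is null. -/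
theorem neBot_nhdsWithin_inf_ae {Ω : Set (ℝ × ℝ)} (hΩ : IsOpen Ω) {g : ℝ × ℝ → ℝ × ℝ}
    (hS : volume (singularSet Ω g) = 0) {q₀ : ℝ × ℝ} (hq₀ : q₀ ∈ Ω) :
    (𝓝[regularSet Ω g] q₀ ⊓ ae volume).NeBot := by
  rw [inf_neBot_iff]
  intro s hs t ht
  obtain ⟨U, hU, hsub⟩ := mem_nhdsWithin_iff_exists_mem_nhds_inter.1 hs
  obtain ⟨V, hVsub, hVo, hqV⟩ := mem_nhds_iff.1 (inter_mem hU (hΩ.mem_nhds hq₀))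
  have hpos : 0 < volume V := hVo.measure_pos volume ⟨q₀, hqV⟩
  by_contra hcon
  have hVs : V ⊆ singularSet Ω g ∪ tᶜ := fun q hq => by
    by_contra hq'
    rw [mem_union, not_or, mem_compl_iff, not_not] at hq'
    exact hcon ⟨q, hsub ⟨(hVsub hq).1, (hVsub hq).2, hq'.1⟩, hq'.2⟩
  exact hpos.ne' (measure_mono_null hVs (measure_union_null hS (mem_ae_iff.1 ht)))

/-- For a conformal map, the conformal factor has a finite positive limit at the singular
points. -/
theorem HolomorphicRep.exists_tendsto_ratio {α : ℝ} {Ω Ω' : Set (ℝ × ℝ)} {g : ℝ × ℝ → ℝ × ℝ}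
    {h : ℂ → ℂ} (H : HolomorphicRep α Ω g h) (hα : 0 < α) (hΩ : IsOpen Ω)
    (hc : Conformal α Ω Ω' g) (hS : volume (singularSet Ω g) = 0) {q₀ : ℝ × ℝ}
    (hq₀ : q₀ ∈ singularSet Ω g) : ∃ m : ℝ, 0 < m ∧
      Tendsto (fun q => (|q.1| ^ α / |(g q).1| ^ α) ^ 2) (𝓝[regularSet Ω g] q₀ ⊓ ae volume)
        (𝓝 m) := by
  obtain ⟨L, hL0, hL⟩ := hc.2.2.2 q₀ hq₀
  have hne := neBot_nhdsWithin_inf_ae hΩ hS hq₀.1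
  have hae := H.grushinD_ae_eq
  rw [ae_restrict_iff' hΩ.measurableSet] at hae
  set l := 𝓝[regularSet Ω g] q₀ ⊓ ae volume with hl
  have hRm : ∀ᶠ q in 𝓝[regularSet Ω g] q₀, q ∈ regularSet Ω g := self_mem_nhdsWithin
  have hD : ∀ᶠ q in l, grushinD α Ω g q = (|q.1| ^ α / |(g q).1| ^ α) •
        !![(deriv h (meyerson α q)).re, -(deriv h (meyerson α q)).im;
           (deriv h (meyerson α q)).im, (deriv h (meyerson α q)).re] := by
    filter_upwards [hRm.filter_mono inf_le_left, hae.filter_mono inf_le_right] with q hq hD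
    exact hD hq.1 hq
  have hent : ∀ i j, Tendsto (fun q => grushinD α Ω g q i j) l (𝓝 (L i j)) := fun i j =>
    ((continuous_apply_apply i j).tendsto L).comp hL
  have e00 : ∀ᶠ q in l, grushinD α Ω g q 0 0 =
      |q.1| ^ α / |(g q).1| ^ α * (deriv h (meyerson α q)).re := by
    filter_upwards [hD] with q hq
    rw [hq]; rfl
  have e01 : ∀ᶠ q in l, grushinD α Ω g q 0 1 =
      |q.1| ^ α / |(g q).1| ^ α * -(deriv h (meyerson α q)).im := by
    filter_upwards [hD] with q hq
    rw [hq]; rfl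
  have e10 : ∀ᶠ q in l, grushinD α Ω g q 1 0 =
      |q.1| ^ α / |(g q).1| ^ α * (deriv h (meyerson α q)).im := by
    filter_upwards [hD] with q hq
    rw [hq]; rfl
  have e11 : ∀ᶠ q in l, grushinD α Ω g q 1 1 =
      |q.1| ^ α / |(g q).1| ^ α * (deriv h (meyerson α q)).re := by
    filter_upwards [hD] with q hq
    rw [hq]; rfl
  have s1 : L 0 0 = L 1 1 := tendsto_nhds_unique (hent 0 0) ((hent 1 1).congr' (by
    filter_upwards [e00, e11] with q h1 h2
    rw [h1, h2]))
  have s2 : L 0 1 = -L 1 0 := tendsto_nhds_unique (hent 0 1) ((hent 1 0).neg.congr' (by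
    filter_upwards [e01, e10] with q h1 h2
    rw [h1, h2, mul_neg]))
  -- The limit inherits the shape of a scaled rotation, so it is determined by its first column and
  -- `L ≠ 0` makes that column nonzero. The squared ratio is the squared norm of the first column of
  -- `D_α g` divided by `|h'|²`.
  have hpos : 0 < L 0 0 ^ 2 + L 1 0 ^ 2 := by
    rcases eq_or_ne (L 0 0) 0 with h0 | h0
    · rcases eq_or_ne (L 1 0) 0 with h1 | h1
      · have h01 : L 0 1 = 0 := by rw [s2, h1, neg_zero]
        refine absurd (Matrix.ext fun i j => ?_) hL0
        fin_cases i <;> fin_cases j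
        · exact h0
        · exact h01
        · exact h1
        · exact s1.symm.trans h0
      · positivity
    · positivity
  have hdc : ContinuousAt (fun q => deriv h (meyerson α q)) q₀ :=
    (H.continuousOn_deriv hα hΩ).continuousAt (hΩ.mem_nhds hq₀.1)
  have hd : Tendsto (fun q => ‖deriv h (meyerson α q)‖ ^ 2) l
      (𝓝 (‖deriv h (meyerson α q₀)‖ ^ 2)) :=
    (hdc.norm.pow 2).tendsto.mono_left (inf_le_left.trans nhdsWithin_le_nhds)
  have hd0 : ‖deriv h (meyerson α q₀)‖ ^ 2 ≠ 0 :=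
    pow_ne_zero 2 (norm_ne_zero_iff.2 (H.deriv_ne_zero q₀ hq₀.1))
  refine ⟨(L 0 0 ^ 2 + L 1 0 ^ 2) / ‖deriv h (meyerson α q₀)‖ ^ 2, by positivity, ?_⟩
  refine ((((hent 0 0).pow 2).add ((hent 1 0).pow 2)).div hd hd0).congr' ?_
  filter_upwards [e00, e10, hd.eventually_ne hd0] with q h1 h2 h3
  rw [Pi.div_apply, h1, h2, div_eq_iff h3, norm_sq_eq_re_im]
  ring

/-- A conformal map preserves the singular axis. -/
theorem HolomorphicRep.zeroSet_eq {α : ℝ} {Ω Ω' : Set (ℝ × ℝ)} {g : ℝ × ℝ → ℝ × ℝ}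
    {h : ℂ → ℂ} (H : HolomorphicRep α Ω g h) (hα : 0 < α) (hΩ : IsOpen Ω)
    (hc : Conformal α Ω Ω' g) (hS : volume (singularSet Ω g) = 0) :
    {q ∈ Ω | (g q).1 = 0} = Ω ∩ yAxis := by
  have hgc := hc.2.1.continuousOn
  have hw : ∀ q₀ ∈ Ω, Tendsto (fun q : ℝ × ℝ => |q.1| ^ α) (𝓝[regularSet Ω g] q₀ ⊓ ae volume)
      (𝓝 (|q₀.1| ^ α)) := fun q₀ _ =>
    ((continuous_weight hα).tendsto q₀).mono_left (inf_le_left.trans nhdsWithin_le_nhds)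
  have hwg : ∀ q₀ ∈ Ω, Tendsto (fun q : ℝ × ℝ => |(g q).1| ^ α)
      (𝓝[regularSet Ω g] q₀ ⊓ ae volume) (𝓝 (|(g q₀).1| ^ α)) := fun q₀ hq₀ =>
    (((continuous_weight hα).tendsto (g q₀)).comp
      (hgc.continuousAt (hΩ.mem_nhds hq₀))).mono_left (inf_le_left.trans nhdsWithin_le_nhds)
  ext q₀
  constructor
  · rintro ⟨hq₀, hg0⟩
    refine ⟨hq₀, by_contra fun hx => ?_⟩
    have hx : q₀.1 ≠ 0 := hx
    have := neBot_nhdsWithin_inf_ae hΩ hS hq₀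
    obtain ⟨m, hm, ht⟩ := H.exists_tendsto_ratio hα hΩ hc hS ⟨hq₀, Or.inr hg0⟩
    -- At a zero of `g₁` off the axis the inverse ratio tends to 0, contradicting the finite limit
    -- `m`; in the other inclusion the ratio itself tends to 0, contradicting `m > 0`.
    have h1 := ht.inv₀ hm.ne'
    have h2 := ((hwg q₀ hq₀).div (hw q₀ hq₀) (by positivity)).pow 2
    rw [hg0, abs_zero, Real.zero_rpow hα.ne', zero_div] at h2
    have := tendsto_nhds_unique h1 (h2.congr fun q => by
      rw [← inv_pow, inv_div, Pi.div_apply])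
    simp [hm.ne'] at this
  · rintro ⟨hq₀, hx⟩
    refine ⟨hq₀, by_contra fun hg0 => ?_⟩
    have hx : q₀.1 = 0 := hx
    have := neBot_nhdsWithin_inf_ae hΩ hS hq₀
    obtain ⟨m, hm, ht⟩ := H.exists_tendsto_ratio hα hΩ hc hS ⟨hq₀, Or.inl hx⟩
    have h2 := ((hw q₀ hq₀).div (hwg q₀ hq₀) (by positivity)).pow 2
    rw [hx, abs_zero, Real.zero_rpow hα.ne', zero_div] at h2
    have := tendsto_nhds_unique ht h2
    simp [hm.ne'] at this

/-! ### The critical exponent and zeros off the axis -/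

/-- Radial integration in dimension two reduces the question to `∫ y⁻² y dy = ∫ y⁻¹ dy` near 0,
which diverges. -/
theorem not_integrableOn_inv_norm_sq (q₀ : ℝ × ℝ) {r : ℝ} (hr : 0 < r) :
    ¬ IntegrableOn (fun q : ℝ × ℝ => (‖q - q₀‖ ^ 2)⁻¹) (Metric.ball q₀ r) := by
  intro hcon
  have h1 : IntegrableOn (fun q : ℝ × ℝ => (‖q‖ ^ 2)⁻¹) (Metric.ball (0 : ℝ × ℝ) r) := by
    have := (measurePreserving_add_right (volume : Measure (ℝ × ℝ)) q₀).integrableOn_comp_preimage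
      (measurableEmbedding_addRight q₀) (f := fun q => (‖q - q₀‖ ^ 2)⁻¹) (s := Metric.ball q₀ r)
    have h2 := this.2 hcon
    have e : (fun q => q + q₀) ⁻¹' Metric.ball q₀ r = Metric.ball (0 : ℝ × ℝ) r := by
      ext q
      simp [Metric.mem_ball, dist_eq_norm]
    rw [e] at h2
    simpa [Function.comp_def] using h2
  have h2 := (integrableOn_fun_norm_addHaar (volume : Measure (ℝ × ℝ))
    (f := fun y : ℝ => (y ^ 2)⁻¹)).1 h1
  have h3 : IntegrableOn (fun y : ℝ => y ^ (-1 : ℝ)) (Ioo 0 r) := by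
    refine h2.congr_fun (fun y hy => ?_) measurableSet_Ioo
    have : y ≠ 0 := hy.1.ne'
    simp only [Module.finrank_prod, Module.finrank_self, smul_eq_mul]
    rw [Real.rpow_neg_one]
    field_simp
    norm_num
  rw [intervalIntegral.integrableOn_Ioo_rpow_iff hr] at h3
  exact lt_irrefl _ h3

/-- The integrability exponent forces the zeros of `g₁` to lie on the axis. -/
theorem HolomorphicRep.fst_eq_zero {α : ℝ} {Ω : Set (ℝ × ℝ)} {g : ℝ × ℝ → ℝ × ℝ} {h : ℂ → ℂ}
    (H : HolomorphicRep α Ω g h) (hα : 0 < α) (hΩ : IsOpen Ω)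
    (h₁ : LocalSobolev α (ENNReal.ofReal (2 * (α + 1) / α)) Ω (fun q => (g q).1))
    {q₀ : ℝ × ℝ} (hq₀ : q₀ ∈ Ω) (hg0 : (g q₀).1 = 0) : q₀.1 = 0 := by
  by_contra hx
  -- Chosen so that `α s = 2(α+1)`. Off the axis `W > 0`, and `W` is `|g₁|^α` times the length of
  -- the horizontal gradient of `g₁`; hence `|g₁|^α |∇g₁|` stays above `δ` near `q₀`, while
  -- `|g₁|^(α+1)` is at most linear in the distance.
  set s : ℝ := 2 * (α + 1) / α with hs
  have hs0 : 0 < s := by positivity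
  set W : ℝ × ℝ → ℝ := fun q => |q.1| ^ α * ‖deriv h (meyerson α q)‖ with hW
  have hW0 : 0 < W q₀ := by
    have := norm_pos_iff.2 (H.deriv_ne_zero q₀ hq₀)
    positivity
  have hWc : ContinuousAt W q₀ := (continuous_weight hα).continuousAt.mul
    ((H.continuousOn_deriv hα hΩ).continuousAt (hΩ.mem_nhds hq₀)).norm
  set δ := W q₀ / 2 with hδ
  have hδ0 : 0 < δ := by positivity
  have hd : HasFDerivAt (fun q => (h (meyerson α q)).re)
      (Complex.reCLM.comp (((ContinuousLinearMap.toSpanSingleton ℂ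
        (deriv h (meyerson α q₀))).restrictScalars ℝ).comp (meyersonDeriv α q₀))) q₀ :=
    Complex.reCLM.hasFDerivAt.comp q₀
      (((H.hasDerivAt hα hΩ hq₀).hasFDerivAt.restrictScalars ℝ).comp q₀
        (hasFDerivAt_meyerson hα q₀))
  obtain ⟨C, hC, hO⟩ := hd.isBigO_sub.exists_pos
  rw [Asymptotics.isBigOWith_iff] at hO
  obtain ⟨r, hr, hball⟩ := Metric.nhds_basis_closedBall.eventually_iff.1
    (((hO.and (hWc.eventually (lt_mem_nhds (half_lt_self hW0)))).and (hΩ.mem_nhds hq₀)))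
  have hsub : Metric.closedBall q₀ r ⊆ Ω := fun q hq => (hball hq).2
  have hKc : IsCompact (Metric.closedBall q₀ r) := isCompact_closedBall _ _
  have hN := (h₁.memLp_x _ hsub hKc).norm.add (h₁.memLp_y _ hsub hKc).norm
  have hNi := hN.integrable_norm_rpow (by simpa using hs0) ENNReal.ofReal_ne_top
  rw [ENNReal.toReal_ofReal hs0.le] at hNi
  have hint := (hNi.const_mul (((α + 1) * C) ^ 2 / δ ^ s)).mono_measure
    (Measure.restrict_mono Metric.ball_subset_closedBall le_rfl)
  refine not_integrableOn_inv_norm_sq q₀ hr (Integrable.mono' hint ?_ ?_)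
  · exact ((measurable_id.sub_const q₀).norm.pow_const 2).inv.aestronglyMeasurable
  filter_upwards [ae_restrict_of_ae_restrict_of_subset
    (Metric.ball_subset_closedBall.trans hsub) H.ae_eq, ae_restrict_mem measurableSet_ball]
    with q ⟨e1, e2, _, _⟩ hq
  obtain ⟨⟨hOq, hWq⟩, hqΩ⟩ := hball (Metric.ball_subset_closedBall hq)
  rw [Real.norm_of_nonneg (by positivity)]
  simp only [Pi.add_apply]
  set A := weakPartial Ω (1, 0) (fun q => (g q).1) q with hA
  set B := |q.1| ^ α * weakPartial Ω (0, 1) (fun q => (g q).1) q with hB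
  change |(g q).1| ^ α * A = _ at e1
  change |(g q).1| ^ α * B = _ at e2
  rw [Real.norm_of_nonneg (add_nonneg (norm_nonneg A) (norm_nonneg B)), Real.norm_eq_abs,
    Real.norm_eq_abs]
  have hN0 : 0 ≤ |A| + |B| := by positivity
  have hle : δ ≤ |(g q).1| ^ α * (|A| + |B|) := by
    refine hWq.le.trans (abs_le_of_sq_le_sq' ?_ (by positivity)).2
    have e : W q ^ 2 = (|(g q).1| ^ α) ^ 2 * (A ^ 2 + B ^ 2) := by
      rw [hW]
      simp only
      rw [mul_pow, norm_sq_eq_re_im]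
      linear_combination -(|(g q).1| ^ α * A + |q.1| ^ α * (deriv h (meyerson α q)).re) * e1 -
        (|(g q).1| ^ α * B - |q.1| ^ α * (deriv h (meyerson α q)).im) * e2
    have h2 : A ^ 2 + B ^ 2 ≤ (|A| + |B|) ^ 2 := by
      rw [add_sq, sq_abs, sq_abs]
      have : 0 ≤ 2 * |A| * |B| := by positivity
      linarith
    rw [e, mul_pow (|(g q).1| ^ α)]
    exact mul_le_mul_of_nonneg_left h2 (sq_nonneg _)
  have hsp : |signedPow α (g q).1| ≤ C * ‖q - q₀‖ := by
    have := hOq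
    rwa [(H.re_eq_zero_iff hα hq₀).2 hg0, sub_zero, H.re_apply hqΩ, Real.norm_eq_abs] at this
  -- The left side is `|g₁|^(2(α+1))`, the square of `(α+1)|signedPow α g₁|`, so the linear bound on
  -- `Re h` becomes quadratic.
  have hpow : (|(g q).1| ^ α) ^ s ≤ ((α + 1) * C) ^ 2 * ‖q - q₀‖ ^ 2 := by
    have e : (|(g q).1| ^ α) ^ s = ((α + 1) * |signedPow α (g q).1|) ^ 2 := by
      rw [abs_signedPow hα, mul_div_cancel₀ _ (by positivity : α + 1 ≠ 0),
        ← Real.rpow_mul (abs_nonneg _), ← Real.rpow_mul_natCast (abs_nonneg _)]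
      congr 1
      rw [hs]
      field_simp
      push_cast
      ring
    rw [e, ← mul_pow, mul_assoc]
    gcongr
  have hfin : δ ^ s ≤ ((α + 1) * C) ^ 2 * ‖q - q₀‖ ^ 2 * (|A| + |B|) ^ s := by
    calc δ ^ s ≤ (|(g q).1| ^ α * (|A| + |B|)) ^ s := Real.rpow_le_rpow hδ0.le hle hs0.le
      _ = (|(g q).1| ^ α) ^ s * (|A| + |B|) ^ s := Real.mul_rpow (by positivity) hN0
      _ ≤ _ := mul_le_mul_of_nonneg_right hpow (by positivity)
  -- At `q = q₀` the inverse is 0 by convention and the bound is trivial.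
  rcases eq_or_lt_of_le (sq_nonneg ‖q - q₀‖) with h0 | h0
  · rw [← h0, inv_zero]; positivity
  · have hδs : 0 < δ ^ s := by positivity
    rw [inv_le_iff_one_le_mul₀ h0, div_mul_eq_mul_div, div_mul_eq_mul_div, one_le_div hδs]
    linarith

/-! ### Counting connected components -/

section Components

variable {S T : Type*} [TopologicalSpace S] [TopologicalSpace T]

theorem card_connectedComponents_congr (e : S ≃ₜ T) :
    ENat.card (ConnectedComponents S) = ENat.card (ConnectedComponents T) := by
  refine ENat.card_congr (e.isQuotientMap.isCoinducing.connectedComponentsHomeomorph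
    fun y => ?_).toEquiv
  have : (e ⁻¹' {y} : Set S) = {e.symm y} := by
    ext x
    simp [e.eq_symm_apply]
  rw [this]
  exact isConnected_singleton

/-- A component of `S` meeting the clopen set lies inside it, so it stays connected in the subspace.
-/
theorem injective_connectedComponentsMap_of_isClopen {Z : Set S} (hZ : IsClopen Z) :
    Function.Injective
      (continuous_subtype_val (p := (· ∈ Z))).connectedComponentsMap := by
  refine ConnectedComponents.surjective_coe.forall₂.2 fun x y hxy => ?_
  have hxy' : (ConnectedComponents.mk (x : S)) = ConnectedComponents.mk (y : S) := hxy
  rw [ConnectedComponents.coe_eq_coe'] at hxy'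
  have hsub : connectedComponent (y : S) ⊆ Z :=
    isPreconnected_connectedComponent.subset_isClopen hZ ⟨y, mem_connectedComponent, y.2⟩
  have hpre : IsPreconnected ((↑) ⁻¹' connectedComponent (y : S) : Set Z) := by
    rw [← IsInducing.subtypeVal.isPreconnected_image, Subtype.image_preimage_coe,
      inter_eq_right.2 hsub]
    exact isPreconnected_connectedComponent
  rw [ConnectedComponents.coe_eq_coe']
  exact hpre.subset_connectedComponent (x := y) mem_connectedComponent hxy'

/-- The injection on components is between finite sets of the same size, hence surjective. So every
component of `S` meets `Z`, and being connected lies in `Z`. -/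
theorem eq_univ_of_isClopen_of_card_eq {Z : Set S} (hZ : IsClopen Z)
    [Finite (ConnectedComponents S)]
    (hcard : ENat.card (ConnectedComponents Z) = ENat.card (ConnectedComponents S)) :
    Z = univ := by
  have hinj := injective_connectedComponentsMap_of_isClopen hZ
  have hfin : Finite (ConnectedComponents Z) := Finite.of_injective _ hinj
  rw [ENat.card_eq_coe_natCard, ENat.card_eq_coe_natCard, Nat.cast_inj] at hcard
  have hbij := hinj.bijective_of_nat_card_le hcard.ge
  refine eq_univ_of_forall fun a => ?_
  obtain ⟨c, hc⟩ := hbij.2 (ConnectedComponents.mk a)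
  obtain ⟨z, rfl⟩ := ConnectedComponents.surjective_coe c
  have hc' : (ConnectedComponents.mk (z : S)) = ConnectedComponents.mk a := hc
  rw [eq_comm, ConnectedComponents.coe_eq_coe'] at hc'
  exact isPreconnected_connectedComponent.subset_isClopen hZ ⟨z, mem_connectedComponent, z.2⟩ hc'

end Components

/-! ### Zeros on the axis form a clopen set -/

theorem exists_sign_of_ne_zero {E : Type*} [TopologicalSpace E] {s : Set E} (hs : IsPreconnected s)
    {u : E → ℝ} (hu : ContinuousOn u s) (h0 : ∀ q ∈ s, u q ≠ 0) :
    ∃ c : ℝ, (c = 1 ∨ c = -1) ∧ ∀ q ∈ s, 0 ≤ c * u q := by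
  by_cases h : ∀ q ∈ s, 0 ≤ u q
  · exact ⟨1, Or.inl rfl, fun q hq => by rw [one_mul]; exact h q hq⟩
  · push Not at h
    obtain ⟨a, ha, hua⟩ := h
    refine ⟨-1, Or.inr rfl, fun q hq => ?_⟩
    by_contra hcon
    have hq0 : 0 ≤ u q := by linarith
    obtain ⟨b, hb, hub⟩ := hs.intermediate_value ha hq hu ⟨hua.le, hq0⟩
    exact h0 b hb hub

theorem nonneg_on_yAxis_of_side {B : Set (ℝ × ℝ)} (hB : IsOpen B) {u : ℝ × ℝ → ℝ}
    (hu : ContinuousOn u B) {c ε : ℝ} (hε : ε ≠ 0)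
    (h : ∀ q ∈ B, 0 < ε * q.1 → 0 ≤ c * u q) {q : ℝ × ℝ} (hq : q ∈ B) (hx : q.1 = 0) :
    0 ≤ c * u q := by
  have hc : Continuous fun t : ℝ => (ε * t, q.2) := by fun_prop
  have ht : Tendsto (fun t : ℝ => (ε * t, q.2)) (𝓝[>] 0) (𝓝 q) := by
    have := hc.tendsto 0
    rw [mul_zero] at this
    have e : ((0 : ℝ), q.2) = q := Prod.ext hx.symm rfl
    rw [e] at this
    exact this.mono_left nhdsWithin_le_nhds
  have hlim := (((hu.continuousAt (hB.mem_nhds hq)).tendsto.comp ht).const_mul c)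
  refine ge_of_tendsto hlim ?_
  filter_upwards [ht.eventually (hB.mem_nhds hq), self_mem_nhdsWithin] with t htB ht0
  refine h _ htB ?_
  have : 0 < t := ht0
  have : 0 < ε ^ 2 := by positivity
  simp only
  nlinarith

/-- A zero of `g₁` on the axis has a neighbourhood in the axis consisting of zeros. -/
theorem HolomorphicRep.eventually_fst_eq_zero {α : ℝ} {Ω : Set (ℝ × ℝ)} {g : ℝ × ℝ → ℝ × ℝ}
    {h : ℂ → ℂ} (H : HolomorphicRep α Ω g h) (hα : 0 < α) (hΩ : IsOpen Ω)
    (hgc : ContinuousOn g Ω) (hz : ∀ q ∈ Ω, (g q).1 = 0 → q.1 = 0) {q₀ : ℝ × ℝ} (hq₀ : q₀ ∈ Ω)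
    (hg0 : (g q₀).1 = 0) : ∀ᶠ q in 𝓝 q₀, q.1 = 0 → (g q).1 = 0 := by
  obtain ⟨r, hr, hball⟩ := Metric.isOpen_iff.1 hΩ q₀ hq₀
  set B := Metric.ball q₀ r with hBdef
  have hBo : IsOpen B := Metric.isOpen_ball
  have huc : ContinuousOn (fun q => (g q).1) B :=
    continuous_fst.comp_continuousOn (hgc.mono hball)
  have side : ∀ ε : ℝ, ε ≠ 0 → ∃ c : ℝ, (c = 1 ∨ c = -1) ∧
      (∀ q ∈ B, 0 < ε * q.1 → 0 ≤ c * (g q).1) ∧ ∀ q ∈ B, q.1 = 0 → 0 ≤ c * (g q).1 := by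
    intro ε hε
    have hconv : Convex ℝ (B ∩ {q | 0 < ε * q.1}) := (convex_ball q₀ r).inter
      (convex_halfSpace_gt (f := fun q : ℝ × ℝ => ε * q.1)
        ⟨fun a b => by simp [mul_add], fun t a => by simp; ring⟩ 0)
    obtain ⟨c, hc, hcu⟩ := exists_sign_of_ne_zero hconv.isPreconnected
      (huc.mono inter_subset_left) fun q hq hcon => by
        have h1 := hz q (hball hq.1) hcon
        have h2 : 0 < ε * q.1 := hq.2
        rw [h1, mul_zero] at h2
        exact lt_irrefl _ h2
    have h1 : ∀ q ∈ B, 0 < ε * q.1 → 0 ≤ c * (g q).1 := fun q hq hqε => hcu q ⟨hq, hqε⟩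
    exact ⟨c, hc, h1, fun q hq hx => nonneg_on_yAxis_of_side hBo huc hε h1 hq hx⟩
  obtain ⟨c, hc, hc1, hc2⟩ := side 1 one_ne_zero
  obtain ⟨d, hd, hd1, hd2⟩ := side (-1) (by norm_num)
  -- If both sides had the same sign, `c Re h` would have a local minimum at the image of `q₀`. Its
  -- differential, evaluated at the conjugate of `h'`, is `c |h'|²`, which is nonzero.
  have hcd : c ≠ d := by
    rintro rfl
    have hc0 : c ≠ 0 := by rcases hc with rfl | rfl <;> norm_num
    have hnonneg : ∀ q ∈ B, 0 ≤ c * (h (meyerson α q)).re := fun q hq => by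
      have h1 : 0 ≤ c * (g q).1 := by
        rcases lt_trichotomy q.1 0 with hlt | heq | hgt
        · exact hd1 q hq (by linarith)
        · exact hc2 q hq heq
        · exact hc1 q hq (by linarith)
      rw [H.re_apply (hball hq), signedPow, ← mul_div_assoc, ← mul_assoc]
      positivity
    have hmin : IsLocalMin (fun z => c * (h z).re) (meyerson α q₀) := by
      have hm : map (meyersonHomeo hα) (𝓝 q₀) = 𝓝 (meyerson α q₀) :=
        (meyersonHomeo hα).map_nhds_eq q₀
      rw [IsLocalMin, IsMinFilter, ← hm, eventually_map]
      filter_upwards [hBo.mem_nhds (Metric.mem_ball_self hr)] with q hq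
      rw [(H.re_eq_zero_iff hα hq₀).2 hg0, mul_zero]
      exact hnonneg q hq
    have hfd : HasFDerivAt (fun z => c * (h z).re)
        (c • (Complex.reCLM.comp ((ContinuousLinearMap.toSpanSingleton ℂ
          (deriv h (meyerson α q₀))).restrictScalars ℝ))) (meyerson α q₀) :=
      (Complex.reCLM.hasFDerivAt.comp _
        ((H.hasDerivAt hα hΩ hq₀).hasFDerivAt.restrictScalars ℝ)).const_mul c
    have h0 := congrArg (fun A : ℂ →L[ℝ] ℝ => A (starRingEnd ℂ (deriv h (meyerson α q₀))))
      (hmin.hasFDerivAt_eq_zero hfd)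
    have h1 : c * ((starRingEnd ℂ (deriv h (meyerson α q₀))) * deriv h (meyerson α q₀)).re = 0 :=
      h0
    rw [mul_comm (starRingEnd ℂ _), Complex.mul_conj, Complex.ofReal_re, mul_eq_zero,
      Complex.normSq_eq_zero] at h1
    exact h1.elim hc0 (H.deriv_ne_zero q₀ hq₀)
  -- With opposite signs on the two sides, continuity gives both `g₁ ≥ 0` and `g₁ ≤ 0` on the axis.
  filter_upwards [hBo.mem_nhds (Metric.mem_ball_self hr)] with q hq hx
  have h1 := hc2 q hq hx
  have h2 := hd2 q hq hx
  rcases hc with rfl | rfl <;> rcases hd with rfl | rfl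
  · exact absurd rfl hcd
  · linarith
  · linarith
  · exact absurd rfl hcd

/-- The part of the axis mapped to the axis is homeomorphic to its image. -/
theorem IsHomeo.card_connectedComponents {Ω Ω' : Set (ℝ × ℝ)} {g : ℝ × ℝ → ℝ × ℝ}
    (hg : IsHomeo Ω Ω' g) (hz : ∀ q ∈ Ω, (g q).1 = 0 → q.1 = 0) :
    ENat.card (ConnectedComponents {a : ↥(Ω ∩ yAxis) | (g a).1 = 0}) =
      ENat.card (ConnectedComponents ↥(Ω' ∩ yAxis)) := by
  obtain ⟨φ, hφ⟩ := hg
  have hsymm : ∀ w : Ω', g (φ.symm w) = w := fun w => by rw [← hφ, φ.apply_symm_apply]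
  -- The inverse is well defined because a point of `Ω` sent to the axis already lies on it, by
  -- `hz`.
  refine card_connectedComponents_congr
    { toFun := fun a => ⟨φ ⟨a.1.1, a.1.2.1⟩, (φ ⟨a.1.1, a.1.2.1⟩).2, by
        change (φ ⟨a.1.1, a.1.2.1⟩ : ℝ × ℝ).1 = 0
        rw [hφ]; exact a.2⟩
      invFun := fun w => ⟨⟨φ.symm ⟨w.1, w.2.1⟩, (φ.symm ⟨w.1, w.2.1⟩).2,
        hz _ (φ.symm ⟨w.1, w.2.1⟩).2 (by rw [hsymm]; exact w.2.2)⟩, by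
          change (g (φ.symm ⟨w.1, w.2.1⟩)).1 = 0
          rw [hsymm]; exact w.2.2⟩
      left_inv := fun a => by
        refine Subtype.ext (Subtype.ext ?_)
        exact congrArg (Subtype.val : Ω → ℝ × ℝ) (φ.symm_apply_apply ⟨a.1.1, a.1.2.1⟩)
      right_inv := fun w => by
        refine Subtype.ext ?_
        exact congrArg (Subtype.val : Ω' → ℝ × ℝ) (φ.apply_symm_apply ⟨w.1, w.2.1⟩)
      continuous_toFun := by fun_prop
      continuous_invFun := by fun_prop }

/-- The zeros of `g₁` lie on the axis by the critical exponent, and form a clopen subset of `Ω ∩ {x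
= 0}` with as many components as `Ω' ∩ {x = 0}`. Equality of the finite counts leaves no room for a
component without zeros. -/
theorem HolomorphicRep.zeroSet_eq_of_card {α : ℝ} {Ω Ω' : Set (ℝ × ℝ)} {g : ℝ × ℝ → ℝ × ℝ}
    {h : ℂ → ℂ} (H : HolomorphicRep α Ω g h) (hα : 0 < α) (hΩ : IsOpen Ω)
    (hg : IsHomeo Ω Ω' g)
    (h₁ : LocalSobolev α (ENNReal.ofReal (2 * (α + 1) / α)) Ω (fun q => (g q).1))
    [Finite (ConnectedComponents ↥(Ω ∩ yAxis))]
    (hcard : ENat.card (ConnectedComponents ↥(Ω' ∩ yAxis)) =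
      ENat.card (ConnectedComponents ↥(Ω ∩ yAxis))) :
    {q ∈ Ω | (g q).1 = 0} = Ω ∩ yAxis := by
  have hz : ∀ q ∈ Ω, (g q).1 = 0 → q.1 = 0 := fun q hq h0 => H.fst_eq_zero hα hΩ h₁ hq h0
  have hcont : Continuous fun a : ↥(Ω ∩ yAxis) => (g a).1 :=
    continuous_fst.comp (hg.continuousOn.comp_continuous continuous_subtype_val fun a => a.2.1)
  have hclopen : IsClopen {a : ↥(Ω ∩ yAxis) | (g a).1 = 0} := by
    refine ⟨isClosed_eq hcont continuous_const, isOpen_iff_mem_nhds.2 fun a ha => ?_⟩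
    have := H.eventually_fst_eq_zero hα hΩ hg.continuousOn hz a.2.1 ha
    filter_upwards [continuous_subtype_val.continuousAt.eventually this] with b hb
    exact hb b.2.2
  have huniv := eq_univ_of_isClopen_of_card_eq hclopen
    ((hg.card_connectedComponents hz).trans hcard)
  ext q
  constructor
  · rintro ⟨hq, h0⟩
    exact ⟨hq, hz q hq h0⟩
  · intro hq
    have : (⟨q, hq⟩ : ↥(Ω ∩ yAxis)) ∈ {a : ↥(Ω ∩ yAxis) | (g a).1 = 0} := huniv ▸ mem_univ _
    exact ⟨hq.1, this⟩

end Grushin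

/-! ### The theorem -/

theorem theorem1p1 (α : ℝ) (hα : 0 < α) (Ω Ω' : Set (ℝ × ℝ)) (hΩ : IsOpen Ω) (hΩ' : IsOpen Ω')
    (g : ℝ × ℝ → ℝ × ℝ)
    (hg : Grushin.HWloc α (ENNReal.ofReal (2 * (α + 1) / α)) Ω Ω' g) :
    -- (a)
    ((∀ᵐ q ∂(volume.restrict Ω), Grushin.Wbar α Ω g q = 0) →
      ∃ g' : ℝ × ℝ → ℝ × ℝ, (∀ᵐ q ∂(volume.restrict Ω), g q = g' q) ∧
        ContDiffOn ℝ ∞ g' (Grushin.regularSet Ω g') ∧ ContinuousOn g' Ω) ∧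
    -- (b)
    ((BijOn g Ω Ω' → Grushin.OrientationPreserving α Ω Ω' g →
        volume (Grushin.singularSet Ω g) = 0) ∧
      (Grushin.Conformal α Ω Ω' g → Grushin.OrientationPreserving α Ω Ω' g →
        ∀ᵐ q ∂(volume.restrict Ω), Grushin.Wbar α Ω g q = 0)) ∧
    -- (c)
    (Grushin.IsHomeo Ω Ω' g →
      ((Grushin.Conformal α Ω Ω' g ∧ Grushin.OrientationPreserving α Ω Ω' g) ↔
        (∀ᵐ q ∂(volume.restrict Ω), Grushin.Wbar α Ω g q = 0) ∧
          {q ∈ Ω | (g q).1 = 0} = Ω ∩ Grushin.yAxis)) ∧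
    -- (d)
    (Grushin.IsHomeo Ω Ω' g →
      Finite (ConnectedComponents ↥(Ω ∩ Grushin.yAxis)) →
      ((Grushin.Conformal α Ω Ω' g ∧ Grushin.OrientationPreserving α Ω Ω' g) ↔
        (∀ᵐ q ∂(volume.restrict Ω), Grushin.Wbar α Ω g q = 0) ∧
          ENat.card (ConnectedComponents ↥(Ω' ∩ Grushin.yAxis)) =
            ENat.card (ConnectedComponents ↥(Ω ∩ Grushin.yAxis)))) := by
  -- The exponent is `2 + 2/α`. Parts (a) to (c) use only that it is at least 2; its exact value
  -- enters in the backward direction of (d).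
  have hp : (2 : ℝ≥0∞) ≤ ENNReal.ofReal (2 * (α + 1) / α) := by
    rw [← ENNReal.ofReal_ofNat]
    refine ENNReal.ofReal_le_ofReal ?_
    rw [le_div_iff₀ hα]
    linarith
  have h₁ := Grushin.LocalSobolev.of_HWloc_fst hΩ hg
  have h₂ := Grushin.LocalSobolev.of_HWloc_snd hΩ hg
  have hb : Grushin.Conformal α Ω Ω' g → Grushin.OrientationPreserving α Ω Ω' g →
      ∀ᵐ q ∂(volume.restrict Ω), Grushin.Wbar α Ω g q = 0 :=
    Grushin.Conformal.wbar_ae_eq_zero hα hp hΩ h₁ h₂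
  have hfwd : Grushin.IsHomeo Ω Ω' g → Grushin.Conformal α Ω Ω' g →
      Grushin.OrientationPreserving α Ω Ω' g → {q ∈ Ω | (g q).1 = 0} = Ω ∩ Grushin.yAxis :=
    fun hh hc ho => by
      obtain ⟨h, H⟩ := Grushin.exists_holomorphicRep hα hp hΩ h₁ h₂ hh (hb hc ho)
      exact H.zeroSet_eq hα hΩ hc (Grushin.volume_singularSet hΩ h₁ ho)
  have hbwd : Grushin.IsHomeo Ω Ω' g → (∀ᵐ q ∂(volume.restrict Ω), Grushin.Wbar α Ω g q = 0) →
      {q ∈ Ω | (g q).1 = 0} = Ω ∩ Grushin.yAxis →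
      Grushin.Conformal α Ω Ω' g ∧ Grushin.OrientationPreserving α Ω Ω' g :=
    fun hh hW hset => by
      obtain ⟨h, H⟩ := Grushin.exists_holomorphicRep hα hp hΩ h₁ h₂ hh hW
      exact ⟨H.conformal hα hΩ (hg.mono_exponent hΩ hp) hh hset,
        H.orientationPreserving hΩ (hg.mono_exponent hΩ (one_le_two.trans hp)) hset⟩
  refine ⟨Grushin.exists_contDiffOn_representative hα hp hΩ h₁ h₂,
    ⟨fun _ ho => Grushin.volume_singularSet hΩ h₁ ho, hb⟩,
    fun hh => ⟨fun ⟨hc, ho⟩ => ⟨hb hc ho, hfwd hh hc ho⟩, fun ⟨hW, hset⟩ => hbwd hh hW hset⟩,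
    fun hh hfin => ⟨fun ⟨hc, ho⟩ => ⟨hb hc ho, ?_⟩, fun ⟨hW, hcard⟩ => ?_⟩⟩
  · have hset := hfwd hh hc ho
    have hiff : ∀ q ∈ Ω, (g q).1 = 0 ↔ q.1 = 0 := fun q hq => by
      have := Set.ext_iff.1 hset q
      simpa [hq, Grushin.yAxis] using this
    -- Here `g` restricts to a homeomorphism between the two axis parts, because its zero set is the
    -- whole of `Ω ∩ {x = 0}`.
    rw [← hh.card_connectedComponents fun q hq => (hiff q hq).1]
    have huniv : {a : ↥(Ω ∩ Grushin.yAxis) | (g a).1 = 0} = univ :=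
      eq_univ_of_forall fun a => (hiff a a.2.1).2 a.2.2
    rw [huniv]
    exact Grushin.card_connectedComponents_congr (Homeomorph.Set.univ _)
  · obtain ⟨h, H⟩ := Grushin.exists_holomorphicRep hα hp hΩ h₁ h₂ hh hW
    exact hbwd hh hW (H.zeroSet_eq_of_card hα hΩ hh h₁ hcard)
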